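/- **Conventions.** Let $\mathcal A$ be an abelian category. A *subcategory* of $\mathcal A$ is full, additive and closed under isomorphisms; it is *exact* if it is closed under direct summands and extensions. For a subcategory $\mathcal X$, an *$\mathcal X$-resolution* of $M$ is a complex $X=(\cdots\to X_1\to X_0\to 0)$ of objects of $\mathcal X$ with an exact augmented complex $X^+=(\cdots\to X_1\to X_0\to M\to 0)$; it is *proper* if $\mathrm{Hom}(V,X^+)$ is exact for all $V\in\mathcal X$. Set $\mathcal X\text{-pd}(M)=\inf_X\sup\{n\ge 0: X_n\ne 0\}$, over all $\mathcal X$-resolutions $X$ of $M$. A complex $T$ of objects of $\mathcal W$ is *totally $\mathcal W$-acyclic* if $T$, $\mathrm{Hom}(V,T)$ and $\mathrm{Hom}(T,V)$ are exact for all $V\in\mathcal W$; $\mathcal G(\mathcal W)$ is the subcategory of objects isomorphic to $\mathrm{Coker}(T_1\to T_0)$ for such $T$. A *Tate $\mathcal W$-resolution* of $M$ is a diagram $T\xrightarrow{\alpha}W\to M$ with $W\to M$ a proper $\mathcal W$-resolution, $T$ totally $\mathcal W$-acyclic and $\alpha_n$ an isomorphism for $n\gg0$. Set $\mathrm{Ext}^n_{\mathcal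 X}(M,N)=H^n(\mathrm{Hom}(X,N))$ for a proper $\mathcal X$-resolution $X$ of $M$, similarly $\mathrm{Ext}^n_{\mathcal W}(M,N)=H^n(\mathrm{Hom}(W,N))$, and $\widehat{\mathrm{Ext}}{}^n_{\mathcal W}(M,N)=H^n(\mathrm{Hom}(T,N))$. The comparison map $\varepsilon^n:\mathrm{Ext}^n_{\mathcal W}(M,N)\to\widehat{\mathrm{Ext}}{}^n_{\mathcal W}(M,N)$ is $H^n(\mathrm{Hom}(\alpha,N))$; if $\mathcal W\subseteq\mathcal X$, the map $\vartheta^n:\mathrm{Ext}^n_{\mathcal X}(M,N)\to\mathrm{Ext}^n_{\mathcal W}(M,N)$ is induced by a lifting $W\to X$ of $\mathrm{id}_M$. A morphism $f:M\to M'$ acts on these groups through liftings $W\to W'$ and $X\to X'$ of $f$ and through a morphism $T\to T'$ that is compatible, up to homotopy, with $\alpha$, $\alpha'$ and the lifting $W\to W'$. **Theorem (abstract form).** Let $\mathcal W\subseteq\mathcal X$ be subcategories of $\mathcal A$, with $\mathcal X$ exact and closed under kernels of epimorphisms and $\mathcal W$ closed under direct summands. Assume that $\mathcal W$ is an injective cogenerator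 for $\mathcal X$ (every $X\in\mathcal X$ has an exact sequence $0\to X\to W\to X'\to0$ with $W\in\mathcal W$, $X'\in\mathcal X$, and $\mathrm{Ext}^{\ge1}_{\mathcal A}(X,W)=0$ for all $X\in\mathcal X$, $W\in\mathcal W$) and a projective generator for $\mathcal X$ (the dual condition). Then each object $M$ with $\mathcal X\text{-pd}(M)<\infty$ has a proper $\mathcal X$-resolution and a Tate $\mathcal W$-resolution; the liftings above exist and are unique up to homotopy; and if $d=\mathcal X\text{-pd}(M)<\infty$ and $N\in\mathcal A$, there is a long exact sequence $$0\to \mathrm{Ext}^1_{\mathcal X}(M,N)\xrightarrow{\vartheta^1}\mathrm{Ext}^1_{\mathcal W}(M,N)\xrightarrow{\varepsilon^1}\widehat{\mathrm{Ext}}{}^1_{\mathcal W}(M,N)\xrightarrow{\delta^1}\mathrm{Ext}^2_{\mathcal X}(M,N)\to\cdots\to \mathrm{Ext}^d_{\mathcal X}(M,N)\xrightarrow{\vartheta^d}\mathrm{Ext}^d_{\mathcal W}(M,N)\xrightarrow{\varepsilon^d}\widehat{\mathrm{Ext}}{}^d_{\mathcal W}(M,N)\to0$$ that is natural in $M$ (among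 objects with $\mathcal X\text{-pd}<\infty$) and in $N$, independently of the choices of resolutions and liftings. Moreover $\varepsilon^n$ is an isomorphism for each $n>d$. **Theorem B.** Let $R$ be a commutative ring and let $C$ be a semidualizing $R$-module, that is, $C$ has a (possibly unbounded) resolution by free modules of finite rank, the homothety map $R\to\mathrm{Hom}_R(C,C)$ is an isomorphism, and $\mathrm{Ext}^{\ge1}_R(C,C)=0$. Let $\mathcal P_C$ be the subcategory of $R$-modules isomorphic to $P\otimes_R C$ with $P$ projective. Then all the conclusions above hold for $\mathcal W=\mathcal P_C$ and $\mathcal X=\mathcal G(\mathcal P_C)$ in the category of $R$-modules: if $d=\mathcal G(\mathcal P_C)\text{-pd}(M)<\infty$, there is a long exact sequence, natural in $M$ and $N$, $$0\to \mathrm{Ext}^1_{\mathcal G(\mathcal P_C)}(M,N)\to\mathrm{Ext}^1_{\mathcal P_C}(M,N)\to\widehat{\mathrm{Ext}}{}^1_{\mathcal P_C}(M,N)\to\mathrm{Ext}^2_{\mathcal G(\mathcal P_C)}(M,N)\to\cdots\to\mathrm{Ext}^d_{\mathcal P_C}(M,N)\to\widehat{\mathrm{Ext}}{}^d_{\mathcal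 P_C}(M,N)\to0,$$ and the comparison maps $\mathrm{Ext}^n_{\mathcal P_C}(M,N)\to\widehat{\mathrm{Ext}}{}^n_{\mathcal P_C}(M,N)$ are isomorphisms for $n>d$. -/

import Mathlib

open CategoryTheory CategoryTheory.Limits TensorProduct

universe u v w r

namespace TateCohomology

noncomputable section

section Abelian

variable {A : Type u} [Category.{v} A] [Abelian A]

/-! ### Subcategories of an abelian category -/

/-- Subcategories are full, closed under isomorphisms, and additive
(it contains zero and is closed under finite direct sums). A full subcategory is given by the
property of its objects. -/
structure IsAdditiveSubcategory (P : ObjectProperty A) : Prop where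
  iso : P.IsClosedUnderIsomorphisms
  zero : P.ContainsZero
  biprod : ∀ X Y : A, P X → P Y → P (X ⊞ Y)

/-- A subcategory is exact if it is closed under direct summands and extensions. -/
structure IsExactSubcategory (P : ObjectProperty A) : Prop
    extends IsAdditiveSubcategory P where
  summands : P.IsStableUnderRetracts
  extensions : P.IsClosedUnderExtensions

/-- Closure under kernels of epimorphisms. -/
def ClosedUnderKernelsOfEpis (P : ObjectProperty A) : Prop :=
  ∀ S : ShortComplex A, S.ShortExact → P S.X₂ → P S.X₃ → P S.X₁

/-- `P ⟂ Q`: `Ext^n(X, Y) = 0` for all `n ≥ 1`, `X` in `P` and `Y` in `Q`. -/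
def Perp [HasExt.{w} A] (P Q : ObjectProperty A) : Prop :=
  ∀ X Y : A, P X → Q Y → ∀ n : ℕ, 1 ≤ n → Subsingleton (Abelian.Ext.{w} X Y n)

/-- `𝒲` is an injective cogenerator for `𝒳`: every `X` in `𝒳` sits in an exact sequence
`0 → X → W → X' → 0` with `W` in `𝒲` and `X'` in `𝒳`, and `𝒳 ⟂ 𝒲`. -/
structure IsInjectiveCogenerator [HasExt.{w} A] (𝒲 𝒳 : ObjectProperty A) : Prop where
  exists_shortExact : ∀ X : A, 𝒳 X →
    ∃ (W X' : A) (i : X ⟶ W) (p : W ⟶ X') (h : i ≫ p = 0),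
      (ShortComplex.mk i p h).ShortExact ∧ 𝒲 W ∧ 𝒳 X'
  perp : Perp.{u, v, w} 𝒳 𝒲

/-- `𝒲` is a projective generator for `𝒳`: every `X` in `𝒳` sits in an exact sequence
`0 → X' → W → X → 0` with `W` in `𝒲` and `X'` in `𝒳`, and `𝒲 ⟂ 𝒳`. -/
structure IsProjectiveGenerator [HasExt.{w} A] (𝒲 𝒳 : ObjectProperty A) : Prop where
  exists_shortExact : ∀ X : A, 𝒳 X →
    ∃ (X' W : A) (i : X' ⟶ W) (p : W ⟶ X) (h : i ≫ p = 0),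
      (ShortComplex.mk i p h).ShortExact ∧ 𝒲 W ∧ 𝒳 X'
  perp : Perp.{u, v, w} 𝒲 𝒳

/-! ### Resolutions and relative projective dimension -/

/-- A `P`-resolution of `M`: a complex `⋯ → X₁ → X₀ → 0` of objects of `P` (indexed by `ℤ`, zero
in negative degrees) with an augmentation `π : X₀ ⟶ M` such that `⋯ → X₁ → X₀ → M → 0` is
exact. -/
structure Resolution (P : ObjectProperty A) (M : A) where
  /-- the complex -/
  cx : ChainComplex A ℤ
  mem : ∀ n, P (cx.X n)
  isZero : ∀ n < 0, IsZero (cx.X n)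
  /-- the augmentation -/
  π : cx.X 0 ⟶ M
  d_π : cx.d 1 0 ≫ π = 0
  exact_pos : ∀ n, 0 < n → cx.ExactAt n
  exact_zero : (ShortComplex.mk (cx.d 1 0) π d_π).Exact
  epi_π : Epi π

/-- `sup {n ≥ 0 | X_n ≠ 0}`. -/
def Resolution.length {P : ObjectProperty A} {M : A} (X : Resolution P M) : ℕ∞ :=
  ⨆ (n : ℕ) (_ : ¬ IsZero (X.cx.X n)), (n : ℕ∞)

/-- The `P`-projective dimension of `M`: the infimum of the lengths of its `P`-resolutions
(`⊤` if there is no resolution of finite length). -/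
def relPd (P : ObjectProperty A) (M : A) : ℕ∞ :=
  ⨅ X : Resolution P M, X.length

/-- A `P`-resolution is proper if for every `V` in `P` the functor `Hom(V, -)` takes the augmented
resolution `⋯ → X₁ → X₀ → M → 0` to an exact sequence. -/
structure ProperResolution (P : ObjectProperty A) (M : A) extends Resolution P M where
  hom_exact_pos : ∀ V, P V → ∀ n : ℤ, 0 < n → ∀ f : V ⟶ cx.X n,
    f ≫ cx.d n (n - 1) = 0 → ∃ g : V ⟶ cx.X (n + 1), g ≫ cx.d (n + 1) n = f
  hom_exact_zero : ∀ V, P V → ∀ f : V ⟶ cx.X 0,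
    f ≫ π = 0 → ∃ g : V ⟶ cx.X 1, g ≫ cx.d 1 0 = f
  hom_surjective : ∀ V, P V → ∀ f : V ⟶ M, ∃ g : V ⟶ cx.X 0, g ≫ π = f

/-- A complex is totally `P`-acyclic: it is an exact complex of objects of `P`, and for every `V`
in `P` the complexes `Hom(V, K)` and `Hom(K, V)` are exact. -/
structure IsTotallyAcyclic (P : ObjectProperty A) (K : ChainComplex A ℤ) : Prop where
  mem : ∀ n, P (K.X n)
  acyclic : K.Acyclic
  hom_from : ∀ V, P V → ∀ (n : ℤ) (f : V ⟶ K.X n),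
    f ≫ K.d n (n - 1) = 0 → ∃ g : V ⟶ K.X (n + 1), g ≫ K.d (n + 1) n = f
  hom_to : ∀ V, P V → ∀ (n : ℤ) (f : K.X n ⟶ V),
    K.d (n + 1) n ≫ f = 0 → ∃ g : K.X (n - 1) ⟶ V, K.d n (n - 1) ≫ g = f

/-- The subcategory `𝒢(P)`: the objects isomorphic to `Coker(K₁ → K₀)` for some totally
`P`-acyclic complex `K`. -/
def gorenstein (P : ObjectProperty A) : ObjectProperty A := fun M =>
  ∃ K : ChainComplex A ℤ, IsTotallyAcyclic P K ∧ Nonempty (M ≅ cokernel (K.d 1 0))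

/-- A Tate `P`-resolution `T → W → M`: `W → M` is a proper `P`-resolution, `T` is totally
`P`-acyclic, and `α : T ⟶ W` is an isomorphism in all large degrees. -/
structure TateResolution (P : ObjectProperty A) (M : A) where
  /-- the proper resolution `W → M` -/
  W : ProperResolution P M
  /-- the totally acyclic complex -/
  T : ChainComplex A ℤ
  totallyAcyclic : IsTotallyAcyclic P T
  /-- the comparison morphism -/
  α : T ⟶ W.cx
  isIso_α : ∃ m : ℤ, ∀ n, m ≤ n → IsIso (α.f n)

/-! ### Liftings -/

/-- `φ : X ⟶ Y` is a lifting of `f : M ⟶ M'` to resolutions `X → M` and `Y → M'`. -/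
def Resolution.IsLift {P Q : ObjectProperty A} {M M' : A} (X : Resolution P M)
    (Y : Resolution Q M') (f : M ⟶ M') (φ : X.cx ⟶ Y.cx) : Prop :=
  φ.f 0 ≫ Y.π = X.π ≫ f

/-- `φ : W ⟶ W'` and `ψ : T ⟶ T'` are liftings of `f : M ⟶ M'` to Tate resolutions:
`φ` lifts `f`, and the square formed by `ψ`, `φ` and the comparison morphisms `T ⟶ W`,
`T' ⟶ W'` commutes up to homotopy. -/
structure TateResolution.IsLift {P : ObjectProperty A} {M M' : A} (τ : TateResolution P M)
    (τ' : TateResolution P M') (f : M ⟶ M') (φ : τ.W.cx ⟶ τ'.W.cx) (ψ : τ.T ⟶ τ'.T) :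
    Prop where
  lift : τ.W.IsLift τ'.W.toResolution f φ
  comm : Nonempty (Homotopy (ψ ≫ τ'.α) (τ.α ≫ φ))

/-! ### Cohomology of `Hom(K, N)` -/

/-- The complex of abelian groups `Hom(K, N)`, with `Hom(K_n, N)` in cohomological degree `n`. -/
def homComplex (K : ChainComplex A ℤ) (N : A) :
    HomologicalComplex AddCommGrpCat.{v} (ComplexShape.down ℤ).symm :=
  ((preadditiveYoneda.obj N).mapHomologicalComplex _).obj K.op

/-- The cohomology group `Hⁿ(Hom(K, N)) = H_{-n}(Hom(K, N))`. If `K` is a proper `𝒳`-resolution of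
`M` this is the relative cohomology group `Extⁿ_𝒳(M, N)`; if `K` is the totally acyclic complex
of a Tate `𝒲`-resolution of `M` this is the Tate cohomology group of `M` and `N`. -/
def ext (K : ChainComplex A ℤ) (N : A) (n : ℤ) : AddCommGrpCat.{v} :=
  (homComplex K N).homology n

/-- The map `Hⁿ(Hom(φ, N)) : Hⁿ(Hom(K', N)) → Hⁿ(Hom(K, N))`. -/
def extMapLeft {K K' : ChainComplex A ℤ} (φ : K ⟶ K') (N : A) (n : ℤ) :
    ext K' N n ⟶ ext K N n :=
  HomologicalComplex.homologyMap
    (((preadditiveYoneda.obj N).mapHomologicalComplex _).map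
      ((HomologicalComplex.opFunctor A (ComplexShape.down ℤ)).map φ.op)) n

/-- The map `Hⁿ(Hom(K, g)) : Hⁿ(Hom(K, N)) → Hⁿ(Hom(K, N'))`. -/
def extMapRight (K : ChainComplex A ℤ) {N N' : A} (g : N ⟶ N') (n : ℤ) :
    ext K N n ⟶ ext K N' n :=
  HomologicalComplex.homologyMap
    ((NatTrans.mapHomologicalComplex (preadditiveYoneda.map g) _).app K.op) n

/-! ### Long exact sequences and their morphisms -/

/-- Exactness of the sequence
`0 → E¹ → F¹ → G¹ → E² → F² → G² → ⋯ → Eᵈ → Fᵈ → Gᵈ → 0`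
(which is empty for `d = 0`). -/
structure IsLongExact (d : ℤ) {E F G : ℤ → AddCommGrpCat.{v}} (θ : ∀ n, E n ⟶ F n)
    (ε : ∀ n, F n ⟶ G n) (δ : ∀ n, G n ⟶ E (n + 1)) : Prop where
  injective : 1 ≤ d → Function.Injective (θ 1)
  exact_F : ∀ n, 1 ≤ n → n ≤ d → Function.Exact (θ n) (ε n)
  exact_G : ∀ n, 1 ≤ n → n < d → Function.Exact (ε n) (δ n)
  exact_E : ∀ n, 1 ≤ n → n < d → Function.Exact (δ n) (θ (n + 1))
  surjective : 1 ≤ d → Function.Surjective (ε d)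

/-- The families `a`, `b`, `c` form a morphism, in degrees `n ≥ 1`, from the sequence
`⋯ → Eⁿ → Fⁿ → Gⁿ → Eⁿ⁺¹ → ⋯` to the sequence `⋯ → E'ⁿ → F'ⁿ → G'ⁿ → E'ⁿ⁺¹ → ⋯`. -/
structure IsLadder {E F G E' F' G' : ℤ → AddCommGrpCat.{v}}
    (θ : ∀ n, E n ⟶ F n) (ε : ∀ n, F n ⟶ G n) (δ : ∀ n, G n ⟶ E (n + 1))
    (θ' : ∀ n, E' n ⟶ F' n) (ε' : ∀ n, F' n ⟶ G' n) (δ' : ∀ n, G' n ⟶ E' (n + 1))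
    (a : ∀ n, E n ⟶ E' n) (b : ∀ n, F n ⟶ F' n) (c : ∀ n, G n ⟶ G' n) : Prop where
  comm_θ : ∀ n, 1 ≤ n → θ n ≫ b n = a n ≫ θ' n
  comm_ε : ∀ n, 1 ≤ n → ε n ≫ c n = b n ≫ ε' n
  comm_δ : ∀ n, 1 ≤ n → δ n ≫ a (n + 1) = c n ≫ δ' n

/-- The groups and maps in the comparison sequence are defined, for objects of finite
`𝒳`-projective dimension: the resolutions exist, morphisms lift to them, and the liftings are
unique up to homotopy. -/
structure CohomologyWellDefined (𝒲 𝒳 : ObjectProperty A) : Prop where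
  exists_tate : ∀ M : A, relPd 𝒳 M < ⊤ → Nonempty (TateResolution 𝒲 M)
  exists_proper : ∀ M : A, relPd 𝒳 M < ⊤ → Nonempty (ProperResolution 𝒳 M)
  exists_tate_lift : ∀ {M M' : A} (f : M ⟶ M') (τ : TateResolution 𝒲 M)
    (τ' : TateResolution 𝒲 M'), ∃ φ ψ, τ.IsLift τ' f φ ψ
  tate_lift_unique : ∀ {M M' : A} (f : M ⟶ M') (τ : TateResolution 𝒲 M)
    (τ' : TateResolution 𝒲 M') (φ₁ φ₂ : τ.W.cx ⟶ τ'.W.cx) (ψ₁ ψ₂ : τ.T ⟶ τ'.T),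
    τ.IsLift τ' f φ₁ ψ₁ → τ.IsLift τ' f φ₂ ψ₂ →
      Nonempty (Homotopy φ₁ φ₂) ∧ Nonempty (Homotopy ψ₁ ψ₂)
  exists_proper_lift : ∀ {M M' : A} (f : M ⟶ M') (ξ : ProperResolution 𝒳 M)
    (ξ' : ProperResolution 𝒳 M'), ∃ χ, ξ.IsLift ξ'.toResolution f χ
  proper_lift_unique : ∀ {M M' : A} (f : M ⟶ M') (ξ : ProperResolution 𝒳 M)
    (ξ' : ProperResolution 𝒳 M') (χ₁ χ₂ : ξ.cx ⟶ ξ'.cx),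
    ξ.IsLift ξ'.toResolution f χ₁ → ξ.IsLift ξ'.toResolution f χ₂ → Nonempty (Homotopy χ₁ χ₂)
  exists_compare : ∀ {M : A} (τ : TateResolution 𝒲 M) (ξ : ProperResolution 𝒳 M),
    ∃ κ, τ.W.IsLift ξ.toResolution (𝟙 M) κ
  compare_unique : ∀ {M : A} (τ : TateResolution 𝒲 M) (ξ : ProperResolution 𝒳 M)
    (κ₁ κ₂ : τ.W.cx ⟶ ξ.cx), τ.W.IsLift ξ.toResolution (𝟙 M) κ₁ →
      τ.W.IsLift ξ.toResolution (𝟙 M) κ₂ → Nonempty (Homotopy κ₁ κ₂)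

/-- The long exact comparison sequence, natural in `M` and `N`. For a Tate `𝒲`-resolution
`τ : T → W → M`, a proper `𝒳`-resolution `ξ : X → M` and a lifting `κ : W → X` of the identity of
`M`, the maps are `θⁿ = Hⁿ(Hom(κ, N)) : Extⁿ_𝒳(M, N) → Extⁿ_𝒲(M, N)`, the comparison map `εⁿ =
Hⁿ(Hom(α, N))` from `Extⁿ_𝒲(M, N)` to Tate cohomology, and the connecting map `δⁿ`. Naturality is
with respect to all choices of resolutions and liftings. -/
structure ComparisonSequence (𝒲 𝒳 : ObjectProperty A) where
  /-- the connecting homomorphisms -/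
  δ : ∀ {M : A} (_ : relPd 𝒳 M < ⊤) (τ : TateResolution 𝒲 M) (ξ : ProperResolution 𝒳 M) (N : A)
    (n : ℤ), ext τ.T N n ⟶ ext ξ.cx N (n + 1)
  exact : ∀ {M : A} (d : ℕ) (_ : relPd 𝒳 M = d) (hM : relPd 𝒳 M < ⊤) (τ : TateResolution 𝒲 M)
    (ξ : ProperResolution 𝒳 M) (κ : τ.W.cx ⟶ ξ.cx) (N : A),
    τ.W.IsLift ξ.toResolution (𝟙 M) κ →
      IsLongExact d (extMapLeft κ N) (extMapLeft τ.α N) (δ hM τ ξ N)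
  isIso : ∀ {M : A} (d : ℕ) (_ : relPd 𝒳 M = d) (τ : TateResolution 𝒲 M) (N : A) (n : ℤ),
    d < n → IsIso (extMapLeft τ.α N n)
  natural_right : ∀ {M : A} (hM : relPd 𝒳 M < ⊤) (τ : TateResolution 𝒲 M)
    (ξ : ProperResolution 𝒳 M) (κ : τ.W.cx ⟶ ξ.cx) {N N' : A} (g : N ⟶ N'),
    τ.W.IsLift ξ.toResolution (𝟙 M) κ →
      IsLadder (extMapLeft κ N) (extMapLeft τ.α N) (δ hM τ ξ N)
        (extMapLeft κ N') (extMapLeft τ.α N') (δ hM τ ξ N')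
        (extMapRight ξ.cx g) (extMapRight τ.W.cx g) (extMapRight τ.T g)
  natural_left : ∀ {M M' : A} (hM : relPd 𝒳 M < ⊤) (hM' : relPd 𝒳 M' < ⊤) (f : M ⟶ M')
    (τ : TateResolution 𝒲 M) (ξ : ProperResolution 𝒳 M) (κ : τ.W.cx ⟶ ξ.cx)
    (τ' : TateResolution 𝒲 M') (ξ' : ProperResolution 𝒳 M') (κ' : τ'.W.cx ⟶ ξ'.cx)
    (φ : τ.W.cx ⟶ τ'.W.cx) (ψ : τ.T ⟶ τ'.T) (χ : ξ.cx ⟶ ξ'.cx) (N : A),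
    τ.W.IsLift ξ.toResolution (𝟙 M) κ → τ'.W.IsLift ξ'.toResolution (𝟙 M') κ' →
    τ.IsLift τ' f φ ψ → ξ.IsLift ξ'.toResolution f χ →
      IsLadder (extMapLeft κ' N) (extMapLeft τ'.α N) (δ hM' τ' ξ' N)
        (extMapLeft κ N) (extMapLeft τ.α N) (δ hM τ ξ N)
        (extMapLeft χ N) (extMapLeft φ N) (extMapLeft ψ N)

end Abelian

/-! ### Semidualizing modules -/

section Modules

variable {R : Type r} [CommRing R]

/-- The free modules of finite rank. -/
def finiteFree (R : Type r) [CommRing R] : ObjectProperty (ModuleCat.{r} R) :=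
  fun F => Module.Finite R F ∧ Module.Free R F

/-- `C` is semidualizing: it has a (possibly unbounded) resolution by free modules of finite rank,
the homothety map `R → Hom_R(C, C)` is an isomorphism, and `Ext^n_R(C, C) = 0` for `n ≥ 1`. -/
structure IsSemidualizing (C : ModuleCat.{r} R) : Prop where
  resolution : Nonempty (Resolution (finiteFree R) C)
  homothety : Function.Bijective (LinearMap.lsmul R C)
  ext_eq_zero : ∀ n : ℕ, 1 ≤ n → Subsingleton (Abelian.Ext.{r} C C n)

/-- The subcategory `𝒫_C(R)` of modules isomorphic to `P ⊗_R C` with `P` projective. -/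
def cProjective (C : ModuleCat.{r} R) : ObjectProperty (ModuleCat.{r} R) := fun M =>
  ∃ P : ModuleCat.{r} R, Module.Projective R P ∧ Nonempty (M ≃ₗ[R] P ⊗[R] C)

end Modules

end

end TateCohomology

open TateCohomology

/-!
The comparison of relative and Tate cohomology rests on a single diagram. Suppose that `𝒲` is both
an injective cogenerator and a projective generator for a class `𝒳` closed under extensions, and
that `M` has finite `𝒳`-projective dimension `d`. The approximation argument of Auslander and
Buchweitz (`exists_approximation`) turns a finite `𝒳`-resolution of `M` into a short exact sequence
`0 → K → G → M → 0` with `G` in `𝒳` and `K` of finite `𝒲`-resolution dimension. Hence `M` has a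
proper `𝒳`-resolution `X` of length at most `d` with `X₀ = G` and `Xₙ` in `𝒲` for `n ≥ 1`
(`exists_properResolution`). The generator and cogenerator sequences, spliced together, make `G` a
syzygy of a totally `𝒲`-acyclic complex `T` (`exists_complete_resolution`).

Since the `Xₙ` with `n ≥ 1` belong to `𝒲`, the differential of `X` lifts along `T₀ → G` to a family
`u : Xₙ₊₁ → Tₙ`, and `u` is the gluing datum of a complex `W` with `W₀ = T₀` and `Wₙ = Tₙ ⊕ Xₙ` for
`n ≥ 1`. An element chase shows that `W` is a proper `𝒲`-resolution of `M`
(`exists_splitComparison`). Then `T → W → M` is a Tate resolution and `T → W → X` is degreewise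
split exact in degrees `≥ 1`. The comparison sequence is the long exact sequence of `Hom(-, N)`,
with connecting map "precomposition with `u`"; the behaviour in degree `0` gives injectivity of its
first map, and `Xₙ = 0` for `n > d` gives surjectivity of its last map and the isomorphisms beyond
`d` (`SplitComparison.isLongExact`, `SplitComparison.isIso_ε`).

Only special resolutions carry such a splitting, so the connecting map for arbitrary choices is
transported along liftings. That this is consistent and natural in `M` comes down to the naturality
of the connecting maps of two split diagrams, `SplitComparison.δ_natural_left`: the two homotopies
that are available combine to a family `Tₙ → X'ₙ₊₁` that anticommutes with the differentials, and
properness of `X'`, tested on `X₀` and on the `Tₙ`, contracts that family. Liftings exist and are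
unique up to homotopy by the usual recursions, upwards for proper resolutions and downwards for
totally acyclic complexes.

For semidualizing modules, `𝒫_C` consists of the direct summands of the modules `C^(J)`, and the
finite free resolution of `C` shows that `Ext^{≥1}(C, C) = 0` implies `Ext^{≥1}(𝒫_C, 𝒫_C) = 0`
(`perp_cProjective`). For a self-orthogonal additive `𝒲`, the class `𝒢(𝒲)` is orthogonal to `𝒲` on
both sides, has `𝒲` as generator and cogenerator, and is closed under extensions by the horseshoe
lemma and its dual, so the abstract form applies to `𝒲` and `𝒢(𝒲)`.
-/

namespace TateCohomology

noncomputable section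

/-! ### Recursion along the integers -/

section Recursion

variable {F : ℤ → Type*} (R : ∀ n, F n → F (n + 1) → Prop)

/-- Upward dependent choice along `ℤ`: a family can be changed above `m` so that it satisfies the
relation `R` from `m` on. -/
theorem exists_extend_up (m : ℤ) (s₀ : ∀ n, F n)
    (step : ∀ n, m ≤ n → ∀ s : ∀ k, F k, (∀ k ≤ m, s k = s₀ k) →
      (∀ k, m ≤ k → k < n → R k (s k) (s (k + 1))) → ∃ y, R n (s n) y) :
    ∃ s : ∀ n, F n, (∀ k ≤ m, s k = s₀ k) ∧ ∀ k, m ≤ k → R k (s k) (s (k + 1)) := by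
  let S (j : ℕ) := {s : ∀ n, F n //
    (∀ k ≤ m, s k = s₀ k) ∧ ∀ k, m ≤ k → k < m + j → R k (s k) (s (k + 1))}
  have next : ∀ j (s : S j), ∃ t : S (j + 1), ∀ k ≤ m + j, t.1 k = s.1 k := by
    rintro j ⟨s, hs, hR⟩
    obtain ⟨y, hy⟩ := step (m + j) (by lia) s hs hR
    have key : ∀ k ≤ m + j, Function.update s (m + j + 1) y k = s k := fun k hk =>
      Function.update_of_ne (by lia) _ _
    refine ⟨⟨Function.update s (m + j + 1) y, fun k hk => ?_, fun k hmk hk => ?_⟩, key⟩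
    · rw [key k (by lia), hs k hk]
    · rcases eq_or_ne k (m + j) with rfl | hne
      · rw [key _ le_rfl, Function.update_self]
        exact hy
      · rw [key k (by push_cast at hk; lia), key (k + 1) (by push_cast at hk; lia)]
        exact hR k hmk (by push_cast at hk; lia)
  choose nxt hnxt using next
  let T : ∀ j, S j := fun j => Nat.rec ⟨s₀, fun _ _ => rfl, fun k _ hk => by simp at hk; lia⟩
    (fun j s => nxt j s) j
  have hT : ∀ j : ℕ, ∀ k ≤ m + j, (T (j + 1)).1 k = (T j).1 k := fun j k hk => hnxt j (T j) k hk
  refine ⟨fun k => (T (k - m).toNat).1 k, fun k hk => (T _).2.1 k hk, fun k hk => ?_⟩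
  have e : (k + 1 - m).toNat = (k - m).toNat + 1 := by lia
  beta_reduce
  rw [e, ← hT (k - m).toNat k (by lia)]
  exact (T ((k - m).toNat + 1)).2.2 k hk (by push_cast; lia)

/-- Downward dependent choice along `ℤ`: a family that satisfies the relation `R` from `m` on can
be changed below `m` so that it satisfies `R` everywhere. -/
theorem exists_extend_down (m : ℤ) (s₀ : ∀ n, F n) (h₀ : ∀ n, m ≤ n → R n (s₀ n) (s₀ (n + 1)))
    (step : ∀ n < m, ∀ s : ∀ k, F k, (∀ k, m ≤ k → s k = s₀ k) →
      (∀ k, n < k → R k (s k) (s (k + 1))) → ∃ y, R n y (s (n + 1))) :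
    ∃ s : ∀ n, F n, (∀ k, m ≤ k → s k = s₀ k) ∧ ∀ k, R k (s k) (s (k + 1)) := by
  let S (j : ℕ) := {s : ∀ n, F n //
    (∀ k, m ≤ k → s k = s₀ k) ∧ ∀ k, m - j ≤ k → R k (s k) (s (k + 1))}
  have next : ∀ j (s : S j), ∃ t : S (j + 1), ∀ k, m - j ≤ k → t.1 k = s.1 k := by
    rintro j ⟨s, hs, hR⟩
    obtain ⟨y, hy⟩ := step (m - j - 1) (by lia) s hs (fun k hk => hR k (by lia))
    have key : ∀ k, m - j ≤ k → Function.update s (m - j - 1) y k = s k := fun k hk =>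
      Function.update_of_ne (by lia) _ _
    refine ⟨⟨Function.update s (m - j - 1) y, fun k hk => ?_, fun k hk => ?_⟩, key⟩
    · rw [key k (by lia), hs k hk]
    · rcases eq_or_ne k (m - j - 1) with rfl | hne
      · rw [key (m - j - 1 + 1) (by lia), Function.update_self]
        exact hy
      · rw [key k (by push_cast at hk; lia), key (k + 1) (by push_cast at hk; lia)]
        exact hR k (by push_cast at hk; lia)
  choose nxt hnxt using next
  let T : ∀ j, S j := fun j => Nat.rec ⟨s₀, fun _ _ => rfl, fun k hk => h₀ k (by simpa using hk)⟩
    (fun j s => nxt j s) j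
  have hT : ∀ j : ℕ, ∀ k, m - j ≤ k → (T (j + 1)).1 k = (T j).1 k :=
    fun j k hk => hnxt j (T j) k hk
  refine ⟨fun k => (T (m - k).toNat).1 k, fun k hk => (T _).2.1 k hk, fun k => ?_⟩
  rcases lt_or_ge k m with hk | hk
  · have e : (m - k).toNat = (m - (k + 1)).toNat + 1 := by lia
    beta_reduce
    rw [e, ← hT (m - (k + 1)).toNat (k + 1) (by lia)]
    exact (T ((m - (k + 1)).toNat + 1)).2.2 k (by push_cast; lia)
  · have e : (m - (k + 1)).toNat = (m - k).toNat := by lia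
    beta_reduce
    rw [e]
    exact (T _).2.2 k (by lia)

end Recursion

section Families

variable {A : Type u} [Category.{v} A] [Abelian A]

/-- Upward solution of `g (n + 1) ≫ d = ε • d ≫ g n + c n` for a family of morphisms
`g n : K.X n ⟶ L.X (a n)` between chain complexes. With `a n = n`, `c = 0` and `ε = 1` the
solutions are the morphisms of complexes, with `a n = n + 1` and `ε = -1` they are the
null-homotopies of `c`. -/
theorem exists_family_up (K L : ChainComplex A ℤ) (a : ℤ → ℤ) (ha : ∀ n, a (n + 1) = a n + 1)
    (ε : ℤ) (c : ∀ n, K.X (n + 1) ⟶ L.X (a n)) (m : ℤ) (g₀ : ∀ n, K.X n ⟶ L.X (a n))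
    (h₁ : ∀ j, (ε • K.d (m + 1) m ≫ g₀ m + c m) ≫ L.d (a m) j = 0)
    (hc : ∀ n, m ≤ n →
      c (n + 1) ≫ L.d (a (n + 1)) (a n) + ε • K.d (n + 1 + 1) (n + 1) ≫ c n = 0)
    (lift : ∀ n, m ≤ n → ∀ f : K.X (n + 1) ⟶ L.X (a n), (∀ j, f ≫ L.d (a n) j = 0) →
      ∃ g : K.X (n + 1) ⟶ L.X (a (n + 1)), g ≫ L.d (a (n + 1)) (a n) = f) :
    ∃ g : ∀ n, K.X n ⟶ L.X (a n), (∀ n ≤ m, g n = g₀ n) ∧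
      ∀ n, m ≤ n → g (n + 1) ≫ L.d (a (n + 1)) (a n) = ε • K.d (n + 1) n ≫ g n + c n := by
  refine exists_extend_up (F := fun n => K.X n ⟶ L.X (a n))
    (fun n x y => y ≫ L.d (a (n + 1)) (a n) = ε • K.d (n + 1) n ≫ x + c n)
    m g₀ fun n hn g hg hR => lift n hn _ fun j => ?_
  rcases eq_or_lt_of_le hn with rfl | hlt
  · rw [hg _ le_rfl]
    exact h₁ j
  · obtain ⟨k, rfl⟩ : ∃ k, n = k + 1 := ⟨n - 1, by lia⟩
    by_cases hj : j + 1 = a (k + 1)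
    · obtain rfl : j = a k := by have := ha k; lia
      rw [Preadditive.add_comp, Preadditive.zsmul_comp, Category.assoc, hR k (by lia) (by lia),
        Preadditive.comp_add, Preadditive.comp_zsmul, K.d_comp_d_assoc, zero_comp, smul_zero,
        zero_add]
      exact (add_comm _ _).trans (hc k (by lia))
    · rw [L.shape _ _ (by simpa using hj), comp_zero]

/-- Downward solution of `g (n + 1) ≫ d = ε • d ≫ g n + c n`, where `ε = ± 1`. -/
theorem exists_family_down (K L : ChainComplex A ℤ) (a : ℤ → ℤ) (ε : ℤ) (hε : ε * ε = 1)
    (c : ∀ n, K.X (n + 1) ⟶ L.X (a n)) (m : ℤ) (g₀ : ∀ n, K.X n ⟶ L.X (a n))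
    (h₀ : ∀ n, m ≤ n → g₀ (n + 1) ≫ L.d (a (n + 1)) (a n) = ε • K.d (n + 1) n ≫ g₀ n + c n)
    (hc : ∀ n, n < m →
      c (n + 1) ≫ L.d (a (n + 1)) (a n) + ε • K.d (n + 1 + 1) (n + 1) ≫ c n = 0)
    (lift : ∀ n, n < m → ∀ f : K.X (n + 1) ⟶ L.X (a n),
      (∀ j, K.d j (n + 1) ≫ f = 0) → ∃ g : K.X n ⟶ L.X (a n), K.d (n + 1) n ≫ g = f) :
    ∃ g : ∀ n, K.X n ⟶ L.X (a n), (∀ n, m ≤ n → g n = g₀ n) ∧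
      ∀ n, g (n + 1) ≫ L.d (a (n + 1)) (a n) = ε • K.d (n + 1) n ≫ g n + c n := by
  refine exists_extend_down (F := fun n => K.X n ⟶ L.X (a n))
    (fun n x y => y ≫ L.d (a (n + 1)) (a n) = ε • K.d (n + 1) n ≫ x + c n)
    m g₀ h₀ fun n hn g hg hR => ?_
  obtain ⟨y, hy⟩ := lift n hn (ε • (g (n + 1) ≫ L.d (a (n + 1)) (a n) - c n)) fun j => by
    by_cases hj : n + 1 + 1 = j
    · subst hj
      have h2 := congrArg (· ≫ L.d (a (n + 1)) (a n)) (hR (n + 1) (by lia))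
      simp only [Category.assoc, L.d_comp_d, comp_zero, Preadditive.add_comp,
        Preadditive.zsmul_comp] at h2
      have h3 := hc n hn
      have h4 : ε • K.d (n + 1 + 1) (n + 1) ≫ g (n + 1) ≫ L.d (a (n + 1)) (a n)
          = ε • K.d (n + 1 + 1) (n + 1) ≫ c n := by
        rw [eq_neg_of_add_eq_zero_left h2.symm, eq_neg_of_add_eq_zero_right h3]
      rw [Preadditive.comp_zsmul, Preadditive.comp_sub, smul_sub, h4, sub_self]
    · rw [K.shape _ _ (by simpa using hj), zero_comp]
  exact ⟨y, by rw [hy, smul_smul, hε, one_smul, sub_add_cancel]⟩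

variable {K L : ChainComplex A ℤ}

/-- The morphism of chain complexes given by a family that commutes with the differentials. -/
def homOfFamily (g : ∀ n, K.X n ⟶ L.X n)
    (hg : ∀ n, g (n + 1) ≫ L.d (n + 1) n = K.d (n + 1) n ≫ g n) : K ⟶ L where
  f := g
  comm' i j h := by
    obtain rfl : j + 1 = i := h
    exact hg j

/-- The homotopy given by a family of morphisms `K.X n ⟶ L.X (n + 1)`. -/
theorem nonempty_homotopy_of_family {f g : K ⟶ L} (h : ∀ n, K.X n ⟶ L.X (n + 1))
    (hh : ∀ n, h (n + 1) ≫ L.d (n + 1 + 1) (n + 1) =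
      (-1 : ℤ) • K.d (n + 1) n ≫ h n + (f.f (n + 1) - g.f (n + 1))) :
    Nonempty (Homotopy f g) := by
  refine ⟨{
    hom := fun i j => if e : i + 1 = j then h i ≫ eqToHom (by rw [e]) else 0
    zero := fun i j hij => dif_neg hij
    comm := fun i => ?_ }⟩
  obtain ⟨n, rfl⟩ : ∃ n, i = n + 1 := ⟨i - 1, by lia⟩
  rw [dNext_eq _ (show (ComplexShape.down ℤ).Rel (n + 1) n from rfl),
    prevD_eq _ (show (ComplexShape.down ℤ).Rel (n + 1 + 1) (n + 1) from rfl)]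
  have := hh n
  simp only [dite_true, eqToHom_refl, Category.comp_id]
  rw [this]
  simp

/-- A homotopy satisfies the defining equation degreewise. -/
theorem homotopy_eq {f g : K ⟶ L} (h : Homotopy f g) (n : ℤ) :
    f.f (n + 1) = K.d (n + 1) n ≫ h.hom n (n + 1) +
      h.hom (n + 1) (n + 1 + 1) ≫ L.d (n + 1 + 1) (n + 1) + g.f (n + 1) := by
  rw [h.comm, dNext_eq _ (show (ComplexShape.down ℤ).Rel (n + 1) n from rfl),
    prevD_eq _ (show (ComplexShape.down ℤ).Rel (n + 1 + 1) (n + 1) from rfl)]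

end Families

/-! ### Liftings of morphisms to resolutions -/

section Lifts

variable {A : Type u} [Category.{v} A] [Abelian A] {P Q : ObjectProperty A}

theorem ProperResolution.exists_lift_succ {M V : A} (Y : ProperResolution Q M) (hV : Q V) (n : ℤ)
    (hn : 0 < n) (f : V ⟶ Y.cx.X n) (hf : ∀ j, f ≫ Y.cx.d n j = 0) :
    ∃ g : V ⟶ Y.cx.X (n + 1), g ≫ Y.cx.d (n + 1) n = f :=
  Y.hom_exact_pos V hV n hn f (hf _)

/-- The comparison theorem: morphisms lift from a `P`-resolution to a proper `Q`-resolution, where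
`P ≤ Q`. -/
theorem exists_lift (hPQ : P ≤ Q) {M M' : A} (X : Resolution P M) (Y : ProperResolution Q M')
    (f : M ⟶ M') : ∃ φ : X.cx ⟶ Y.cx, X.IsLift Y.toResolution f φ := by
  obtain ⟨f₀, h₀⟩ := Y.hom_surjective _ (hPQ _ (X.mem 0)) (X.π ≫ f)
  obtain ⟨f₁, h₁⟩ := Y.hom_exact_zero _ (hPQ _ (X.mem 1)) (X.cx.d 1 0 ≫ f₀)
    (by rw [Category.assoc, h₀, ← Category.assoc, X.d_π, zero_comp])
  obtain ⟨g, hg, hR⟩ := exists_family_up X.cx Y.cx (fun n => n) (fun _ => rfl) 1 (fun _ => 0) 1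
    (Function.update (Function.update (fun _ => 0) 0 f₀) 1 f₁)
    (fun j => by
      simp only [Function.update_self, one_smul, add_zero, Category.assoc]
      by_cases hj : j + 1 = 1
      · obtain rfl : j = 0 := by lia
        rw [h₁, ← Category.assoc, X.cx.d_comp_d, zero_comp]
      · rw [Y.cx.shape _ _ (by simpa using hj), comp_zero, comp_zero])
    (fun n hn => by simp)
    (fun n hn f hf => Y.exists_lift_succ (hPQ _ (X.mem _)) n (by lia) f hf)
  have e₀ : g 0 = f₀ := by
    rw [hg 0 (by lia), Function.update_of_ne (by decide), Function.update_self]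
  have e₁ : g 1 = f₁ := by rw [hg 1 le_rfl, Function.update_self]
  refine ⟨homOfFamily g fun n => ?_, ?_⟩
  · rcases lt_trichotomy n 0 with h | rfl | h
    · exact (Y.isZero n h).eq_of_tgt _ _
    · change g 1 ≫ Y.cx.d 1 0 = X.cx.d 1 0 ≫ g 0
      rw [e₀, e₁, h₁]
    · simpa using hR n (by lia)
  · change g 0 ≫ Y.π = X.π ≫ f
    rw [e₀, h₀]

theorem lift_unique (hPQ : P ≤ Q) {M M' : A} {X : Resolution P M} {Y : ProperResolution Q M'}
    {f : M ⟶ M'} {φ₁ φ₂ : X.cx ⟶ Y.cx} (h₁ : X.IsLift Y.toResolution f φ₁)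
    (h₂ : X.IsLift Y.toResolution f φ₂) : Nonempty (Homotopy φ₁ φ₂) := by
  obtain ⟨s, hs⟩ : ∃ s : X.cx.X 0 ⟶ Y.cx.X (0 + 1), _ :=
    Y.hom_exact_zero _ (hPQ _ (X.mem 0)) (φ₁.f 0 - φ₂.f 0)
      (by rw [Preadditive.sub_comp, h₁, h₂, sub_self])
  obtain ⟨g, hg, hR⟩ := exists_family_up X.cx Y.cx (fun n => n + 1) (fun _ => rfl) (-1)
    (fun n => φ₁.f (n + 1) - φ₂.f (n + 1)) 0
    (Function.update (β := fun n => X.cx.X n ⟶ Y.cx.X (n + 1)) (fun _ => 0) 0 s)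
    (fun j => by
      rw [Function.update_self]
      by_cases hj : j + 1 = 1
      · obtain rfl : j = 0 := by lia
        rw [Preadditive.add_comp, Preadditive.zsmul_comp, Category.assoc]
        change (-1 : ℤ) • X.cx.d 1 0 ≫ s ≫ Y.cx.d 1 0 + (φ₁.f 1 - φ₂.f 1) ≫ Y.cx.d 1 0 = 0
        rw [hs]
        simp
      · rw [Y.cx.shape _ _ (by simpa using hj), comp_zero])
    (fun n hn => by simp)
    (fun n hn f hf => Y.exists_lift_succ (hPQ _ (X.mem _)) (n + 1) (by lia) f hf)
  refine nonempty_homotopy_of_family g fun n => ?_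
  rcases lt_trichotomy n (-1) with h | rfl | h
  · exact (Y.isZero _ (by lia)).eq_of_tgt _ _
  · have e₀ : g 0 = s := by rw [hg 0 le_rfl, Function.update_self]
    have e₁ : g (-1) = 0 := by rw [hg (-1) (by lia), Function.update_of_ne (by decide)]
    rw [e₁, comp_zero, smul_zero, zero_add]
    change g 0 ≫ _ = _
    rw [e₀]
    exact hs
  · exact hR n (by lia)

theorem Resolution.IsLift.comp {P₁ P₂ P₃ : ObjectProperty A} {M₁ M₂ M₃ : A}
    {X₁ : Resolution P₁ M₁} {X₂ : Resolution P₂ M₂} {X₃ : Resolution P₃ M₃} {f : M₁ ⟶ M₂}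
    {g : M₂ ⟶ M₃} {φ : X₁.cx ⟶ X₂.cx} {ψ : X₂.cx ⟶ X₃.cx} (hφ : X₁.IsLift X₂ f φ)
    (hψ : X₂.IsLift X₃ g ψ) : X₁.IsLift X₃ (f ≫ g) (φ ≫ ψ) := by
  unfold Resolution.IsLift at *
  rw [HomologicalComplex.comp_f, Category.assoc, hψ, ← Category.assoc, hφ, Category.assoc]

theorem Resolution.isLift_id {M : A} (X : Resolution P M) : X.IsLift X (𝟙 M) (𝟙 X.cx) := by
  simp [Resolution.IsLift]

/-! ### Liftings to Tate resolutions -/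

/-- In the degrees where the comparison morphism of a Tate resolution is invertible, a family of
inverses. -/
theorem TateResolution.exists_inverse {M : A} (τ : TateResolution P M) :
    ∃ (m : ℤ) (β : ∀ n, τ.W.cx.X n ⟶ τ.T.X n), ∀ n, m ≤ n →
      τ.α.f n ≫ β n = 𝟙 _ ∧ β n ≫ τ.α.f n = 𝟙 _ := by
  obtain ⟨m, hm⟩ := τ.isIso_α
  have : ∀ n, ∃ β : τ.W.cx.X n ⟶ τ.T.X n, m ≤ n →
      τ.α.f n ≫ β = 𝟙 _ ∧ β ≫ τ.α.f n = 𝟙 _ := fun n => by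
    by_cases h : m ≤ n
    · have := hm n h
      exact ⟨inv (τ.α.f n), fun _ => by simp⟩
    · exact ⟨0, fun h' => absurd h' h⟩
  choose β hβ using this
  exact ⟨m, β, hβ⟩

theorem inverse_comm {K L : ChainComplex A ℤ} (α : K ⟶ L) {β : ∀ n, L.X n ⟶ K.X n} {n k : ℤ}
    (hn : β n ≫ α.f n = 𝟙 _) (hk : α.f k ≫ β k = 𝟙 _) :
    β n ≫ K.d n k = L.d n k ≫ β k := by
  rw [← Category.comp_id (K.d n k), ← hk, ← α.comm_assoc, ← Category.assoc (β n), hn,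
    Category.id_comp]

/-- Exactness of `Hom(T, V)` for `V` in `P`, in the form of one step of a downward recursion. -/
theorem exists_extend_hom {T : ChainComplex A ℤ} (hT : IsTotallyAcyclic P T)
    {V : A} (hV : P V) (n : ℤ) (f : T.X (n + 1) ⟶ V) (hf : ∀ j, T.d j (n + 1) ≫ f = 0) :
    ∃ g : T.X n ⟶ V, T.d (n + 1) n ≫ g = f := by
  obtain ⟨g, hg⟩ := hT.hom_to V hV (n + 1) f (hf _)
  have key : ∀ k, n + 1 - 1 = k → ∃ g : T.X k ⟶ V, T.d (n + 1) k ≫ g = f := by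
    rintro k rfl
    exact ⟨g, hg⟩
  exact key n (by lia)

/-- A morphism from a totally acyclic complex that is null-homotopic in high degrees is
null-homotopic. -/
theorem homotopy_of_eventually {T K : ChainComplex A ℤ} (hT : IsTotallyAcyclic P T)
    (hK : ∀ n, P (K.X n)) (φ₁ φ₂ : T ⟶ K) (m : ℤ) (s : ∀ n, T.X n ⟶ K.X (n + 1))
    (hs : ∀ n, m ≤ n → s (n + 1) ≫ K.d (n + 1 + 1) (n + 1) =
      (-1 : ℤ) • T.d (n + 1) n ≫ s n + (φ₁.f (n + 1) - φ₂.f (n + 1))) :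
    Nonempty (Homotopy φ₁ φ₂) := by
  obtain ⟨g, -, hR⟩ := exists_family_down T K (fun n => n + 1) (-1) (by norm_num)
    (fun n => φ₁.f (n + 1) - φ₂.f (n + 1)) m s hs (fun n hn => by simp)
    (fun n hn f hf => exists_extend_hom hT (hK _) n f hf)
  exact nonempty_homotopy_of_family g hR

/-- A lifting `W ⟶ W'` is transported to `T ⟶ T'` in the high degrees, where `α'` is invertible,
and extended downwards. -/
theorem exists_tate_lift {M M' : A} (f : M ⟶ M') (τ : TateResolution P M)
    (τ' : TateResolution P M') : ∃ φ ψ, τ.IsLift τ' f φ ψ := by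
  obtain ⟨φ, hφ⟩ := exists_lift le_rfl τ.W.toResolution τ'.W f
  obtain ⟨m, β, hβ⟩ := τ'.exists_inverse
  obtain ⟨g, hg, hR⟩ := exists_family_down τ.T τ'.T (fun n => n) 1 (by norm_num) (fun _ => 0) m
    (fun n => τ.α.f n ≫ φ.f n ≫ β n)
    (fun n hn => by
      have := inverse_comm τ'.α (hβ (n + 1) (by lia)).2 (hβ n hn).1
      simp [this])
    (fun n hn => by simp)
    (fun n hn f hf => exists_extend_hom τ.totallyAcyclic (τ'.totallyAcyclic.mem _) n f hf)
  refine ⟨φ, homOfFamily g fun n => by simpa using hR n, hφ, ?_⟩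
  refine homotopy_of_eventually τ.totallyAcyclic τ'.W.mem _ _ m (fun _ => 0) fun n hn => ?_
  simp [homOfFamily, hg (n + 1) (by lia), (hβ (n + 1) (by lia)).2]

theorem tate_lift_unique {M M' : A} {f : M ⟶ M'} {τ : TateResolution P M}
    {τ' : TateResolution P M'} {φ₁ φ₂ : τ.W.cx ⟶ τ'.W.cx} {ψ₁ ψ₂ : τ.T ⟶ τ'.T}
    (h₁ : τ.IsLift τ' f φ₁ ψ₁) (h₂ : τ.IsLift τ' f φ₂ ψ₂) :
    Nonempty (Homotopy φ₁ φ₂) ∧ Nonempty (Homotopy ψ₁ ψ₂) := by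
  obtain ⟨H⟩ := lift_unique le_rfl h₁.lift h₂.lift
  refine ⟨⟨H⟩, ?_⟩
  obtain ⟨H₁⟩ := h₁.comm
  obtain ⟨H₂⟩ := h₂.comm
  obtain ⟨m, β, hβ⟩ := τ'.exists_inverse
  have K : Homotopy (ψ₁ ≫ τ'.α) (ψ₂ ≫ τ'.α) := (H₁.trans (H.compLeft τ.α)).trans H₂.symm
  refine homotopy_of_eventually τ.totallyAcyclic τ'.totallyAcyclic.mem _ _ m
    (fun n => K.hom n (n + 1) ≫ β (n + 1)) fun n hn => ?_
  have e := congrArg (· ≫ β (n + 1)) (homotopy_eq K n)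
  simp only [HomologicalComplex.comp_f, Category.assoc, (hβ (n + 1) (by lia)).1,
    Preadditive.add_comp, Category.comp_id] at e
  rw [Category.assoc, inverse_comm τ'.α (hβ (n + 1 + 1) (by lia)).2 (hβ (n + 1) (by lia)).1, e]
  simp only [neg_smul, one_smul]
  abel

theorem TateResolution.IsLift.comp {M₁ M₂ M₃ : A} {τ₁ : TateResolution P M₁}
    {τ₂ : TateResolution P M₂} {τ₃ : TateResolution P M₃} {f : M₁ ⟶ M₂} {g : M₂ ⟶ M₃}
    {φ : τ₁.W.cx ⟶ τ₂.W.cx} {ψ : τ₁.T ⟶ τ₂.T} {φ' : τ₂.W.cx ⟶ τ₃.W.cx} {ψ' : τ₂.T ⟶ τ₃.T}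
    (h : τ₁.IsLift τ₂ f φ ψ) (h' : τ₂.IsLift τ₃ g φ' ψ') :
    τ₁.IsLift τ₃ (f ≫ g) (φ ≫ φ') (ψ ≫ ψ') where
  lift := h.lift.comp h'.lift
  comm := by
    obtain ⟨H⟩ := h.comm
    obtain ⟨H'⟩ := h'.comm
    exact ⟨(Homotopy.ofEq (Category.assoc _ _ _)).trans ((H'.compLeft ψ).trans
      ((Homotopy.ofEq (Category.assoc _ _ _).symm).trans ((H.compRight φ').trans
        (Homotopy.ofEq (Category.assoc _ _ _)))))⟩

theorem TateResolution.isLift_id {M : A} (τ : TateResolution P M) :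
    τ.IsLift τ (𝟙 M) (𝟙 _) (𝟙 _) where
  lift := τ.W.isLift_id
  comm := ⟨Homotopy.ofEq (by simp)⟩

end Lifts

/-! ### Cohomology classes of `Hom(K, N)` -/

section Classes

variable {A : Type u} [Category.{v} A] [Abelian A]

/-- The `n`-cocycles of `Hom(K, N)`. -/
def cocycles (K : ChainComplex A ℤ) (N : A) (n : ℤ) : AddSubgroup (K.X n ⟶ N) where
  carrier := {c | K.d (n + 1) n ≫ c = 0}
  zero_mem' := by simp
  add_mem' {a b} ha hb := by
    change K.d (n + 1) n ≫ (a + b) = 0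
    rw [Preadditive.comp_add, show K.d (n + 1) n ≫ a = 0 from ha,
      show K.d (n + 1) n ≫ b = 0 from hb, add_zero]
  neg_mem' {a} ha := by
    change K.d (n + 1) n ≫ (-a) = 0
    rw [Preadditive.comp_neg, show K.d (n + 1) n ≫ a = 0 from ha, neg_zero]

variable {K L : ChainComplex A ℤ} {N N' : A} {n : ℤ}

theorem mem_cocycles {c : K.X n ⟶ N} : c ∈ cocycles K N n ↔ K.d (n + 1) n ≫ c = 0 := Iff.rfl

theorem d_comp_cocycle (c : cocycles K N n) (j : ℤ) : K.d j n ≫ c.1 = 0 := by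
  by_cases h : n + 1 = j
  · subst h
    exact c.2
  · rw [K.shape _ _ (by simpa using h), zero_comp]

/-- Precomposition of a cocycle with a morphism of complexes. -/
def precompCocycle (φ : K ⟶ L) (c : cocycles L N n) : cocycles K N n :=
  ⟨φ.f n ≫ c.1, by rw [mem_cocycles, ← φ.comm_assoc, d_comp_cocycle, comp_zero]⟩

/-- Postcomposition of a cocycle with a morphism. -/
def postcompCocycle (c : cocycles K N n) (g : N ⟶ N') : cocycles K N' n :=
  ⟨c.1 ≫ g, by rw [mem_cocycles, ← Category.assoc, d_comp_cocycle, zero_comp]⟩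

/-- The class in `Hⁿ(Hom(K, N))` of a cocycle. -/
def extMk (K : ChainComplex A ℤ) (N : A) (n : ℤ) : cocycles K N n →+ ext K N n :=
  ((homComplex K N).sc n).homologyπ.hom.comp
    (((homComplex K N).sc n).abCyclesIso.inv.hom.comp
      { toFun := fun c => ⟨c.1, d_comp_cocycle c _⟩
        map_zero' := rfl
        map_add' := fun _ _ => rfl })

theorem extMk_surjective : Function.Surjective (extMk K N n) := by
  have h1 : Function.Surjective ((homComplex K N).sc n).homologyπ :=
    (AddCommGrpCat.epi_iff_surjective _).1 inferInstance
  have h2 : Function.Surjective ((homComplex K N).sc n).abCyclesIso.inv :=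
    (AddCommGrpCat.epi_iff_surjective _).1 inferInstance
  intro e
  obtain ⟨z, rfl⟩ := h1 e
  obtain ⟨⟨c, hc⟩, rfl⟩ := h2 z
  have hc' : K.d ((ComplexShape.down ℤ).symm.next n) n ≫ c = 0 := hc
  rw [show (ComplexShape.down ℤ).symm.next n = n + 1 from ComplexShape.next_eq' _ rfl] at hc'
  exact ⟨⟨c, hc'⟩, rfl⟩

theorem iCycles_extMk (c : cocycles K N n) :
    ∃ z, ((homComplex K N).sc n).iCycles z = c.1 ∧
      ((homComplex K N).sc n).homologyπ z = extMk K N n c :=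
  ⟨_, ShortComplex.abCyclesIso_inv_apply_iCycles _ _, rfl⟩

theorem eq_of_iCycles (c : cocycles K N n) (z : ((homComplex K N).sc n).cycles)
    (hz : ((homComplex K N).sc n).iCycles z = c.1) :
    ((homComplex K N).sc n).homologyπ z = extMk K N n c := by
  obtain ⟨z', h1, h2⟩ := iCycles_extMk c
  rw [← h2]
  congr 1
  exact (AddCommGrpCat.mono_iff_injective ((homComplex K N).sc n).iCycles).1 inferInstance
    (hz.trans h1.symm)

theorem extMk_eq_zero_iff (c : cocycles K N n) (k : ℤ) (hk : k + 1 = n) :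
    extMk K N n c = 0 ↔ ∃ b : K.X k ⟶ N, K.d n k ≫ b = c.1 := by
  have hp : (ComplexShape.down ℤ).symm.prev n = k := ComplexShape.prev_eq' _ hk
  obtain ⟨z, h1, h2⟩ := iCycles_extMk c
  have hex : (ShortComplex.mk _ _ ((homComplex K N).sc n).toCycles_comp_homologyπ).Exact :=
    ShortComplex.exact_of_g_is_cokernel _ ((homComplex K N).sc n).homologyIsCokernel
  have hi : ∀ b, ((homComplex K N).sc n).iCycles (((homComplex K N).sc n).toCycles b) =
      ((homComplex K N).sc n).f b := fun b =>
    ConcreteCategory.congr_hom ((homComplex K N).sc n).toCycles_i b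
  have hb : (∃ b, ((homComplex K N).sc n).f b = c.1) ↔ ∃ b : K.X k ⟶ N, K.d n k ≫ b = c.1 := by
    subst hp
    exact Iff.rfl
  rw [← h2, ← hb]
  constructor
  · intro h0
    obtain ⟨b, rfl⟩ := (ShortComplex.ab_exact_iff _).1 hex z h0
    exact ⟨b, (hi b).symm.trans h1⟩
  · rintro ⟨b, hb⟩
    obtain rfl : ((homComplex K N).sc n).toCycles b = z :=
      (AddCommGrpCat.mono_iff_injective ((homComplex K N).sc n).iCycles).1 inferInstance
        ((hi b).trans (hb.trans h1.symm))
    exact ConcreteCategory.congr_hom ((homComplex K N).sc n).toCycles_comp_homologyπ b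

/-- The map of complexes `Hom(φ, N)`. -/
def homComplexMapLeft (φ : K ⟶ L) (N : A) : homComplex L N ⟶ homComplex K N :=
  (HomologicalComplex.opFunctor A (ComplexShape.down ℤ) ⋙
    (preadditiveYoneda.obj N).mapHomologicalComplex _).map φ.op

/-- The map of complexes `Hom(K, g)`. -/
def homComplexMapRight (K : ChainComplex A ℤ) (g : N ⟶ N') : homComplex K N ⟶ homComplex K N' :=
  (NatTrans.mapHomologicalComplex (preadditiveYoneda.map g) _).app K.op

theorem homologyMap_extMk {K' : ChainComplex A ℤ} (F : homComplex K N ⟶ homComplex K' N')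
    (c : cocycles K N n) (c' : cocycles K' N' n) (h : F.f n c.1 = c'.1) :
    HomologicalComplex.homologyMap F n (extMk K N n c) = extMk K' N' n c' := by
  obtain ⟨z, h1, h2⟩ := iCycles_extMk c
  rw [← h2, ← eq_of_iCycles c' (HomologicalComplex.cyclesMap F n z)]
  · exact (ConcreteCategory.congr_hom (HomologicalComplex.homologyπ_naturality F n) z)
  · refine (ConcreteCategory.congr_hom (HomologicalComplex.cyclesMap_i F n) z).trans ?_
    exact (congrArg (F.f n) h1).trans h

theorem extMapLeft_extMk (φ : K ⟶ L) (c : cocycles L N n) :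
    extMapLeft φ N n (extMk L N n c) = extMk K N n (precompCocycle φ c) :=
  homologyMap_extMk (homComplexMapLeft φ N) c _ rfl

theorem extMapRight_extMk (g : N ⟶ N') (c : cocycles K N n) :
    extMapRight K g n (extMk K N n c) = extMk K N' n (postcompCocycle c g) :=
  homologyMap_extMk (homComplexMapRight K g) c _ rfl

theorem extMapLeft_eq_of_homotopy {φ ψ : K ⟶ L} (h : Nonempty (Homotopy φ ψ)) (N : A) (n : ℤ) :
    extMapLeft φ N n = extMapLeft ψ N n :=
  ((preadditiveYoneda.obj N).mapHomotopy h.some.op).homologyMap_eq n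

theorem extMapLeft_comp {K' : ChainComplex A ℤ} (φ : K ⟶ L) (ψ : L ⟶ K') (N : A) (n : ℤ) :
    extMapLeft (φ ≫ ψ) N n = extMapLeft ψ N n ≫ extMapLeft φ N n := by
  have : homComplexMapLeft (φ ≫ ψ) N = homComplexMapLeft ψ N ≫ homComplexMapLeft φ N := by
    unfold homComplexMapLeft
    rw [op_comp]
    exact Functor.map_comp _ _ _
  exact (congrArg (HomologicalComplex.homologyMap · n) this).trans
    (HomologicalComplex.homologyMap_comp _ _ _)

theorem extMapLeft_comp_assoc {K' : ChainComplex A ℤ} (φ : K ⟶ L) (ψ : L ⟶ K') (N : A) (n : ℤ)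
    {E : AddCommGrpCat.{v}} (f : ext K N n ⟶ E) :
    extMapLeft (φ ≫ ψ) N n ≫ f = extMapLeft ψ N n ≫ extMapLeft φ N n ≫ f := by
  rw [extMapLeft_comp, Category.assoc]

theorem extMapLeft_id (N : A) (n : ℤ) : extMapLeft (𝟙 K) N n = 𝟙 _ := by
  have : homComplexMapLeft (𝟙 K) N = 𝟙 _ := by
    unfold homComplexMapLeft
    rw [op_id]
    exact CategoryTheory.Functor.map_id _ _
  exact (congrArg (HomologicalComplex.homologyMap · n) this).trans
    (HomologicalComplex.homologyMap_id _ _)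

theorem extMapLeft_naturality (φ : K ⟶ L) (g : N ⟶ N') (n : ℤ) :
    extMapLeft φ N n ≫ extMapRight K g n = extMapRight L g n ≫ extMapLeft φ N' n := by
  have : homComplexMapLeft φ N ≫ homComplexMapRight K g =
      homComplexMapRight L g ≫ homComplexMapLeft φ N' :=
    (NatTrans.mapHomologicalComplex (preadditiveYoneda.map g) _).naturality _
  exact (HomologicalComplex.homologyMap_comp _ _ _).symm.trans
    ((congrArg (HomologicalComplex.homologyMap · n) this).trans
      (HomologicalComplex.homologyMap_comp _ _ _))

theorem isIso_extMapLeft_of_inverse {φ : K ⟶ L} {ψ : L ⟶ K}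
    (h : Nonempty (Homotopy (φ ≫ ψ) (𝟙 K))) (h' : Nonempty (Homotopy (ψ ≫ φ) (𝟙 L))) (N : A)
    (n : ℤ) : IsIso (extMapLeft φ N n) :=
  ⟨extMapLeft ψ N n, by
    rw [← extMapLeft_comp, extMapLeft_eq_of_homotopy h', extMapLeft_id], by
    rw [← extMapLeft_comp, extMapLeft_eq_of_homotopy h, extMapLeft_id]⟩

end Classes

/-! ### The split comparison diagram and its long exact sequence -/

section Split

variable {A : Type u} [Category.{v} A] [Abelian A] {𝒲 𝒳 : ObjectProperty A}

/-- A comparison diagram `T → W → X` over `M` for which `0 → Tₙ → Wₙ → Xₙ → 0` is split exact for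
`n ≥ 1`, while `T₀ → W₀` is invertible and `T₁ → T₀ → X₀ → 0` is exact. The data consist of the
splittings `σ : W → T` and `ι : X → W` (with `ι = 0` in degree `0`), and of the family
`u : Xₙ₊₁ → Tₙ` through which `ι` fails to commute with the differentials. -/
structure SplitComparison (𝒲 𝒳 : ObjectProperty A) (M : A) where
  /-- the Tate resolution -/
  τ : TateResolution 𝒲 M
  /-- the proper resolution -/
  ξ : ProperResolution 𝒳 M
  /-- the comparison morphism `W ⟶ X` -/
  κ : τ.W.cx ⟶ ξ.cx
  lift : τ.W.IsLift ξ.toResolution (𝟙 M) κ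
  /-- the retraction of `T ⟶ W` -/
  σ : ∀ n, τ.W.cx.X n ⟶ τ.T.X n
  /-- the section of `W ⟶ X` -/
  ι : ∀ n, ξ.cx.X n ⟶ τ.W.cx.X n
  /-- the component `X ⟶ T` of the differential of `W` -/
  u : ∀ n, ξ.cx.X (n + 1) ⟶ τ.T.X n
  α_σ : ∀ n, 0 ≤ n → τ.α.f n ≫ σ n = 𝟙 _
  ι_κ : ∀ n, 1 ≤ n → ι n ≫ κ.f n = 𝟙 _
  ι_σ : ∀ n, 0 ≤ n → ι n ≫ σ n = 0
  α_κ : ∀ n, 1 ≤ n → τ.α.f n ≫ κ.f n = 0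
  total : ∀ n, 0 ≤ n → σ n ≫ τ.α.f n + κ.f n ≫ ι n = 𝟙 _
  ι_zero : ι 0 = 0
  u_d : ∀ n, 0 ≤ n → u (n + 1) ≫ τ.T.d (n + 1) n = -(ξ.cx.d (n + 1 + 1) (n + 1) ≫ u n)
  ι_d : ∀ n, 0 ≤ n →
    ι (n + 1) ≫ τ.W.cx.d (n + 1) n = ξ.cx.d (n + 1) n ≫ ι n + u n ≫ τ.α.f n
  epi : Epi (τ.α.f 0 ≫ κ.f 0)
  desc : ∀ (N : A) (c : τ.T.X 0 ⟶ N), τ.T.d 1 0 ≫ c = 0 →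
    ∃ g : ξ.cx.X 0 ⟶ N, (τ.α.f 0 ≫ κ.f 0) ≫ g = c

namespace SplitComparison

variable {M : A} (S : SplitComparison 𝒲 𝒳 M) {N N' : A} {n : ℤ}

theorem d_σ (hn : 0 ≤ n) : S.τ.W.cx.d (n + 1) n ≫ S.σ n =
    S.σ (n + 1) ≫ S.τ.T.d (n + 1) n + S.κ.f (n + 1) ≫ S.u n := by
  rw [← Category.id_comp (S.τ.W.cx.d (n + 1) n), ← S.total (n + 1) (by lia),
    Preadditive.add_comp, Preadditive.add_comp]
  simp only [Category.assoc]
  rw [S.τ.α.comm_assoc, S.α_σ n hn, Category.comp_id]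
  have := congrArg (· ≫ S.σ n) (S.ι_d n hn)
  simp only [Category.assoc, Preadditive.add_comp, S.ι_σ n hn, comp_zero, zero_add, S.α_σ n hn,
    Category.comp_id] at this
  rw [this]

theorem epi_κ (hn : 1 ≤ n) : Epi (S.κ.f n) :=
  have : Epi (S.ι n ≫ S.κ.f n) := by
    rw [S.ι_κ n hn]
    infer_instance
  epi_of_epi (S.ι n) _

theorem u_zero_comp : S.u 0 ≫ S.τ.α.f 0 ≫ S.κ.f 0 = S.ξ.cx.d 1 0 := by
  have := congrArg (· ≫ S.κ.f 0) (S.ι_d 0 le_rfl)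
  simp only [Category.assoc, S.ι_zero, comp_zero, zero_add] at this
  rw [← this, ← S.κ.comm, ← Category.assoc]
  exact (congrArg (· ≫ S.ξ.cx.d 1 0) (S.ι_κ 1 le_rfl)).trans (Category.id_comp _)

theorem u_cocycle (hn : 0 ≤ n) (t : cocycles S.τ.T N n) :
    S.u n ≫ t.1 ∈ cocycles S.ξ.cx N (n + 1) := by
  rw [mem_cocycles, ← Category.assoc, ← neg_eq_zero, ← Preadditive.neg_comp, ← S.u_d n hn,
    Category.assoc, d_comp_cocycle, comp_zero]

/-- Precomposition with `u` on cocycles. -/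
def uMap (N : A) (hn : 0 ≤ n) : cocycles S.τ.T N n →+ cocycles S.ξ.cx N (n + 1) where
  toFun t := ⟨S.u n ≫ t.1, S.u_cocycle hn t⟩
  map_zero' := Subtype.ext comp_zero
  map_add' _ _ := Subtype.ext (Preadditive.comp_add _ _ _ _ _ _)

theorem extMk_u_eq_zero (hn : 1 ≤ n) {t : cocycles S.τ.T N n} (ht : extMk _ _ _ t = 0)
    (x : cocycles S.ξ.cx N (n + 1)) (hx : x.1 = S.u n ≫ t.1) : extMk _ _ _ x = 0 := by
  obtain ⟨k, rfl⟩ : ∃ k, n = k + 1 := ⟨n - 1, by lia⟩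
  rw [extMk_eq_zero_iff _ k rfl] at ht
  obtain ⟨b, hb⟩ := ht
  rw [extMk_eq_zero_iff _ (k + 1) rfl]
  refine ⟨-(S.u k ≫ b), ?_⟩
  rw [hx, ← hb, ← Category.assoc, S.u_d k (by lia), Preadditive.comp_neg, Preadditive.neg_comp,
    Category.assoc]

/-- The connecting homomorphism in a degree `n ≥ 1`, as a homomorphism of groups. -/
def δHom (N : A) (n : ℤ) (hn : 1 ≤ n) : ext S.τ.T N n →+ ext S.ξ.cx N (n + 1) :=
  (extMk S.τ.T N n).liftOfSurjective extMk_surjective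
    ⟨(extMk S.ξ.cx N (n + 1)).comp (S.uMap N (by lia)), fun _ ht =>
      S.extMk_u_eq_zero hn ht _ rfl⟩

/-- The connecting homomorphism of the degreewise split sequence: in degrees `n ≥ 1` it sends the
class of `t` to the class of `u ≫ t`. -/
def δ (N : A) (n : ℤ) : ext S.τ.T N n ⟶ ext S.ξ.cx N (n + 1) :=
  if hn : 1 ≤ n then AddCommGrpCat.ofHom (S.δHom N n hn) else 0

theorem δ_extMk (hn : 1 ≤ n) (t : cocycles S.τ.T N n) :
    S.δ N n (extMk _ _ _ t) = extMk _ _ _ (S.uMap N (by lia) t) := by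
  have : S.δ N n = AddCommGrpCat.ofHom (S.δHom N n hn) := dif_pos hn
  rw [this]
  exact AddMonoidHom.liftOfRightInverse_comp_apply _ _ _ _ _

theorem δ_naturality (hn : 1 ≤ n) (g : N ⟶ N') :
    S.δ N n ≫ extMapRight S.ξ.cx g (n + 1) = extMapRight S.τ.T g n ≫ S.δ N' n := by
  ext e
  obtain ⟨t, rfl⟩ := extMk_surjective e
  rw [ConcreteCategory.comp_apply, ConcreteCategory.comp_apply, S.δ_extMk hn t,
    extMapRight_extMk g t, S.δ_extMk hn, extMapRight_extMk]
  exact congrArg _ (Subtype.ext (Category.assoc _ _ _))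

theorem θ_injective : Function.Injective (extMapLeft S.κ N 1) := by
  refine (injective_iff_map_eq_zero (extMapLeft S.κ N 1).hom).2 fun e he => ?_
  obtain ⟨x, rfl⟩ := extMk_surjective e
  obtain ⟨w, hw⟩ := (extMk_eq_zero_iff _ 0 rfl).1 ((extMapLeft_extMk S.κ x).symm.trans he)
  replace hw : S.τ.W.cx.d 1 0 ≫ w = S.κ.f 1 ≫ x.1 := hw
  -- on `W₁ = T₁ ⊕ X₁` the identity `d ≫ w = κ ≫ x` says that `w` descends to `X₀`
  obtain ⟨g, hg⟩ := S.desc N (S.τ.α.f 0 ≫ w) (by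
    rw [← S.τ.α.comm_assoc, hw, ← Category.assoc, S.α_κ 1 le_rfl, zero_comp])
  refine (extMk_eq_zero_iff x 0 rfl).2 ⟨g, ?_⟩
  have h1 := congrArg (· ≫ w) (S.ι_d 0 le_rfl)
  simp only [Category.assoc, S.ι_zero, comp_zero, zero_add] at h1
  replace h1 : S.ι 1 ≫ S.τ.W.cx.d 1 0 ≫ w = S.u 0 ≫ S.τ.α.f 0 ≫ w := h1
  rw [hw, ← Category.assoc, S.ι_κ 1 le_rfl, Category.id_comp, ← hg] at h1
  rw [h1, ← S.u_zero_comp]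
  simp only [Category.assoc]

theorem θ_ε_exact (hn : 1 ≤ n) :
    Function.Exact (extMapLeft S.κ N n) (extMapLeft S.τ.α N n) := by
  obtain ⟨k, rfl⟩ : ∃ k, n = k + 1 := ⟨n - 1, by lia⟩
  intro e
  constructor
  · intro he
    obtain ⟨c, rfl⟩ := extMk_surjective e
    obtain ⟨b, hb⟩ := (extMk_eq_zero_iff _ k rfl).1 ((extMapLeft_extMk S.τ.α c).symm.trans he)
    replace hb : S.τ.T.d (k + 1) k ≫ b = S.τ.α.f (k + 1) ≫ c.1 := hb
    have h1 : c.1 - S.τ.W.cx.d (k + 1) k ≫ S.σ k ≫ b =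
        S.κ.f (k + 1) ≫ (S.ι (k + 1) ≫ c.1 - S.u k ≫ b) := by
      have h2 := congrArg (· ≫ c.1) (S.total (k + 1) (by lia))
      have h3 := congrArg (· ≫ b) (S.d_σ (n := k) (by lia))
      simp only [Preadditive.add_comp, Category.assoc, Category.id_comp] at h2 h3
      rw [h3, hb, Preadditive.comp_sub]
      grind
    have := S.epi_κ (n := k + 1 + 1) (by lia)
    let x : cocycles S.ξ.cx N (k + 1) := ⟨S.ι (k + 1) ≫ c.1 - S.u k ≫ b, by
      rw [mem_cocycles, ← cancel_epi (S.κ.f (k + 1 + 1)), S.κ.comm_assoc, ← h1,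
        Preadditive.comp_sub, d_comp_cocycle, S.τ.W.cx.d_comp_d_assoc, zero_comp, sub_zero,
        comp_zero]⟩
    refine ⟨extMk _ _ _ x, (extMapLeft_extMk S.κ x).trans ?_⟩
    rw [← sub_eq_zero, ← map_sub, extMk_eq_zero_iff _ k rfl]
    refine ⟨-(S.σ k ≫ b), ?_⟩
    change _ = S.κ.f _ ≫ (S.ι (k + 1) ≫ c.1 - S.u k ≫ b) - c.1
    rw [← h1, Preadditive.comp_neg]
    abel
  · rintro ⟨e, rfl⟩
    obtain ⟨x, rfl⟩ := extMk_surjective e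
    rw [extMapLeft_extMk, extMapLeft_extMk]
    refine (congrArg _ (Subtype.ext ?_)).trans (map_zero (extMk S.τ.T N (k + 1)))
    change _ ≫ _ ≫ _ = 0
    rw [← Category.assoc, S.α_κ _ hn, zero_comp]

theorem ε_δ_exact (hn : 1 ≤ n) : Function.Exact (extMapLeft S.τ.α N n) (S.δ N n) := by
  intro e
  constructor
  · intro he
    obtain ⟨t, rfl⟩ := extMk_surjective e
    rw [S.δ_extMk hn t, extMk_eq_zero_iff _ n rfl] at he
    obtain ⟨x, hx⟩ := he
    replace hx : S.ξ.cx.d (n + 1) n ≫ x = S.u n ≫ t.1 := hx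
    let c : cocycles S.τ.W.cx N n := ⟨S.σ n ≫ t.1 - S.κ.f n ≫ x, by
      rw [mem_cocycles, Preadditive.comp_sub, ← Category.assoc, S.d_σ (by lia),
        Preadditive.add_comp, Category.assoc, d_comp_cocycle, comp_zero, zero_add,
        ← S.κ.comm_assoc, hx, Category.assoc, sub_self]⟩
    refine ⟨extMk _ _ _ c, (extMapLeft_extMk _ _).trans (congrArg _ (Subtype.ext ?_))⟩
    change _ ≫ (_ - _) = _
    rw [Preadditive.comp_sub, ← Category.assoc, S.α_σ n (by lia), Category.id_comp,
      ← Category.assoc, S.α_κ n hn, zero_comp, sub_zero]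
  · rintro ⟨e, rfl⟩
    obtain ⟨c, rfl⟩ := extMk_surjective e
    rw [extMapLeft_extMk, S.δ_extMk hn, extMk_eq_zero_iff _ n rfl]
    refine ⟨-(S.ι n ≫ c.1), ?_⟩
    change _ = S.u n ≫ S.τ.α.f n ≫ c.1
    have h1 := congrArg (· ≫ c.1) (S.ι_d n (by lia))
    simp only [Category.assoc, Preadditive.add_comp, d_comp_cocycle, comp_zero] at h1
    rw [Preadditive.comp_neg, eq_neg_of_add_eq_zero_left h1.symm, neg_neg]

theorem δ_θ_exact (hn : 1 ≤ n) : Function.Exact (S.δ N n) (extMapLeft S.κ N (n + 1)) := by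
  intro e
  constructor
  · intro he
    obtain ⟨x, rfl⟩ := extMk_surjective e
    rw [extMapLeft_extMk, extMk_eq_zero_iff _ n rfl] at he
    obtain ⟨w, hw⟩ := he
    replace hw : S.τ.W.cx.d (n + 1) n ≫ w = S.κ.f (n + 1) ≫ x.1 := hw
    let t : cocycles S.τ.T N n := ⟨S.τ.α.f n ≫ w, by
      rw [mem_cocycles, ← S.τ.α.comm_assoc, hw, ← Category.assoc, S.α_κ _ (by lia), zero_comp]⟩
    refine ⟨extMk _ _ _ t, ?_⟩
    rw [S.δ_extMk hn t, ← sub_eq_zero, ← map_sub, extMk_eq_zero_iff _ n rfl]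
    refine ⟨-(S.ι n ≫ w), ?_⟩
    change _ = S.u n ≫ S.τ.α.f n ≫ w - x.1
    have h1 := congrArg (· ≫ w) (S.ι_d n (by lia))
    simp only [Category.assoc, Preadditive.add_comp] at h1
    rw [hw, ← Category.assoc, S.ι_κ (n + 1) (by lia), Category.id_comp] at h1
    rw [h1, Preadditive.comp_neg]
    abel
  · rintro ⟨e, rfl⟩
    obtain ⟨t, rfl⟩ := extMk_surjective e
    rw [S.δ_extMk hn t, extMapLeft_extMk, extMk_eq_zero_iff _ n rfl]
    refine ⟨S.σ n ≫ t.1, ?_⟩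
    change _ = S.κ.f (n + 1) ≫ S.u n ≫ t.1
    rw [← Category.assoc, S.d_σ (by lia), Preadditive.add_comp, Category.assoc, d_comp_cocycle,
      comp_zero, zero_add, Category.assoc]

/-! ### Naturality of the connecting homomorphism -/

/-- The homotopies that compare two split comparison diagrams define a family
`k : Tₙ → X'ₙ₊₁` that anticommutes with the differentials in degrees `≥ 1`. Since `X₀` belongs to
`𝒳` and `X'` is a proper `𝒳`-resolution, such a family is null-homotopic in degrees `≥ 1`. -/
theorem exists_contraction (h𝒲 : 𝒲 ≤ 𝒳) {M' : A} (ξ' : ProperResolution 𝒳 M')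
    (k : ∀ n, S.τ.T.X n ⟶ ξ'.cx.X (n + 1))
    (hk : ∀ n, 0 ≤ n → k (n + 1) ≫ ξ'.cx.d (n + 1 + 1) (n + 1) =
      -(S.τ.T.d (n + 1) n ≫ k n)) :
    ∃ l : ∀ n, S.τ.T.X n ⟶ ξ'.cx.X (n + 1 + 1), ∀ n, 0 ≤ n →
      l (n + 1) ≫ ξ'.cx.d (n + 1 + 1 + 1) (n + 1 + 1) = S.τ.T.d (n + 1) n ≫ l n + k (n + 1) := by
  have hT : ∀ n, 𝒳 (S.τ.T.X n) := fun n => h𝒲 _ (S.τ.totallyAcyclic.mem n)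
  have := S.epi
  obtain ⟨k₀, hkk⟩ : ∃ k₀ : S.τ.T.X 0 ⟶ ξ'.cx.X 1, k₀ = k 0 := ⟨_, rfl⟩
  obtain ⟨k₁, hkk₁⟩ : ∃ k₁ : S.τ.T.X 1 ⟶ ξ'.cx.X 2, k₁ = k 1 := ⟨_, rfl⟩
  have hk₀ : k₁ ≫ ξ'.cx.d 2 1 = -(S.τ.T.d 1 0 ≫ k₀) := by
    rw [hkk, hkk₁]
    exact hk 0 le_rfl
  -- `k₀ ≫ d` factors through `X₀`, so that `k₀` can be corrected by a map that factors through `X₀`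
  obtain ⟨g, hg⟩ := S.desc _ (k₀ ≫ ξ'.cx.d 1 0) (by
    rw [← Category.assoc, ← neg_eq_zero, ← Preadditive.neg_comp, ← hk₀, Category.assoc,
      ξ'.cx.d_comp_d, comp_zero])
  obtain ⟨e, he⟩ := ξ'.hom_exact_zero _ (S.ξ.mem 0) g (by
    rw [← cancel_epi (S.τ.α.f 0 ≫ S.κ.f 0), ← Category.assoc, hg, Category.assoc, ξ'.d_π,
      comp_zero, comp_zero])
  obtain ⟨l₀, hl₀⟩ : ∃ l₀ : S.τ.T.X 0 ⟶ ξ'.cx.X 2,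
      l₀ ≫ ξ'.cx.d 2 1 = k₀ - (S.τ.α.f 0 ≫ S.κ.f 0) ≫ e :=
    ξ'.hom_exact_pos _ (hT 0) 1 one_pos _ (by
      change _ ≫ ξ'.cx.d 1 0 = 0
      rw [Preadditive.sub_comp, Category.assoc _ e, he, hg, sub_self])
  have hd : S.τ.T.d 1 0 ≫ (S.τ.α.f 0 ≫ S.κ.f 0) = 0 := by
    rw [← S.τ.α.comm_assoc, ← S.κ.comm, ← Category.assoc, S.α_κ 1 le_rfl, zero_comp]
  obtain ⟨l, -, hl⟩ := exists_family_up S.τ.T ξ'.cx (fun n => n + 1 + 1) (fun _ => rfl) 1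
    (fun n => k (n + 1)) 0
    (Function.update (β := fun n => S.τ.T.X n ⟶ ξ'.cx.X (n + 1 + 1)) (fun _ => 0) 0 l₀)
    (fun j => by
      rw [Function.update_self]
      by_cases hj : j + 1 = 2
      · obtain rfl : j = 1 := by lia
        have key : (S.τ.T.d 1 0 ≫ l₀ + k₁) ≫ ξ'.cx.d 2 1 = 0 := by
          rw [Preadditive.add_comp, Category.assoc, hl₀, hk₀, Preadditive.comp_sub,
            ← Category.assoc _ _ e, hd, zero_comp, sub_zero, add_neg_cancel]
        rw [hkk₁] at key
        rw [one_smul]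
        exact key
      · rw [ξ'.cx.shape _ _ (by simpa using hj), comp_zero])
    (fun n hn => by
      rw [one_smul]
      exact add_eq_zero_iff_eq_neg.2 (hk (n + 1) (by lia)))
    (fun n hn f hf => ξ'.exists_lift_succ (hT _) (n + 1 + 1) (by lia) f hf)
  exact ⟨l, fun n hn => by simpa using hl n hn⟩

/-- The connecting maps of two split diagrams commute with liftings of a morphism `f : M ⟶ M'`. The
explicit null-homotopy combines the two homotopies `ψ ≫ α' ∼ α ≫ φ` and `κ ≫ χ ∼ φ ≫ κ'` with the
contraction `l` of the family `k` that they define. -/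
theorem δ_natural_left (h𝒲 : 𝒲 ≤ 𝒳) {M' : A} (S' : SplitComparison 𝒲 𝒳 M') {f : M ⟶ M'}
    {φ : S.τ.W.cx ⟶ S'.τ.W.cx} {ψ : S.τ.T ⟶ S'.τ.T} {χ : S.ξ.cx ⟶ S'.ξ.cx}
    (hτ : S.τ.IsLift S'.τ f φ ψ) (hξ : S.ξ.IsLift S'.ξ.toResolution f χ) (hn : 1 ≤ n) :
    S'.δ N n ≫ extMapLeft χ N (n + 1) = extMapLeft ψ N n ≫ S.δ N n := by
  obtain ⟨H⟩ := hτ.comm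
  obtain ⟨G⟩ : Nonempty (Homotopy (S.κ ≫ χ) (φ ≫ S'.κ)) := by
    refine lift_unique h𝒲 (Y := S'.ξ) (f := f) ?_ ?_
    · simpa using S.lift.comp hξ
    · simpa using hτ.lift.comp S'.lift
  let k : ∀ n, S.τ.T.X n ⟶ S'.ξ.cx.X (n + 1) := fun n =>
    S.τ.α.f n ≫ G.hom n (n + 1) - H.hom n (n + 1) ≫ S'.κ.f (n + 1)
  obtain ⟨l, hl⟩ := S.exists_contraction h𝒲 S'.ξ k (fun n hn => by
    have h1 := congrArg (S.τ.α.f (n + 1) ≫ ·) (homotopy_eq G n)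
    have h2 := congrArg (· ≫ S'.κ.f (n + 1)) (homotopy_eq H n)
    have h3 := S'.α_κ (n + 1) (by lia)
    have h4 := congrArg (· ≫ χ.f (n + 1)) (S.α_κ (n + 1) (by lia))
    simp only [HomologicalComplex.comp_f, Category.assoc, Preadditive.add_comp,
      Preadditive.comp_add, zero_comp] at h1 h2 h4
    rw [h4] at h1
    rw [h3, comp_zero] at h2
    simp only [k, Preadditive.sub_comp, Preadditive.comp_sub, Category.assoc, S'.κ.comm,
      ← S.τ.α.comm_assoc]
    grind)
  ext e
  obtain ⟨t, rfl⟩ := extMk_surjective e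
  obtain ⟨m, rfl⟩ : ∃ m, n = m + 1 := ⟨n - 1, by lia⟩
  rw [ConcreteCategory.comp_apply, ConcreteCategory.comp_apply, S'.δ_extMk hn, extMapLeft_extMk,
    extMapLeft_extMk, S.δ_extMk hn, ← sub_eq_zero, ← map_sub, extMk_eq_zero_iff _ (m + 1) rfl]
  refine ⟨S.ι (m + 1) ≫ φ.f (m + 1) ≫ S'.σ (m + 1) ≫ t.1
    + S.u m ≫ H.hom m (m + 1) ≫ S'.σ (m + 1) ≫ t.1
    + S.ι (m + 1) ≫ G.hom (m + 1) (m + 1 + 1) ≫ S'.u (m + 1) ≫ t.1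
    + S.u m ≫ l m ≫ S'.u (m + 1) ≫ t.1, ?_⟩
  change _ = χ.f (m + 1 + 1) ≫ S'.u (m + 1) ≫ t.1 - S.u (m + 1) ≫ ψ.f (m + 1) ≫ t.1
  have hx : ∀ j, S'.ξ.cx.d j (m + 1 + 1) ≫ S'.u (m + 1) ≫ t.1 = 0 :=
    d_comp_cocycle (⟨_, S'.u_cocycle (by lia) t⟩ : cocycles S'.ξ.cx N (m + 1 + 1))
  have e₁ := congrArg (fun z => S.ι (m + 1 + 1) ≫ z ≫ S'.u (m + 1) ≫ t.1)
    (homotopy_eq G (m + 1))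
  have e₂ := congrArg (· ≫ t.1) (S'.d_σ (n := m + 1) (by lia))
  have e₃ := congrArg (· ≫ φ.f (m + 1) ≫ S'.σ (m + 1) ≫ t.1) (S.ι_d (m + 1) (by lia))
  have e₄ := congrArg (fun z => S.u (m + 1) ≫ z ≫ S'.σ (m + 1) ≫ t.1) (homotopy_eq H m)
  have e₅ := congrArg (· ≫ H.hom m (m + 1) ≫ S'.σ (m + 1) ≫ t.1) (S.u_d m (by lia))
  have e₆ := congrArg (· ≫ G.hom (m + 1) (m + 1 + 1) ≫ S'.u (m + 1) ≫ t.1)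
    (S.ι_d (m + 1) (by lia))
  have e₇ := congrArg (fun z => S.u (m + 1) ≫ z ≫ S'.u (m + 1) ≫ t.1) (hl m (by lia))
  have e₈ := congrArg (· ≫ l m ≫ S'.u (m + 1) ≫ t.1) (S.u_d m (by lia))
  have e₉ := congrArg (· ≫ χ.f (m + 1 + 1) ≫ S'.u (m + 1) ≫ t.1) (S.ι_κ (m + 1 + 1) (by lia))
  have e₁₀ := congrArg (· ≫ t.1) (S'.α_σ (m + 1) (by lia))
  simp only [HomologicalComplex.comp_f, Category.assoc, Preadditive.add_comp,
    Preadditive.comp_add, hx, comp_zero, d_comp_cocycle, zero_add, add_zero,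
    Preadditive.neg_comp, Category.id_comp, k, Preadditive.sub_comp, Preadditive.comp_sub]
    at e₁ e₂ e₃ e₄ e₅ e₆ e₇ e₈ e₉ e₁₀ ⊢
  rw [← φ.comm_assoc, e₂] at e₃
  rw [e₁₀, e₂] at e₄
  rw [e₉] at e₁
  grind

end SplitComparison

end Split

/-! ### Independence of the choices -/

section Transport

variable {A : Type u} [Category.{v} A] [Abelian A] {𝒲 𝒳 : ObjectProperty A}

theorem exact_of_ladder {X Y Z X' Y' Z' : AddCommGrpCat.{v}} {f : X ⟶ Y} {g : Y ⟶ Z}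
    {f' : X' ⟶ Y'} {g' : Y' ⟶ Z'} {a : X ⟶ X'} {b : Y ⟶ Y'} {c : Z ⟶ Z'} [IsIso a] [IsIso b]
    [IsIso c] (hf : f ≫ b = a ≫ f') (hg : g ≫ c = b ≫ g') (h : Function.Exact f' g') :
    Function.Exact f g := by
  have ha : Function.Bijective a := ConcreteCategory.bijective_of_isIso a
  have hb : Function.Bijective b := ConcreteCategory.bijective_of_isIso b
  have hc : Function.Bijective c := ConcreteCategory.bijective_of_isIso c
  have hf' : ∀ x, b (f x) = f' (a x) := ConcreteCategory.congr_hom hf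
  have hg' : ∀ y, c (g y) = g' (b y) := ConcreteCategory.congr_hom hg
  intro y
  rw [← map_eq_zero_iff c.hom hc.1]
  refine (Eq.congr_left (hg' y)).trans ((h (b y)).trans ⟨?_, ?_⟩)
  · rintro ⟨x', hx'⟩
    obtain ⟨x, rfl⟩ := ha.2 x'
    exact ⟨x, hb.1 ((hf' x).trans hx')⟩
  · rintro ⟨x, rfl⟩
    exact ⟨a x, (hf' x).symm⟩

theorem IsLongExact.of_ladder {d : ℤ} {E F G E' F' G' : ℤ → AddCommGrpCat.{v}}
    {θ : ∀ n, E n ⟶ F n} {ε : ∀ n, F n ⟶ G n} {δ : ∀ n, G n ⟶ E (n + 1)}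
    {θ' : ∀ n, E' n ⟶ F' n} {ε' : ∀ n, F' n ⟶ G' n} {δ' : ∀ n, G' n ⟶ E' (n + 1)}
    {a : ∀ n, E n ⟶ E' n} {b : ∀ n, F n ⟶ F' n} {c : ∀ n, G n ⟶ G' n}
    (l : IsLadder θ ε δ θ' ε' δ' a b c) (ha : ∀ n, IsIso (a n)) (hb : ∀ n, IsIso (b n))
    (hc : ∀ n, IsIso (c n)) (h : IsLongExact d θ' ε' δ') : IsLongExact d θ ε δ where
  injective hd x y hxy := by
    have hθ : ∀ x, b 1 (θ 1 x) = θ' 1 (a 1 x) := ConcreteCategory.congr_hom (l.comm_θ 1 le_rfl)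
    exact (ConcreteCategory.bijective_of_isIso (a 1)).1
      (h.injective hd ((hθ x).symm.trans ((congrArg _ hxy).trans (hθ y))))
  exact_F n h₁ h₂ := exact_of_ladder (l.comm_θ n h₁) (l.comm_ε n h₁) (h.exact_F n h₁ h₂)
  exact_G n h₁ h₂ := exact_of_ladder (l.comm_ε n h₁) (l.comm_δ n h₁) (h.exact_G n h₁ h₂)
  exact_E n h₁ h₂ :=
    exact_of_ladder (l.comm_δ n h₁) (l.comm_θ (n + 1) (by lia)) (h.exact_E n h₁ h₂)
  surjective hd z := by
    have hε : ∀ x, c d (ε d x) = ε' d (b d x) := ConcreteCategory.congr_hom (l.comm_ε d hd)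
    obtain ⟨y', hy'⟩ := h.surjective hd (c d z)
    obtain ⟨y, rfl⟩ := (ConcreteCategory.bijective_of_isIso (b d)).2 y'
    exact ⟨y, (ConcreteCategory.bijective_of_isIso (c d)).1 ((hε y).trans hy')⟩

theorem subsingleton_ext {K : ChainComplex A ℤ} {n : ℤ} (h : IsZero (K.X n)) (N : A)
    (e : ext K N n) : e = 0 := by
  obtain ⟨c, rfl⟩ := extMk_surjective e
  rw [show c = 0 from Subtype.ext (h.eq_of_src _ _), map_zero]

namespace SplitComparison

variable {M : A} (S : SplitComparison 𝒲 𝒳 M)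

theorem isLongExact {d : ℕ} (hd : ∀ n : ℤ, d < n → IsZero (S.ξ.cx.X n)) (N : A) :
    IsLongExact d (extMapLeft S.κ N) (extMapLeft S.τ.α N) (S.δ N) where
  injective _ := S.θ_injective
  exact_F n h _ := S.θ_ε_exact h
  exact_G n h _ := S.ε_δ_exact h
  exact_E n h _ := S.δ_θ_exact h
  surjective h e := (S.ε_δ_exact h e).1 (subsingleton_ext (hd _ (by lia)) N _)

theorem isIso_ε {d : ℕ} (hd : ∀ n : ℤ, d < n → IsZero (S.ξ.cx.X n)) (N : A) {n : ℤ}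
    (hn : d < n) : IsIso (extMapLeft S.τ.α N n) := by
  refine (ConcreteCategory.isIso_iff_bijective _).2 ⟨?_, fun e => ?_⟩
  · refine (injective_iff_map_eq_zero (extMapLeft S.τ.α N n).hom).2 fun e he => ?_
    obtain ⟨x, rfl⟩ := (S.θ_ε_exact (by lia) e).1 he
    rw [subsingleton_ext (hd n hn) N x]
    exact map_zero (extMapLeft S.κ N n).hom
  · exact (S.ε_δ_exact (by lia) e).1 (subsingleton_ext (hd _ (by lia)) N _)

end SplitComparison

theorem isIso_extMapLeft_of_isLift {P : ObjectProperty A} {M : A} {ξ ξ' : ProperResolution P M}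
    {χ : ξ.cx ⟶ ξ'.cx} (h : ξ.IsLift ξ'.toResolution (𝟙 M) χ) (N : A) (n : ℤ) :
    IsIso (extMapLeft χ N n) := by
  obtain ⟨χ', h'⟩ := exists_lift le_rfl ξ'.toResolution ξ (𝟙 M)
  refine isIso_extMapLeft_of_inverse (ψ := χ')
    (lift_unique (X := ξ.toResolution) (Y := ξ) le_rfl (f := 𝟙 M) ?_ ξ.isLift_id)
    (lift_unique (X := ξ'.toResolution) (Y := ξ') le_rfl (f := 𝟙 M) ?_ ξ'.isLift_id) N n
  · simpa using h.comp h'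
  · simpa using h'.comp h

theorem isIso_extMapLeft_of_tate_isLift {P : ObjectProperty A} {M : A} {τ τ' : TateResolution P M}
    {φ : τ.W.cx ⟶ τ'.W.cx} {ψ : τ.T ⟶ τ'.T} (h : τ.IsLift τ' (𝟙 M) φ ψ) (N : A) (n : ℤ) :
    IsIso (extMapLeft ψ N n) := by
  obtain ⟨φ', ψ', h'⟩ := exists_tate_lift (𝟙 M) τ' τ
  refine isIso_extMapLeft_of_inverse (ψ := ψ')
    (tate_lift_unique (f := 𝟙 M) (φ₁ := φ ≫ φ') ?_ τ.isLift_id).2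
    (tate_lift_unique (f := 𝟙 M) (φ₁ := φ' ≫ φ) ?_ τ'.isLift_id).2 N n
  · simpa using h.comp h'
  · simpa using h'.comp h

/-- If every object of finite `𝒳`-projective dimension has a split comparison diagram of the right
length, then relative and Tate cohomology are well defined and the comparison sequence exists. For
arbitrary resolutions the connecting homomorphism is transported from the split diagram. -/
theorem comparison_of_split (h𝒲 : 𝒲 ≤ 𝒳)
    (H : ∀ (M : A) (d : ℕ), relPd 𝒳 M = d →
      ∃ S : SplitComparison 𝒲 𝒳 M, ∀ n : ℤ, d < n → IsZero (S.ξ.cx.X n)) :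
    CohomologyWellDefined 𝒲 𝒳 ∧ Nonempty (ComparisonSequence 𝒲 𝒳) := by
  have H' : ∀ M : A, relPd 𝒳 M < ⊤ → ∃ S : SplitComparison 𝒲 𝒳 M, ∀ d : ℕ, relPd 𝒳 M = d →
      ∀ n : ℤ, d < n → IsZero (S.ξ.cx.X n) := fun M hM => by
    obtain ⟨d, hd⟩ := ENat.ne_top_iff_exists.1 hM.ne
    obtain ⟨S, hS⟩ := H M d hd.symm
    refine ⟨S, fun d' hd' => ?_⟩
    rw [← hd, Nat.cast_inj] at hd'
    exact hd' ▸ hS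
  choose S hS using H'
  have tl : ∀ {M : A} (hM : relPd 𝒳 M < ⊤) (τ : TateResolution 𝒲 M),
      ∃ (ψ : (S M hM).τ.T ⟶ τ.T) (φ : _), (S M hM).τ.IsLift τ (𝟙 M) φ ψ := fun hM τ => by
    obtain ⟨φ, ψ, h⟩ := exists_tate_lift (𝟙 _) (S _ hM).τ τ
    exact ⟨ψ, φ, h⟩
  have xl : ∀ {M : A} (hM : relPd 𝒳 M < ⊤) (ξ : ProperResolution 𝒳 M),
      ∃ χ, ξ.IsLift (S M hM).ξ.toResolution (𝟙 M) χ := fun hM ξ =>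
    exists_lift le_rfl ξ.toResolution (S _ hM).ξ (𝟙 _)
  choose ψ φ hψ using @tl
  choose χ hχ using @xl
  let δ : ∀ {M : A} (_ : relPd 𝒳 M < ⊤) (τ : TateResolution 𝒲 M) (ξ : ProperResolution 𝒳 M)
      (N : A) (n : ℤ), ext τ.T N n ⟶ ext ξ.cx N (n + 1) := fun {M} hM τ ξ N n =>
    extMapLeft (ψ hM τ) N n ≫ (S M hM).δ N n ≫ extMapLeft (χ hM ξ) N (n + 1)
  have comm_ε : ∀ {M M' : A} {f : M ⟶ M'} {τ : TateResolution 𝒲 M} {τ' : TateResolution 𝒲 M'}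
      {φ : τ.W.cx ⟶ τ'.W.cx} {ψ : τ.T ⟶ τ'.T} (_ : τ.IsLift τ' f φ ψ) (N : A) (n : ℤ),
      extMapLeft τ'.α N n ≫ extMapLeft ψ N n = extMapLeft φ N n ≫ extMapLeft τ.α N n := by
    intro M M' f τ τ' φ ψ h N n
    rw [← extMapLeft_comp, ← extMapLeft_comp, extMapLeft_eq_of_homotopy h.comm]
  refine ⟨?_, ⟨?_⟩⟩
  · exact
    { exists_tate := fun M hM => ⟨(S M hM).τ⟩
      exists_proper := fun M hM => ⟨(S M hM).ξ⟩
      exists_tate_lift := exists_tate_lift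
      tate_lift_unique := fun f τ τ' φ₁ φ₂ ψ₁ ψ₂ h₁ h₂ => tate_lift_unique h₁ h₂
      exists_proper_lift := fun f ξ ξ' => exists_lift le_rfl ξ.toResolution ξ' f
      proper_lift_unique := fun f ξ ξ' χ₁ χ₂ h₁ h₂ => lift_unique le_rfl h₁ h₂
      exists_compare := fun τ ξ => exists_lift h𝒲 τ.W.toResolution ξ (𝟙 _)
      compare_unique := fun τ ξ κ₁ κ₂ h₁ h₂ => lift_unique h𝒲 h₁ h₂ }
  have natural_left : ∀ {M M' : A} (hM : relPd 𝒳 M < ⊤) (hM' : relPd 𝒳 M' < ⊤) (f : M ⟶ M')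
      (τ : TateResolution 𝒲 M) (ξ : ProperResolution 𝒳 M) (κ : τ.W.cx ⟶ ξ.cx)
      (τ' : TateResolution 𝒲 M') (ξ' : ProperResolution 𝒳 M') (κ' : τ'.W.cx ⟶ ξ'.cx)
      (φ : τ.W.cx ⟶ τ'.W.cx) (ψ : τ.T ⟶ τ'.T) (χ : ξ.cx ⟶ ξ'.cx) (N : A),
      τ.W.IsLift ξ.toResolution (𝟙 M) κ → τ'.W.IsLift ξ'.toResolution (𝟙 M') κ' →
      τ.IsLift τ' f φ ψ → ξ.IsLift ξ'.toResolution f χ →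
        IsLadder (extMapLeft κ' N) (extMapLeft τ'.α N) (δ hM' τ' ξ' N)
          (extMapLeft κ N) (extMapLeft τ.α N) (δ hM τ ξ N)
          (extMapLeft χ N) (extMapLeft φ N) (extMapLeft ψ N) := by
    intro M M' hM hM' f τ ξ κ τ' ξ' κ' φ₁ ψ₁ χ₁ N hκ hκ' hφ₁ hχ₁
    refine ⟨fun n _ => ?_, fun n _ => comm_ε hφ₁ N n, fun n hn => ?_⟩
    · rw [← extMapLeft_comp, ← extMapLeft_comp]
      refine extMapLeft_eq_of_homotopy (lift_unique h𝒲 (Y := ξ') (f := f) ?_ ?_) N n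
      · simpa using hφ₁.lift.comp hκ'
      · simpa using hκ.comp hχ₁
    · obtain ⟨φ₀, ψ₀, h₀⟩ := exists_tate_lift f (S M hM).τ (S M' hM').τ
      obtain ⟨χ₀, hχ₀⟩ := exists_lift le_rfl (S M hM).ξ.toResolution (S M' hM').ξ f
      have e₁ : Nonempty (Homotopy (χ₁ ≫ χ hM' ξ') (χ hM ξ ≫ χ₀)) := by
        refine lift_unique le_rfl (X := ξ.toResolution) (Y := (S M' hM').ξ) (f := f) ?_ ?_
        · simpa using hχ₁.comp (hχ hM' ξ')
        · simpa using (hχ hM ξ).comp hχ₀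
      have e₂ : Nonempty (Homotopy (ψ₀ ≫ ψ hM' τ') (ψ hM τ ≫ ψ₁)) := by
        refine (tate_lift_unique (f := f) (φ₁ := φ₀ ≫ φ hM' τ') (φ₂ := φ hM τ ≫ φ₁) ?_ ?_).2
        · simpa using h₀.comp (hψ hM' τ')
        · simpa using (hψ hM τ).comp hφ₁
      simp only [δ, Category.assoc]
      rw [← extMapLeft_comp, extMapLeft_eq_of_homotopy e₁, extMapLeft_comp,
        reassoc_of% (S M hM).δ_natural_left h𝒲 (S M' hM') (N := N) h₀ hχ₀ hn,
        ← extMapLeft_comp_assoc, extMapLeft_eq_of_homotopy e₂, extMapLeft_comp, Category.assoc]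
  refine
    { δ := δ
      natural_left := natural_left
      exact := ?_
      isIso := ?_
      natural_right := ?_ }
  · intro M d hd hM τ ξ κ N hκ
    obtain ⟨χ', hχ'⟩ := exists_lift le_rfl (S M hM).ξ.toResolution ξ (𝟙 M)
    have e₁ : Nonempty (Homotopy (χ' ≫ χ hM ξ) (𝟙 _)) := by
      refine lift_unique le_rfl (X := (S M hM).ξ.toResolution) (Y := (S M hM).ξ) (f := 𝟙 M) ?_
        (Resolution.isLift_id _)
      simpa using hχ'.comp (hχ hM ξ)
    have l := natural_left hM hM (𝟙 M) (S M hM).τ (S M hM).ξ (S M hM).κ τ ξ κ (φ hM τ) (ψ hM τ) χ' N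
      (S M hM).lift hκ (hψ hM τ) hχ'
    refine IsLongExact.of_ladder (δ' := (S M hM).δ N)
      (a := extMapLeft χ' N) (b := extMapLeft (φ hM τ) N) (c := extMapLeft (ψ hM τ) N)
      ⟨l.comm_θ, l.comm_ε, fun n hn => ?_⟩ (isIso_extMapLeft_of_isLift hχ' N)
      (isIso_extMapLeft_of_isLift (hψ hM τ).lift N)
      (isIso_extMapLeft_of_tate_isLift (hψ hM τ) N) ((S M hM).isLongExact (hS M hM d hd) N)
    simp only [δ, Category.assoc]
    rw [← extMapLeft_comp, extMapLeft_eq_of_homotopy e₁, extMapLeft_id, Category.comp_id]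
  · intro M d hd τ N n hn
    have hM : relPd 𝒳 M < ⊤ := hd ▸ ENat.natCast_lt_top d
    have h₁ := (S M hM).isIso_ε (hS M hM d hd) N hn
    have h₂ := isIso_extMapLeft_of_isLift (hψ hM τ).lift N n
    have h₃ := isIso_extMapLeft_of_tate_isLift (hψ hM τ) N n
    have h₄ : IsIso (extMapLeft τ.α N n ≫ extMapLeft (ψ hM τ) N n) := by
      rw [comm_ε (hψ hM τ) N n]
      infer_instance
    exact IsIso.of_isIso_comp_right _ (extMapLeft (ψ hM τ) N n)
  · intro M hM τ ξ κ N N' g hκ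
    have h₁ := extMapLeft_naturality (ψ hM τ) g
    have h₂ := extMapLeft_naturality (χ hM ξ) g
    refine ⟨fun n _ => extMapLeft_naturality κ g n,
      fun n _ => extMapLeft_naturality τ.α g n, fun n hn => ?_⟩
    change (_ ≫ _ ≫ _) ≫ _ = _ ≫ _ ≫ _ ≫ _
    rw [Category.assoc, Category.assoc, h₂, ← Category.assoc ((S M hM).δ N n),
      (S M hM).δ_naturality hn g, ← Category.assoc (extMapRight τ.T g n), ← h₁]
    simp only [Category.assoc]

end Transport

/-! ### Short exact sequences and the vanishing of `Ext` -/

section ShortExact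

variable {A : Type u} [Category.{v} A] [Abelian A]

/-- The sequence `0 → X → Y → Z → 0` with maps `i` and `p` is exact. -/
def IsShortExact {X Y Z : A} (i : X ⟶ Y) (p : Y ⟶ Z) : Prop :=
  ∃ h : i ≫ p = 0, (ShortComplex.mk i p h).ShortExact

namespace IsShortExact

variable {X Y Z V : A} {i : X ⟶ Y} {p : Y ⟶ Z}

theorem w (h : IsShortExact i p) : i ≫ p = 0 := h.1

theorem mono (h : IsShortExact i p) : Mono i := h.2.mono_f

theorem epi (h : IsShortExact i p) : Epi p := h.2.epi_g

theorem exact (h : IsShortExact i p) : (ShortComplex.mk i p h.w).Exact := h.2.exact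

theorem exists_lift_of_comp_eq_zero (h : IsShortExact i p) (f : V ⟶ Y) (hf : f ≫ p = 0) :
    ∃ g : V ⟶ X, g ≫ i = f :=
  have := h.2.mono_f
  ⟨h.2.exact.lift f hf, h.2.exact.lift_f f hf⟩

theorem exists_desc_of_comp_eq_zero (h : IsShortExact i p) (f : Y ⟶ V) (hf : i ≫ f = 0) :
    ∃ g : Z ⟶ V, p ≫ g = f :=
  have := h.2.epi_g
  ⟨h.2.exact.desc f hf, h.2.exact.g_desc f hf⟩

theorem of_exact (w : i ≫ p = 0) (h : (ShortComplex.mk i p w).Exact) (hi : Mono i) (hp : Epi p) :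
    IsShortExact i p := ⟨w, ShortComplex.ShortExact.mk' h hi hp⟩

theorem kernel (p : Y ⟶ Z) [Epi p] : IsShortExact (kernel.ι p) p :=
  of_exact (kernel.condition p)
    (ShortComplex.exact_of_f_is_kernel _ (kernelIsKernel p)) inferInstance inferInstance

theorem cokernel (i : X ⟶ Y) [Mono i] : IsShortExact i (cokernel.π i) :=
  of_exact (cokernel.condition i)
    (ShortComplex.exact_of_g_is_cokernel _ (cokernelIsCokernel i)) inferInstance inferInstance

theorem id_zero (hZ : IsZero Z) (p : Y ⟶ Z) : IsShortExact (𝟙 Y) p := by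
  obtain rfl : p = 0 := hZ.eq_of_tgt _ _
  exact of_exact (by simp) ((ShortComplex.exact_iff_epi _ rfl).2 inferInstance) inferInstance
    ⟨fun _ _ _ => hZ.eq_of_src _ _⟩

theorem zero_id (hX : IsZero X) (i : X ⟶ Y) : IsShortExact i (𝟙 Y) := by
  obtain rfl : i = 0 := hX.eq_of_src _ _
  exact of_exact (by simp) ((ShortComplex.exact_iff_mono _ rfl).2 inferInstance)
    ⟨fun _ _ _ => hX.eq_of_tgt _ _⟩ inferInstance

theorem of_iso_right {Z' : A} (h : IsShortExact i p) (e : Z ≅ Z') :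
    IsShortExact i (p ≫ e.hom) := by
  obtain ⟨w, h⟩ := h
  have hw : i ≫ p ≫ e.hom = 0 := by rw [← Category.assoc, w, zero_comp]
  exact ⟨hw, ShortComplex.shortExact_of_iso
    (ShortComplex.isoMk (S₁ := .mk i p w) (S₂ := .mk i (p ≫ e.hom) hw) (Iso.refl _) (Iso.refl _) e
      (by simp) (by simp)) h⟩

theorem of_iso_left {X' : A} (h : IsShortExact i p) (e : X' ≅ X) :
    IsShortExact (e.hom ≫ i) p := by
  obtain ⟨w, h⟩ := h
  have hw : (e.hom ≫ i) ≫ p = 0 := by rw [Category.assoc, w, comp_zero]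
  exact ⟨hw, ShortComplex.shortExact_of_iso
    (ShortComplex.isoMk (S₁ := .mk i p w) (S₂ := .mk (e.hom ≫ i) p hw) e.symm (Iso.refl _)
      (Iso.refl _) (by simp) (by simp)) h⟩

/-- The cokernel of a monomorphism does not change under a cobase change. -/
theorem of_isPushout {X' Y' Q : A} {t : X ⟶ X'} {l : X ⟶ Y} {r : X' ⟶ Y'} {b : Y ⟶ Y'}
    (sq : IsPushout t l r b) {q : Y ⟶ Q} (h : IsShortExact l q) :
    ∃ q' : Y' ⟶ Q, IsShortExact r q' := by
  have hw : r ≫ sq.desc 0 q (by simp [h.w]) = 0 := sq.inl_desc _ _ _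
  have hq : b ≫ sq.desc 0 q (by simp [h.w]) = q := sq.inr_desc _ _ _
  refine ⟨sq.desc 0 q (by simp [h.w]), of_exact hw ?_ ?_ ?_⟩
  · rw [ShortComplex.exact_iff_exact_up_to_refinements]
    intro V x hx
    obtain ⟨V', c, hc, x₂, x₃, e⟩ := sq.hom_eq_add_up_to_refinements x
    change x ≫ sq.desc 0 q _ = 0 at hx
    have hx₃ : x₃ ≫ q = 0 := by
      have := congrArg (· ≫ sq.desc 0 q (by simp [h.w])) e
      simpa [hx, hw, hq] using this.symm
    obtain ⟨x₁, rfl⟩ := h.exists_lift_of_comp_eq_zero x₃ hx₃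
    refine ⟨V', c, hc, x₂ + x₁ ≫ t, ?_⟩
    change c ≫ x = (x₂ + x₁ ≫ t) ≫ r
    rw [e, Preadditive.add_comp, Category.assoc, Category.assoc, sq.w]
  · exact (MorphismProperty.monomorphisms A).of_isPushout sq h.mono
  · have := h.epi
    exact epi_of_epi_fac hq

variable [HasExt.{w} A]

theorem exists_lift (h : IsShortExact i p) (hV : Subsingleton (Abelian.Ext.{w} V X 1))
    (f : V ⟶ Z) : ∃ g : V ⟶ Y, g ≫ p = f := by
  obtain ⟨x, hx⟩ := Abelian.Ext.covariant_sequence_exact₃ V h.2 (Abelian.Ext.mk₀ f) (zero_add 1)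
    (Subsingleton.elim _ _)
  obtain ⟨g, rfl⟩ := (Abelian.Ext.mk₀_bijective _ _).2 x
  refine ⟨g, (Abelian.Ext.mk₀_bijective _ _).1 ?_⟩
  rw [← hx, Abelian.Ext.mk₀_comp_mk₀]

theorem exists_desc (h : IsShortExact i p) (hV : Subsingleton (Abelian.Ext.{w} Z V 1))
    (f : X ⟶ V) : ∃ g : Y ⟶ V, i ≫ g = f := by
  obtain ⟨x, hx⟩ := Abelian.Ext.contravariant_sequence_exact₁ h.2 V (Abelian.Ext.mk₀ f)
    (add_zero 1) (Subsingleton.elim _ _)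
  obtain ⟨g, rfl⟩ := (Abelian.Ext.mk₀_bijective _ _).2 x
  refine ⟨g, (Abelian.Ext.mk₀_bijective _ _).1 ?_⟩
  rw [← hx, Abelian.Ext.mk₀_comp_mk₀]

theorem ext_eq_zero_right₂ (h : IsShortExact i p) {n : ℕ}
    (h₁ : Subsingleton (Abelian.Ext.{w} V X n)) (h₃ : Subsingleton (Abelian.Ext.{w} V Z n)) :
    Subsingleton (Abelian.Ext.{w} V Y n) := by
  refine subsingleton_of_forall_eq 0 fun x => ?_
  obtain ⟨y, rfl⟩ := Abelian.Ext.covariant_sequence_exact₂ V h.2 x (Subsingleton.elim _ _)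
  rw [Subsingleton.elim y 0, Abelian.Ext.zero_comp]

theorem ext_eq_zero_right₁ (h : IsShortExact i p) {n : ℕ}
    (h₂ : Subsingleton (Abelian.Ext.{w} V Y (n + 1)))
    (h₃ : Subsingleton (Abelian.Ext.{w} V Z n)) :
    Subsingleton (Abelian.Ext.{w} V X (n + 1)) := by
  refine subsingleton_of_forall_eq 0 fun x => ?_
  obtain ⟨y, rfl⟩ := Abelian.Ext.covariant_sequence_exact₁ V h.2 x (Subsingleton.elim _ _) rfl
  rw [Subsingleton.elim y 0, Abelian.Ext.zero_comp]

theorem ext_eq_zero_right₃ (h : IsShortExact i p) {n : ℕ}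
    (h₁ : Subsingleton (Abelian.Ext.{w} V X (n + 1)))
    (h₂ : Subsingleton (Abelian.Ext.{w} V Y n)) :
    Subsingleton (Abelian.Ext.{w} V Z n) := by
  refine subsingleton_of_forall_eq 0 fun x => ?_
  obtain ⟨y, rfl⟩ := Abelian.Ext.covariant_sequence_exact₃ V h.2 x rfl (Subsingleton.elim _ _)
  rw [Subsingleton.elim y 0, Abelian.Ext.zero_comp]

theorem ext_eq_zero_left₂ (h : IsShortExact i p) {n : ℕ}
    (h₁ : Subsingleton (Abelian.Ext.{w} X V n)) (h₃ : Subsingleton (Abelian.Ext.{w} Z V n)) :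
    Subsingleton (Abelian.Ext.{w} Y V n) := by
  refine subsingleton_of_forall_eq 0 fun x => ?_
  obtain ⟨y, rfl⟩ := Abelian.Ext.contravariant_sequence_exact₂ h.2 V x (Subsingleton.elim _ _)
  rw [Subsingleton.elim y 0, Abelian.Ext.comp_zero]

theorem ext_eq_zero_left₁ (h : IsShortExact i p) {n : ℕ}
    (h₂ : Subsingleton (Abelian.Ext.{w} Y V n))
    (h₃ : Subsingleton (Abelian.Ext.{w} Z V (n + 1))) :
    Subsingleton (Abelian.Ext.{w} X V n) := by
  refine subsingleton_of_forall_eq 0 fun x => ?_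
  obtain ⟨y, rfl⟩ := Abelian.Ext.contravariant_sequence_exact₁ h.2 V x (add_comm 1 n)
    (Subsingleton.elim _ _)
  rw [Subsingleton.elim y 0, Abelian.Ext.comp_zero]

theorem ext_eq_zero_left₃ (h : IsShortExact i p) {n : ℕ}
    (h₁ : Subsingleton (Abelian.Ext.{w} X V n))
    (h₂ : Subsingleton (Abelian.Ext.{w} Y V (n + 1))) :
    Subsingleton (Abelian.Ext.{w} Z V (n + 1)) := by
  refine subsingleton_of_forall_eq 0 fun x => ?_
  obtain ⟨y, rfl⟩ := Abelian.Ext.contravariant_sequence_exact₃ h.2 V x (Subsingleton.elim _ _)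
    (add_comm 1 n)
  rw [Subsingleton.elim y 0, Abelian.Ext.comp_zero]

theorem ext_one_eq_zero_right (h : IsShortExact i p)
    (h₂ : Subsingleton (Abelian.Ext.{w} V Y 1)) (hp : ∀ f : V ⟶ Z, ∃ g : V ⟶ Y, g ≫ p = f) :
    Subsingleton (Abelian.Ext.{w} V X 1) := by
  refine subsingleton_of_forall_eq 0 fun x => ?_
  obtain ⟨y, rfl⟩ := Abelian.Ext.covariant_sequence_exact₁ V h.2 x (Subsingleton.elim _ _)
    (zero_add 1)
  obtain ⟨f, rfl⟩ := (Abelian.Ext.mk₀_bijective _ _).2 y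
  obtain ⟨g, rfl⟩ := hp f
  rw [← Abelian.Ext.mk₀_comp_mk₀, Abelian.Ext.comp_assoc_of_second_deg_zero]
  have e := h.2.comp_extClass
  dsimp only at e
  rw [e, Abelian.Ext.comp_zero]

theorem ext_one_eq_zero_left (h : IsShortExact i p)
    (h₂ : Subsingleton (Abelian.Ext.{w} Y V 1)) (hi : ∀ f : X ⟶ V, ∃ g : Y ⟶ V, i ≫ g = f) :
    Subsingleton (Abelian.Ext.{w} Z V 1) := by
  refine subsingleton_of_forall_eq 0 fun x => ?_
  obtain ⟨y, rfl⟩ := Abelian.Ext.contravariant_sequence_exact₃ h.2 V x (Subsingleton.elim _ _)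
    (add_zero 1)
  obtain ⟨f, rfl⟩ := (Abelian.Ext.mk₀_bijective _ _).2 y
  obtain ⟨g, rfl⟩ := hi f
  rw [← Abelian.Ext.mk₀_comp_mk₀]
  exact h.2.extClass_comp_assoc (Abelian.Ext.mk₀ g)

end IsShortExact

variable [HasExt.{w} A] {X Y V : A} {n : ℕ}

theorem ext_eq_zero_of_retract_right (r : Retract X Y)
    (h : Subsingleton (Abelian.Ext.{w} V Y n)) : Subsingleton (Abelian.Ext.{w} V X n) := by
  refine subsingleton_of_forall_eq 0 fun x => ?_
  rw [← Abelian.Ext.comp_mk₀_id x, ← r.retract, ← Abelian.Ext.mk₀_comp_mk₀,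
    ← Abelian.Ext.comp_assoc_of_second_deg_zero,
    Subsingleton.elim (x.comp (Abelian.Ext.mk₀ r.i) _) 0, Abelian.Ext.zero_comp]

theorem ext_eq_zero_of_retract_left (r : Retract X Y)
    (h : Subsingleton (Abelian.Ext.{w} Y V n)) : Subsingleton (Abelian.Ext.{w} X V n) := by
  refine subsingleton_of_forall_eq 0 fun x => ?_
  rw [← Abelian.Ext.mk₀_id_comp x, ← r.retract, ← Abelian.Ext.mk₀_comp_mk₀,
    Abelian.Ext.comp_assoc_of_second_deg_zero,
    Subsingleton.elim ((Abelian.Ext.mk₀ r.r).comp x _) 0, Abelian.Ext.comp_zero]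

theorem ext_eq_zero_of_isZero_right (hX : IsZero X) : Subsingleton (Abelian.Ext.{w} V X n) := by
  refine subsingleton_of_forall_eq 0 fun x => ?_
  rw [← Abelian.Ext.comp_mk₀_id x, hX.eq_of_src (𝟙 X) 0, Abelian.Ext.mk₀_zero,
    Abelian.Ext.comp_zero]

end ShortExact

/-! ### Exactness tested on a class of objects -/

section Testing

variable {A : Type u} [Category.{v} A]

/-- Surjectivity of `X → Y` for generalised elements `x : V ⟶ Y` with `V` in `𝒬`, up to
precomposition with a morphism in `C`. -/
def SurjectiveUpTo (𝒬 : ObjectProperty A) (C : MorphismProperty A) {X Y : A} (f : X ⟶ Y) :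
    Prop :=
  ∀ ⦃V : A⦄, 𝒬 V → ∀ x : V ⟶ Y,
    ∃ (V' : A) (c : V' ⟶ V) (x' : V' ⟶ X), 𝒬 V' ∧ C c ∧ x' ≫ f = c ≫ x

theorem surjectiveUpTo_iso_iff {X Y : A} {f : X ⟶ Y} {𝒬 : ObjectProperty A} :
    SurjectiveUpTo 𝒬 (MorphismProperty.isomorphisms A) f ↔
    ∀ V, 𝒬 V → ∀ x : V ⟶ Y, ∃ x' : V ⟶ X, x' ≫ f = x := by
  constructor
  · intro h V hV x
    obtain ⟨V', c, x', -, hc, e⟩ := h hV x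
    have : IsIso c := hc
    exact ⟨inv c ≫ x', by rw [Category.assoc, e, IsIso.inv_hom_id_assoc]⟩
  · intro h V hV x
    obtain ⟨x', e⟩ := h V hV x
    exact ⟨V, 𝟙 V, x', hV, inferInstanceAs (IsIso (𝟙 V)), by rw [e, Category.id_comp]⟩

variable [Abelian A]

/-- Exactness of `X → Y → Z` at `Y` for generalised elements `x : V ⟶ Y` with `V` in `𝒬`, up to
precomposition with a morphism in `C`. For `𝒬 = ⊤` and `C` the epimorphisms this is exactness, for
`C` the isomorphisms it is exactness of `Hom(V, -)` for all `V` in `𝒬`. -/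
def ExactUpTo (𝒬 : ObjectProperty A) (C : MorphismProperty A) {X Y Z : A} (f : X ⟶ Y)
    (g : Y ⟶ Z) : Prop :=
  ∀ ⦃V : A⦄, 𝒬 V → ∀ x : V ⟶ Y, x ≫ g = 0 →
    ∃ (V' : A) (c : V' ⟶ V) (x' : V' ⟶ X), 𝒬 V' ∧ C c ∧ x' ≫ f = c ≫ x

variable {X Y Z : A} {f : X ⟶ Y} {g : Y ⟶ Z} {𝒬 : ObjectProperty A}

theorem exactUpTo_top_iff (w : f ≫ g = 0) :
    ExactUpTo ⊤ (MorphismProperty.epimorphisms A) f g ↔ (ShortComplex.mk f g w).Exact := by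
  rw [ShortComplex.exact_iff_exact_up_to_refinements]
  constructor
  · intro h V x hx
    obtain ⟨V', c, x', -, hc, e⟩ := h trivial x hx
    exact ⟨V', c, hc, x', e.symm⟩
  · intro h V _ x hx
    obtain ⟨V', c, hc, x', e⟩ := h x hx
    exact ⟨V', c, x', trivial, hc, e.symm⟩

theorem exactUpTo_iso_iff : ExactUpTo 𝒬 (MorphismProperty.isomorphisms A) f g ↔
    ∀ V, 𝒬 V → ∀ x : V ⟶ Y, x ≫ g = 0 → ∃ x' : V ⟶ X, x' ≫ f = x := by
  constructor
  · intro h V hV x hx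
    obtain ⟨V', c, x', -, hc, e⟩ := h hV x hx
    have : IsIso c := hc
    exact ⟨inv c ≫ x', by rw [Category.assoc, e, IsIso.inv_hom_id_assoc]⟩
  · intro h V hV x hx
    obtain ⟨x', e⟩ := h V hV x hx
    exact ⟨V, 𝟙 V, x', hV, inferInstanceAs (IsIso (𝟙 V)), by rw [e, Category.id_comp]⟩

theorem surjectiveUpTo_top_iff :
    SurjectiveUpTo ⊤ (MorphismProperty.epimorphisms A) f ↔ Epi f := by
  rw [epi_iff_surjective_up_to_refinements]
  constructor
  · intro h V x
    obtain ⟨V', c, x', -, hc, e⟩ := h trivial x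
    exact ⟨V', c, hc, x', e.symm⟩
  · intro h V _ x
    obtain ⟨V', c, hc, x', e⟩ := h x
    exact ⟨V', c, x', trivial, hc, e.symm⟩

theorem exactAt_succ_iff (K : ChainComplex A ℤ) (n : ℤ) : K.ExactAt (n + 1) ↔
    (ShortComplex.mk (K.d (n + 1 + 1) (n + 1)) (K.d (n + 1) n) (K.d_comp_d _ _ _)).Exact :=
  K.exactAt_iff' (n + 1 + 1) (n + 1) n (by simp) (by simp)

end Testing

/-! ### Gluing a totally acyclic complex to a resolution -/

section Gluing

variable {A : Type u} [Category.{v} A] [Abelian A]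

/-- The data of an extension `E` of a complex `X` in degrees `≥ 1` by a complex `T` in degrees
`≥ 0`: in each degree a biproduct decomposition `E = T ⊕ X` (with `E₀ = T₀`), and the component
`u : Xₙ₊₁ → Tₙ` of the differential. In degree `0` the projection `κ` to `X` is a given morphism
`p : T₀ ⟶ X₀`. -/
structure Gluing (T X : ChainComplex A ℤ) (p : T.X 0 ⟶ X.X 0) where
  /-- the objects of the extension -/
  E : ℤ → A
  /-- the inclusion of `T` -/
  α : ∀ n, T.X n ⟶ E n
  /-- the projection to `T` -/
  σ : ∀ n, E n ⟶ T.X n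
  /-- the inclusion of `X` -/
  ι : ∀ n, X.X n ⟶ E n
  /-- the projection to `X` -/
  κ : ∀ n, E n ⟶ X.X n
  /-- the component `X ⟶ T` of the differential -/
  u : ∀ n, X.X (n + 1) ⟶ T.X n
  isZero_E : ∀ n < 0, IsZero (E n)
  α_σ : ∀ n, 0 ≤ n → α n ≫ σ n = 𝟙 _
  ι_κ : ∀ n, 1 ≤ n → ι n ≫ κ n = 𝟙 _
  ι_σ : ∀ n, 0 ≤ n → ι n ≫ σ n = 0
  α_κ : ∀ n, 1 ≤ n → α n ≫ κ n = 0
  α_κ_zero : α 0 ≫ κ 0 = p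
  total : ∀ n, 0 ≤ n → σ n ≫ α n + κ n ≫ ι n = 𝟙 _
  ι_zero : ι 0 = 0
  isZero_X : ∀ n < 0, IsZero (X.X n)
  d_p : T.d 1 0 ≫ p = 0
  u_p : u 0 ≫ p = X.d 1 0
  u_d : ∀ n, 0 ≤ n → u (n + 1) ≫ T.d (n + 1) n = -(X.d (n + 1 + 1) (n + 1) ≫ u n)

namespace Gluing

variable {T X : ChainComplex A ℤ} {p : T.X 0 ⟶ X.X 0} (G : Gluing T X p)

/-- The differential of `E`. -/
def dE (n : ℤ) : G.E (n + 1) ⟶ G.E n := G.σ (n + 1) ≫ T.d (n + 1) n ≫ G.α n +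
  (G.κ (n + 1) ≫ X.d (n + 1) n ≫ G.ι n + G.κ (n + 1) ≫ G.u n ≫ G.α n)

theorem ι_dE {n : ℤ} (hn : 0 ≤ n) :
    G.ι (n + 1) ≫ G.dE n = X.d (n + 1) n ≫ G.ι n + G.u n ≫ G.α n := by
  have h₃ := G.ι_σ (n + 1) (by lia)
  have h₄ := G.ι_κ (n + 1) (by lia)
  simp only [dE, Preadditive.comp_add, reassoc_of% h₃, reassoc_of% h₄, zero_comp, zero_add]

theorem α_dE (n : ℤ) : G.α (n + 1) ≫ G.dE n = T.d (n + 1) n ≫ G.α n := by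
  rcases lt_or_ge n 0 with hn | hn
  · exact (G.isZero_E n hn).eq_of_tgt _ _
  · have h₁ := G.α_σ (n + 1) (by lia)
    have h₂ := G.α_κ (n + 1) (by lia)
    simp only [dE, Preadditive.comp_add, reassoc_of% h₁, reassoc_of% h₂, zero_comp, add_zero]

theorem dE_κ (n : ℤ) : G.dE n ≫ G.κ n = G.κ (n + 1) ≫ X.d (n + 1) n := by
  rcases lt_trichotomy n 0 with hn | rfl | hn
  · exact (G.isZero_X n hn).eq_of_tgt _ _
  · have h₁ := G.α_κ_zero
    have h₂ : T.d (0 + 1) 0 ≫ p = 0 := G.d_p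
    have h₃ : G.u 0 ≫ p = X.d (0 + 1) 0 := G.u_p
    simp only [dE, Preadditive.add_comp, Category.assoc, h₁, h₂, h₃, G.ι_zero, comp_zero,
      zero_add]
  · have h₁ := G.α_κ n hn
    have h₂ := G.ι_κ n hn
    simp only [dE, Preadditive.add_comp, Category.assoc, h₁, h₂, comp_zero, zero_add, add_zero,
      Category.comp_id]

theorem dE_σ {n : ℤ} (hn : 0 ≤ n) :
    G.dE n ≫ G.σ n = G.σ (n + 1) ≫ T.d (n + 1) n + G.κ (n + 1) ≫ G.u n := by
  have h₁ := G.α_σ n hn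
  have h₂ := G.ι_σ n hn
  simp only [dE, Preadditive.add_comp, Category.assoc, h₁, h₂, comp_zero, zero_add,
    Category.comp_id]

/-- The complex `E`. -/
def complex : ChainComplex A ℤ :=
  ChainComplex.of G.E G.dE (fun n => by
    rcases lt_or_ge n 0 with hn | hn
    · exact (G.isZero_E n hn).eq_of_tgt _ _
    · have h₁ := G.total (n + 1) (by lia)
      have h₂ := G.dE_κ (n + 1)
      have h₃ := G.dE_σ (n := n + 1) (by lia)
      have h₄ := G.ι_dE hn
      have h₅ := G.u_d n hn
      rw [← Category.id_comp (G.dE n), ← h₁]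
      simp only [Preadditive.add_comp, Preadditive.comp_add, Category.assoc, G.α_dE, h₄,
        reassoc_of% h₂, reassoc_of% h₃, reassoc_of% h₅, Preadditive.neg_comp,
        Preadditive.comp_neg, HomologicalComplex.d_comp_d_assoc, zero_comp, comp_zero, zero_add,
        neg_add_cancel])

theorem complex_d (n : ℤ) : G.complex.d (n + 1) n = G.dE n := ChainComplex.of_d _ _ _

/-- The inclusion of `T` as a morphism of complexes. -/
def inclusion : T ⟶ G.complex where
  f := G.α
  comm' i j hij := by
    obtain rfl : j + 1 = i := hij
    exact (congrArg (G.α (j + 1) ≫ ·) (G.complex_d j)).trans (G.α_dE j)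

/-- The projection to `X` as a morphism of complexes. -/
def projection : G.complex ⟶ X where
  f := G.κ
  comm' i j hij := by
    obtain rfl : j + 1 = i := hij
    exact ((congrArg (· ≫ G.κ j) (G.complex_d j)).trans (G.dE_κ j)).symm

variable {𝒬 : ObjectProperty A} {C : MorphismProperty A} [C.IsStableUnderComposition]

/-- If `(t, x')` is a cycle of `E = T ⊕ X`, then `x'` is a boundary `y ≫ d`, and `t - y ≫ u` is a cycle
of `T`. -/
theorem exactUpTo_succ {n : ℤ} (hn : 0 ≤ n)
    (hT : ExactUpTo 𝒬 C (T.d (n + 1 + 1) (n + 1)) (T.d (n + 1) n))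
    (hX : ExactUpTo 𝒬 C (X.d (n + 1 + 1) (n + 1)) (X.d (n + 1) n)) :
    ExactUpTo 𝒬 C (G.dE (n + 1)) (G.dE n) := by
  intro V hV f hf
  have hfκ : (f ≫ G.κ (n + 1)) ≫ X.d (n + 1) n = 0 := by
    rw [Category.assoc, ← G.dE_κ, ← Category.assoc, hf, zero_comp]
  have hfσ : f ≫ G.σ (n + 1) ≫ T.d (n + 1) n = -(f ≫ G.κ (n + 1) ≫ G.u n) := by
    have h := congrArg (· ≫ G.σ n) hf
    simp only [Category.assoc, G.dE_σ hn, Preadditive.comp_add, zero_comp] at h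
    exact eq_neg_of_add_eq_zero_left h
  obtain ⟨V₁, c₁, y, hV₁, hc₁, hy⟩ := hX hV _ hfκ
  obtain ⟨V₂, c₂, s, hV₂, hc₂, hs⟩ := hT hV₁ (c₁ ≫ f ≫ G.σ (n + 1) - y ≫ G.u (n + 1)) (by
    rw [Preadditive.sub_comp, Category.assoc, Category.assoc, Category.assoc, hfσ, G.u_d n hn,
      Preadditive.comp_neg, Preadditive.comp_neg, ← Category.assoc y, hy]
    simp only [Category.assoc]
    abel)
  refine ⟨V₂, c₂ ≫ c₁, s ≫ G.α _ + c₂ ≫ y ≫ G.ι _, hV₂, C.comp_mem _ _ hc₂ hc₁, ?_⟩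
  have hid := congrArg (fun z => c₂ ≫ c₁ ≫ f ≫ z) (G.total (n + 1) (by lia))
  have h₁ := congrArg (· ≫ G.α (n + 1)) hs
  have h₂ := congrArg (fun z => c₂ ≫ z ≫ G.ι (n + 1)) hy
  have h₃ := G.ι_dE (n := n + 1) (by lia)
  have h₄ := G.α_dE (n + 1)
  simp only [Preadditive.add_comp, Preadditive.sub_comp, Preadditive.comp_sub,
    Preadditive.comp_add, Category.assoc, Category.comp_id, h₃, h₄] at hid h₁ h₂ ⊢
  grind

theorem exactUpTo_zero {M : A} {π : X.X 0 ⟶ M} (hp : ExactUpTo 𝒬 C (T.d 1 0) p)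
    (hX : ExactUpTo 𝒬 C (X.d 1 0) π) : ExactUpTo 𝒬 C (G.dE 0) (G.κ 0 ≫ π) := by
  intro V hV f hf
  have hid : f ≫ G.σ 0 ≫ G.α 0 = f := by
    have := congrArg (f ≫ ·) (G.total 0 le_rfl)
    simpa [G.ι_zero] using this
  have hfκ : f ≫ G.κ 0 = (f ≫ G.σ 0) ≫ p := by
    conv_lhs => rw [← hid]
    rw [Category.assoc, Category.assoc, G.α_κ_zero, Category.assoc]
  obtain ⟨V₁, c₁, y, hV₁, hc₁, hy⟩ := hX hV (f ≫ G.κ 0) (by rw [Category.assoc, hf])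
  obtain ⟨V₂, c₂, s, hV₂, hc₂, hs⟩ := hp hV₁ (c₁ ≫ f ≫ G.σ 0 - y ≫ G.u 0) (by
    rw [Preadditive.sub_comp, Category.assoc c₁, ← hfκ, Category.assoc, G.u_p]
    exact sub_eq_zero.2 hy.symm)
  refine ⟨V₂, c₂ ≫ c₁, s ≫ G.α (0 + 1) + c₂ ≫ y ≫ G.ι (0 + 1), hV₂, C.comp_mem _ _ hc₂ hc₁, ?_⟩
  have h₁ := congrArg (· ≫ G.α 0) hs
  have h₃ : G.ι (0 + 1) ≫ G.dE 0 = G.u 0 ≫ G.α 0 := by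
    rw [G.ι_dE le_rfl, G.ι_zero, comp_zero]
    exact zero_add _
  have h₄ := G.α_dE 0
  simp only [Preadditive.add_comp, Preadditive.sub_comp, Preadditive.comp_sub,
    Category.assoc, hid, h₃, h₄] at h₁ ⊢
  exact (congrArg (· + _) h₁).trans (sub_add_cancel _ _)

theorem surjectiveUpTo_zero {M : A} {π : X.X 0 ⟶ M} (hp : SurjectiveUpTo 𝒬 C p)
    (hX : SurjectiveUpTo 𝒬 C π) : SurjectiveUpTo 𝒬 C (G.κ 0 ≫ π) := by
  intro V hV f
  obtain ⟨V₁, c₁, x, hV₁, hc₁, hx⟩ := hX hV f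
  obtain ⟨V₂, c₂, t, hV₂, hc₂, ht⟩ := hp hV₁ x
  refine ⟨V₂, c₂ ≫ c₁, t ≫ G.α 0, hV₂, C.comp_mem _ _ hc₂ hc₁, ?_⟩
  have h₁ := G.α_κ_zero
  rw [Category.assoc, reassoc_of% h₁, reassoc_of% ht, hx, Category.assoc]

end Gluing

end Gluing

/-! ### Existence of split comparison diagrams -/

section SplitExistence

variable {A : Type u} [Category.{v} A] [Abelian A] {𝒲 𝒳 : ObjectProperty A}

/-- The objects of the glued complex with their biproduct structure maps: `0` in negative degrees,
`T₀` in degree `0`, and `Tₙ ⊞ Xₙ` in degrees `n ≥ 1`. -/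
theorem exists_biprod_family (h𝒲 : IsAdditiveSubcategory 𝒲) (T X : ℤ → A)
    (hT : ∀ n, 𝒲 (T n)) (hX : ∀ n, 1 ≤ n → 𝒲 (X n)) (q : ∀ n, T n ⟶ X n) (n : ℤ) :
    ∃ (E : A) (α : T n ⟶ E) (σ : E ⟶ T n) (ι : X n ⟶ E) (κ : E ⟶ X n), 𝒲 E ∧
      (n < 0 → IsZero E) ∧ (0 ≤ n → α ≫ σ = 𝟙 _) ∧ (1 ≤ n → ι ≫ κ = 𝟙 _) ∧
      (0 ≤ n → ι ≫ σ = 0) ∧ (1 ≤ n → α ≫ κ = 0) ∧ (n = 0 → α ≫ κ = q n) ∧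
      (0 ≤ n → σ ≫ α + κ ≫ ι = 𝟙 _) ∧ (n = 0 → ι = 0) := by
  rcases lt_trichotomy n 0 with hn | hn | hn
  · obtain ⟨Z, hZ, hWZ⟩ := h𝒲.zero
    exact ⟨Z, 0, 0, 0, 0, hWZ, fun _ => hZ, by lia, by lia, by lia, by lia, by lia, by lia,
      by lia⟩
  · exact ⟨T n, 𝟙 _, 𝟙 _, 0, q n, hT n, by lia, by simp, by lia, by simp, by lia, by simp,
      by simp, fun _ => rfl⟩
  · exact ⟨T n ⊞ X n, biprod.inl, biprod.fst, biprod.inr, biprod.snd,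
      h𝒲.biprod _ _ (hT n) (hX n (by lia)), by lia, by simp, by simp, by simp, by simp, by lia,
      by simp [biprod.total], by lia⟩

/-- A split comparison diagram can be built on a proper `𝒳`-resolution whose terms in degrees
`≥ 1` belong to `𝒲`, and on a totally `𝒲`-acyclic complex that continues a proper presentation of
the term in degree `0`. -/
theorem exists_splitComparison (h𝒲 : IsAdditiveSubcategory 𝒲) (h𝒲𝒳 : 𝒲 ≤ 𝒳) {M : A}
    (ξ : ProperResolution 𝒳 M) (hξ : ∀ n, 1 ≤ n → 𝒲 (ξ.cx.X n)) (m : ℤ)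
    (hm : ∀ n, m ≤ n → IsZero (ξ.cx.X n)) (T : ChainComplex A ℤ) (hT : IsTotallyAcyclic 𝒲 T)
    (p : T.X 0 ⟶ ξ.cx.X 0) (hp : Epi p) (w : T.d 1 0 ≫ p = 0)
    (hTp : (ShortComplex.mk (T.d 1 0) p w).Exact)
    (hom_surjective : ∀ V, 𝒲 V → ∀ f : V ⟶ ξ.cx.X 0, ∃ g, g ≫ p = f)
    (hom_exact : ∀ V, 𝒲 V → ∀ f : V ⟶ T.X 0, f ≫ p = 0 → ∃ g, g ≫ T.d 1 0 = f) :
    ∃ S : SplitComparison 𝒲 𝒳 M, S.ξ = ξ := by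
  choose E α σ ι κ hE hE₀ hασ hικ hισ hακ hακ₀ htotal hι₀ using
    exists_biprod_family h𝒲 T.X ξ.cx.X hT.mem hξ
      (Function.update (β := fun n => T.X n ⟶ ξ.cx.X n) (fun _ => 0) 0 p)
  obtain ⟨u₀, hu₀⟩ := hom_surjective _ (hξ 1 le_rfl) (ξ.cx.d 1 0)
  obtain ⟨u, hu, hud⟩ := exists_extend_up (F := fun n => ξ.cx.X (n + 1) ⟶ T.X n)
    (fun n x y => y ≫ T.d (n + 1) n = -(ξ.cx.d (n + 1 + 1) (n + 1) ≫ x)) 0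
    (Function.update (β := fun n => ξ.cx.X (n + 1) ⟶ T.X n) (fun _ => 0) 0 u₀)
    (fun n hn u hu hd => by
      rcases hn.eq_or_lt with rfl | hn
      · have h0 : u 0 = u₀ := (hu 0 le_rfl).trans (Function.update_self ..)
        refine hom_exact _ (hξ _ (by lia)) _ ?_
        rw [h0, Preadditive.neg_comp, Category.assoc]
        exact (congrArg (fun z => -(ξ.cx.d 2 1 ≫ z)) hu₀).trans (by simp)
      · obtain ⟨k, rfl⟩ : ∃ k, n = k + 1 := ⟨n - 1, by lia⟩
        refine hT.hom_from _ (hξ _ (by lia)) (k + 1) _ ?_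
        rw [show k + 1 - 1 = k by lia, Preadditive.neg_comp, Category.assoc,
          hd k (by lia) (by lia), Preadditive.comp_neg, HomologicalComplex.d_comp_d_assoc,
          zero_comp, neg_zero, neg_zero])
  have hu0 : u 0 = u₀ := (hu 0 le_rfl).trans (Function.update_self ..)
  let G : Gluing T ξ.cx p :=
    { E := E, α := α, σ := σ, ι := ι, κ := κ, u := u
      isZero_E := hE₀, α_σ := hασ, ι_κ := hικ, ι_σ := hισ, α_κ := hακ
      α_κ_zero := (hακ₀ 0 rfl).trans (Function.update_self ..)
      total := htotal, ι_zero := hι₀ 0 rfl, isZero_X := ξ.isZero, d_p := w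
      u_p := by
        rw [hu0]
        exact hu₀
      u_d := hud }
  have hd := G.complex_d
  have hX₁ : ∀ n, 0 ≤ n → ExactUpTo ⊤ (MorphismProperty.epimorphisms A)
      (ξ.cx.d (n + 1 + 1) (n + 1)) (ξ.cx.d (n + 1) n) := fun n hn =>
    (exactUpTo_top_iff _).2 ((exactAt_succ_iff _ _).1 (ξ.exact_pos (n + 1) (by lia)))
  have hX₂ : ∀ n, 0 ≤ n → ExactUpTo 𝒲 (MorphismProperty.isomorphisms A)
      (ξ.cx.d (n + 1 + 1) (n + 1)) (ξ.cx.d (n + 1) n) := fun n hn =>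
    exactUpTo_iso_iff.2 fun V hV f hf => ξ.hom_exact_pos V (h𝒲𝒳 _ hV) (n + 1) (by lia) f (by
      rw [show n + 1 - 1 = n by lia]
      exact hf)
  have hT₁ : ∀ n, ExactUpTo ⊤ (MorphismProperty.epimorphisms A)
      (T.d (n + 1 + 1) (n + 1)) (T.d (n + 1) n) := fun n =>
    (exactUpTo_top_iff _).2 ((exactAt_succ_iff _ _).1 (hT.acyclic (n + 1)))
  have hT₂ : ∀ n, ExactUpTo 𝒲 (MorphismProperty.isomorphisms A)
      (T.d (n + 1 + 1) (n + 1)) (T.d (n + 1) n) := fun n =>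
    exactUpTo_iso_iff.2 fun V hV f hf => hT.hom_from V hV (n + 1) f (by
      rw [show n + 1 - 1 = n by lia]
      exact hf)
  have hw : G.complex.d 1 0 ≫ κ 0 ≫ ξ.π = 0 := by
    refine (G.projection.comm_assoc 1 0 ξ.π).symm.trans ?_
    rw [ξ.d_π, comp_zero]
  have he : G.complex.d 1 0 = G.dE 0 := hd 0
  let W : ProperResolution 𝒲 M :=
    { cx := G.complex
      mem := hE
      isZero := hE₀
      π := κ 0 ≫ ξ.π
      d_π := hw
      exact_pos := fun n hn => by
        obtain ⟨k, rfl⟩ : ∃ k, n = k + 1 := ⟨n - 1, by lia⟩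
        rw [exactAt_succ_iff, ← exactUpTo_top_iff, hd, hd]
        exact G.exactUpTo_succ (by lia) (hT₁ _) (hX₁ _ (by lia))
      exact_zero := by
        rw [← exactUpTo_top_iff, he]
        exact G.exactUpTo_zero ((exactUpTo_top_iff w).2 hTp)
          ((exactUpTo_top_iff _).2 ξ.exact_zero)
      epi_π := surjectiveUpTo_top_iff.1 (G.surjectiveUpTo_zero (surjectiveUpTo_top_iff.2 hp)
        (surjectiveUpTo_top_iff.2 ξ.epi_π))
      hom_exact_pos := fun V hV n hn f hf => by
        obtain ⟨k, rfl⟩ : ∃ k, n = k + 1 := ⟨n - 1, by lia⟩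
        rw [show k + 1 - 1 = k by lia, hd] at hf
        rw [hd]
        exact exactUpTo_iso_iff.1 (G.exactUpTo_succ (by lia) (hT₂ _) (hX₂ _ (by lia))) V hV f hf
      hom_exact_zero := fun V hV f hf => by
        rw [he]
        exact exactUpTo_iso_iff.1 (G.exactUpTo_zero (exactUpTo_iso_iff.2 hom_exact)
          (exactUpTo_iso_iff.2 fun V hV => ξ.hom_exact_zero V (h𝒲𝒳 _ hV))) V hV f hf
      hom_surjective := surjectiveUpTo_iso_iff.1 (G.surjectiveUpTo_zero
        (surjectiveUpTo_iso_iff.2 hom_surjective)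
        (surjectiveUpTo_iso_iff.2 fun V hV => ξ.hom_surjective V (h𝒲𝒳 _ hV))) }
  have hακp : G.α 0 ≫ G.κ 0 = p := G.α_κ_zero
  refine ⟨
    { τ :=
        { W := W
          T := T
          totallyAcyclic := hT
          α := G.inclusion
          isIso_α := ⟨max m 0, fun n hn => ⟨σ n, hασ n (by lia), by
            have h := htotal n (by lia)
            rw [(hm n (by lia)).eq_of_src (ι n) 0, comp_zero, add_zero] at h
            exact h⟩⟩ }
      ξ := ξ
      κ := G.projection
      lift := (Category.comp_id _).symm
      σ := σ, ι := ι, u := u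
      α_σ := hασ, ι_κ := hικ, ι_σ := hισ, α_κ := hακ, total := htotal, ι_zero := hι₀ 0 rfl
      u_d := hud
      ι_d := fun n hn => (congrArg (ι (n + 1) ≫ ·) (hd n)).trans (G.ι_dE hn)
      epi := by
        change Epi (G.α 0 ≫ G.κ 0)
        rwa [hακp]
      desc := fun N c hc => by
        change ∃ g, (G.α 0 ≫ G.κ 0) ≫ g = c
        rw [hακp]
        exact ⟨hTp.desc c hc, hTp.g_desc c hc⟩ }, rfl⟩

end SplitExistence

/-! ### Splicing short exact sequences -/

section Splice

variable {A : Type u} [Category.{v} A] [Abelian A]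

section Arrows

variable {P₀ P₁ P₂ Z₁ Z₂ V : A} {p₂ : P₂ ⟶ Z₂} {i₁ : Z₂ ⟶ P₁} {p₁ : P₁ ⟶ Z₁} {i₀ : Z₁ ⟶ P₀}

theorem exact_comp_left (h₂ : Epi p₂) (h₁ : IsShortExact i₁ p₁) (w : (p₂ ≫ i₁) ≫ p₁ = 0) :
    (ShortComplex.mk (p₂ ≫ i₁) p₁ w).Exact := by
  rw [← exactUpTo_top_iff]
  intro V _ x hx
  obtain ⟨y, rfl⟩ := h₁.exists_lift_of_comp_eq_zero x hx
  obtain ⟨V', c, hc, y', hy'⟩ := surjective_up_to_refinements_of_epi p₂ y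
  exact ⟨V', c, y', trivial, hc, by rw [← Category.assoc, ← hy', Category.assoc]⟩

theorem exact_comp (h₂ : Epi p₂) (h₁ : IsShortExact i₁ p₁) (h₀ : Mono i₀)
    (w : (p₂ ≫ i₁) ≫ p₁ ≫ i₀ = 0) : (ShortComplex.mk (p₂ ≫ i₁) (p₁ ≫ i₀) w).Exact := by
  rw [← exactUpTo_top_iff]
  intro V hV x hx
  refine (exactUpTo_top_iff _).2 (exact_comp_left h₂ h₁ (by simp [h₁.w])) hV x ?_
  rwa [← Category.assoc, ← zero_comp (f := i₀), cancel_mono] at hx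

theorem hom_exact_comp_left (h₂ : ∀ f : V ⟶ Z₂, ∃ g, g ≫ p₂ = f) (h₁ : IsShortExact i₁ p₁)
    (x : V ⟶ P₁) (hx : x ≫ p₁ = 0) : ∃ g, g ≫ p₂ ≫ i₁ = x := by
  obtain ⟨y, rfl⟩ := h₁.exists_lift_of_comp_eq_zero x hx
  obtain ⟨g, rfl⟩ := h₂ y
  exact ⟨g, (Category.assoc _ _ _).symm⟩

theorem hom_exact_comp (h₂ : ∀ f : V ⟶ Z₂, ∃ g, g ≫ p₂ = f) (h₁ : IsShortExact i₁ p₁)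
    (h₀ : Mono i₀) (x : V ⟶ P₁) (hx : x ≫ p₁ ≫ i₀ = 0) : ∃ g, g ≫ p₂ ≫ i₁ = x := by
  refine hom_exact_comp_left h₂ h₁ x ?_
  rwa [← Category.assoc, ← zero_comp (f := i₀), cancel_mono] at hx

end Arrows

variable (P Z : ℤ → A) (i : ∀ n, Z (n + 1) ⟶ P n) (p : ∀ n, P n ⟶ Z n) (w : ∀ n, i n ≫ p n = 0)

/-- The complex with terms `P n` obtained by splicing the sequences
`0 → Z (n + 1) → P n → Z n → 0`. -/
def splice : ChainComplex A ℤ :=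
  ChainComplex.of P (fun n => p (n + 1) ≫ i n) fun n => by
    rw [Category.assoc, ← Category.assoc (i (n + 1)), w, zero_comp, comp_zero]

theorem splice_d (n : ℤ) : (splice P Z i p w).d (n + 1) n = p (n + 1) ≫ i n :=
  ChainComplex.of_d (X := P) (d := fun n => p (n + 1) ≫ i n) _

variable {𝒲 𝒴 : ObjectProperty A} [HasExt.{w} A]

/-- Let `𝒴` be a class of objects which satisfies the vanishing conditions
`Ext¹(𝒲, 𝒴) = 0 = Ext¹(𝒴, 𝒲)`, and in which each object is the cokernel of a monomorphism from `𝒴`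
to `𝒲` and the kernel of an epimorphism from `𝒲` to `𝒴`. Then each object of `𝒴` is a syzygy of a
totally `𝒲`-acyclic complex. -/
theorem exists_complete_resolution
    (h₁ : ∀ V Y, 𝒲 V → 𝒴 Y → Subsingleton (Abelian.Ext.{w} V Y 1))
    (h₂ : ∀ V Y, 𝒲 V → 𝒴 Y → Subsingleton (Abelian.Ext.{w} Y V 1))
    (hgen : ∀ Y, 𝒴 Y → ∃ (Y' W : A) (i : Y' ⟶ W) (p : W ⟶ Y), IsShortExact i p ∧ 𝒲 W ∧ 𝒴 Y')
    (hcog : ∀ Y, 𝒴 Y → ∃ (W Y' : A) (i : Y ⟶ W) (p : W ⟶ Y'), IsShortExact i p ∧ 𝒲 W ∧ 𝒴 Y')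
    (G : A) (hG : 𝒴 G) :
    ∃ (T : ChainComplex A ℤ) (p : T.X 0 ⟶ G) (w : T.d 1 0 ≫ p = 0), IsTotallyAcyclic 𝒲 T ∧
      Epi p ∧ (ShortComplex.mk (T.d 1 0) p w).Exact ∧
      (∀ V, 𝒲 V → ∀ f : V ⟶ G, ∃ g, g ≫ p = f) ∧
      (∀ V, 𝒲 V → ∀ f : V ⟶ T.X 0, f ≫ p = 0 → ∃ g, g ≫ T.d 1 0 = f) := by
  let R : ∀ _ : ℤ, {Y : A // 𝒴 Y} → {Y : A // 𝒴 Y} → Prop := fun _ Y Y' =>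
    ∃ (W : A) (i : Y'.1 ⟶ W) (p : W ⟶ Y.1), IsShortExact i p ∧ 𝒲 W
  obtain ⟨Z₀, hZ₀, hR₀⟩ := exists_extend_up (F := fun _ => {Y : A // 𝒴 Y}) R 0 (fun _ => ⟨G, hG⟩)
    fun n _ s _ _ => by
      obtain ⟨Y', W, i, p, h, hW, hY'⟩ := hgen _ (s n).2
      exact ⟨⟨Y', hY'⟩, W, i, p, h, hW⟩
  obtain ⟨Z, hZ, hR⟩ := exists_extend_down (F := fun _ => {Y : A // 𝒴 Y}) R 0 Z₀ hR₀
    fun n _ s _ _ => by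
      obtain ⟨W, Y', i, p, h, hW, hY'⟩ := hcog _ (s (n + 1)).2
      exact ⟨⟨Y', hY'⟩, W, i, p, h, hW⟩
  choose P i p h hP using hR
  obtain ⟨T, hTdef⟩ : ∃ T, T = splice P (fun n => (Z n).1) i p (fun n => (h n).w) := ⟨_, rfl⟩
  have lift : ∀ n V, 𝒲 V → ∀ f : V ⟶ (Z n).1, ∃ g, g ≫ p n = f := fun n V hV f =>
    (h n).exists_lift (h₁ V _ hV (Z (n + 1)).2) f
  have hd := splice_d P (fun n => (Z n).1) i p (fun n => (h n).w)
  obtain rfl : (Z 0).1 = G := by rw [hZ 0 le_rfl, hZ₀ 0 le_rfl]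
  subst hTdef
  have hd0 : (splice P (fun n => (Z n).1) i p (fun n => (h n).w)).d 1 0 = p 1 ≫ i 0 := hd 0
  have hw : (p 1 ≫ i 0) ≫ p 0 = 0 := by rw [Category.assoc, (h 0).w, comp_zero]
  refine ⟨splice P (fun n => (Z n).1) i p (fun n => (h n).w), p 0, ?_,
    ⟨hP, fun n => ?_, fun V hV n f hf => ?_, fun V hV n f hf => ?_⟩, (h 0).epi, ?_, lift 0, ?_⟩
  · rw [hd0]
    exact hw
  · obtain ⟨k, rfl⟩ : ∃ k, n = k + 1 := ⟨n - 1, by lia⟩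
    rw [exactAt_succ_iff, ← exactUpTo_top_iff, hd, hd]
    have hw' : (p (k + 1 + 1) ≫ i (k + 1)) ≫ p (k + 1) ≫ i k = 0 := by
      have := (h (k + 1)).w
      rw [Category.assoc, reassoc_of% this, zero_comp, comp_zero]
    exact (exactUpTo_top_iff hw').2 (exact_comp (h (k + 1 + 1)).epi (h (k + 1)) (h k).mono hw')
  · obtain ⟨k, rfl⟩ : ∃ k, n = k + 1 := ⟨n - 1, by lia⟩
    rw [show k + 1 - 1 = k by lia, hd] at hf
    rw [hd]
    exact hom_exact_comp (lift _ V hV) (h (k + 1)) (h k).mono f hf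
  · obtain ⟨k, rfl⟩ : ∃ k, n = k + 1 := ⟨n - 1, by lia⟩
    rw [hd] at hf
    rw [show k + 1 - 1 = k by lia, hd]
    have := (h (k + 1 + 1)).epi
    replace hf : i (k + 1) ≫ f = 0 :=
      (cancel_epi (p (k + 1 + 1))).1 ((Category.assoc _ _ _).symm.trans (hf.trans comp_zero.symm))
    obtain ⟨g, rfl⟩ := (h (k + 1)).exists_desc_of_comp_eq_zero f hf
    obtain ⟨g', rfl⟩ := (h k).exists_desc (h₂ V _ hV (Z k).2) g
    exact ⟨g', Category.assoc _ _ _⟩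
  · refine (exactUpTo_top_iff _).1 ?_
    rw [hd0]
    exact (exactUpTo_top_iff hw).2 (exact_comp_left (h 1).epi (h 0) hw)
  · intro V hV f hf
    rw [hd0]
    exact hom_exact_comp_left (lift 1 V hV) (h 0) f hf

end Splice

/-! ### Finite resolutions and approximations -/

section Approximation

variable {A : Type u} [Category.{v} A] [Abelian A]

/-- `M` has a `P`-resolution with at most `n` terms. -/
inductive HasFiniteResolution (P : ObjectProperty A) : ℕ → A → Prop
  | zero {M : A} : IsZero M → HasFiniteResolution P 0 M
  | succ {n : ℕ} {K V M : A} {i : K ⟶ V} {p : V ⟶ M} (h : IsShortExact i p) (hV : P V)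
      (hK : HasFiniteResolution P n K) : HasFiniteResolution P (n + 1) M

theorem isShortExact_cokernel_desc {X Y Z : A} {f : X ⟶ Y} {g : Y ⟶ Z} {w : f ≫ g = 0}
    (h : (ShortComplex.mk f g w).Exact) :
    IsShortExact (cokernel.desc f g w) (cokernel.π g) := by
  have hw : cokernel.desc f g w ≫ cokernel.π g = 0 := by
    rw [← cancel_epi (cokernel.π f)]
    simp
  refine .of_exact hw ?_ ?_ inferInstance
  · rw [← exactUpTo_top_iff]
    intro V _ x hx
    obtain ⟨V', c, x', -, hc, e⟩ := (exactUpTo_top_iff (cokernel.condition g)).2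
      (ShortComplex.exact_of_g_is_cokernel _ (cokernelIsCokernel g)) trivial x hx
    exact ⟨V', c, x' ≫ cokernel.π f, trivial, hc, by simpa using e⟩
  · exact h.mono_cokernelDesc

variable {𝒲 𝒳 : ObjectProperty A}

theorem Resolution.hasFiniteResolution {M : A} (X : Resolution 𝒳 M) {d : ℕ}
    (hd : ∀ n : ℤ, d < n → IsZero (X.cx.X n)) : HasFiniteResolution 𝒳 (d + 1) M := by
  have key : ∀ (j : ℕ) (k : ℤ), 0 ≤ k → d + 1 ≤ k + j →
      HasFiniteResolution 𝒳 j (cokernel (X.cx.d (k + 1) k)) := by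
    intro j
    induction j with
    | zero =>
      intro k hk hdk
      exact .zero (IsZero.of_epi (cokernel.π _) (hd k (by push_cast at hdk; lia)))
    | succ j ih =>
      intro k hk hdk
      exact .succ (isShortExact_cokernel_desc
        ((exactAt_succ_iff _ _).1 (X.exact_pos (k + 1) (by lia)))) (X.mem k)
        (ih (k + 1) (by lia) (by push_cast at hdk; lia))
  have := X.epi_π
  have hw := X.d_π
  have h : IsShortExact (cokernel.desc (X.cx.d 2 1) (X.cx.d 1 0) (X.cx.d_comp_d _ _ _)) X.π := by
    refine .of_exact ?_ ?_ ?_ X.epi_π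
    · rw [← cancel_epi (cokernel.π _)]
      simp [hw]
    · rw [← exactUpTo_top_iff]
      intro V _ x hx
      obtain ⟨V', c, x', -, hc, e⟩ := (exactUpTo_top_iff hw).2 X.exact_zero trivial x hx
      exact ⟨V', c, x' ≫ cokernel.π _, trivial, hc, by simpa using e⟩
    · exact ((exactAt_succ_iff X.cx 0).1 (X.exact_pos 1 one_pos)).mono_cokernelDesc
  exact .succ h (X.mem 0) (key d 1 zero_le_one (by lia))

/-- If `𝒲` is a cogenerator for `𝒳`, then each object with a finite `𝒳`-resolution is the quotient
of an object of `𝒳` by an object with a finite `𝒲`-resolution. -/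
theorem exists_approximation (hext : 𝒳.IsClosedUnderExtensions)
    (hcog : ∀ X, 𝒳 X → ∃ (W X' : A) (i : X ⟶ W) (p : W ⟶ X'), IsShortExact i p ∧ 𝒲 W ∧ 𝒳 X')
    {n : ℕ} : ∀ {M : A}, HasFiniteResolution 𝒳 (n + 1) M →
      ∃ (K G : A) (i : K ⟶ G) (p : G ⟶ M), IsShortExact i p ∧ HasFiniteResolution 𝒲 n K ∧ 𝒳 G := by
  induction n with
  | zero =>
    rintro M (_ | @⟨_, K, V, _, i, p, h, hV, ⟨hK⟩⟩)
    exact ⟨K, V, i, p, h, .zero hK, hV⟩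
  | succ n ih =>
    rintro M (_ | @⟨_, K, V, _, i, p, h, hV, hK⟩)
    obtain ⟨K₁, G₁, i₁, p₁, h₁, hK₁, hG₁⟩ := ih hK
    obtain ⟨W, G', j, q, hj, hW, hG'⟩ := hcog _ hG₁
    -- the pushout of `K ← G₁ → W` is a quotient of `W` by `K₁`
    obtain ⟨q', hq'⟩ := IsShortExact.of_isPushout (IsPushout.of_hasPushout p₁ j) hj
    have hL : IsShortExact (i₁ ≫ j) (pushout.inr p₁ j) := by
      have := h₁.mono
      have := hj.mono
      have := h₁.epi
      have sq := IsPushout.of_hasPushout p₁ j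
      have hw : (i₁ ≫ j) ≫ pushout.inr p₁ j = 0 := by
        rw [Category.assoc, ← pushout.condition, ← Category.assoc, h₁.w, zero_comp]
      refine .of_exact hw ?_ inferInstance
        ((MorphismProperty.epimorphisms A).of_isPushout sq.flip h₁.epi)
      rw [← exactUpTo_top_iff]
      intro V _ x hx
      obtain ⟨V', c, x₁, -, hc, hx₁⟩ := (exactUpTo_top_iff _).2 sq.flip.exact_shortComplex
        (V := V) trivial (biprod.lift x 0) (by simp [hx])
      have e₁ := congrArg (· ≫ biprod.fst) hx₁
      have e₂ := congrArg (· ≫ biprod.snd) hx₁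
      simp only [Category.assoc, biprod.lift_fst, biprod.lift_snd] at e₁ e₂
      obtain ⟨y, rfl⟩ := h₁.exists_lift_of_comp_eq_zero x₁ (by simpa using e₂)
      exact ⟨V', c, y, trivial, hc, by simpa using e₁⟩
    -- and the pushout of `V ← K → W / K₁` is the approximation
    have sq := IsPushout.of_hasPushout i (pushout.inl p₁ j)
    obtain ⟨r, hr⟩ := IsShortExact.of_isPushout sq hq'
    obtain ⟨s, hs⟩ := IsShortExact.of_isPushout sq.flip h
    exact ⟨_, _, _, s, hs, .succ hL hW hK₁, hext.prop_X₂_of_shortExact hr.2 hV hG'⟩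

variable [HasExt.{w} A]

/-- Orthogonality to `𝒲` passes to the objects with a finite `𝒲`-resolution, by dimension shift. -/
theorem HasFiniteResolution.ext_eq_zero {V : A}
    (h : ∀ W, 𝒲 W → ∀ m : ℕ, 1 ≤ m → Subsingleton (Abelian.Ext.{w} V W m)) {n : ℕ} {K : A}
    (hK : HasFiniteResolution 𝒲 n K) :
    ∀ m : ℕ, 1 ≤ m → Subsingleton (Abelian.Ext.{w} V K m) := by
  induction hK with
  | zero h0 => exact fun m _ => ext_eq_zero_of_isZero_right h0
  | succ hs hW _ ih =>
    exact fun m hm => hs.ext_eq_zero_right₃ (ih (m + 1) (by lia)) (h _ hW m hm)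

/-- An approximation `K → G → M` and a finite `𝒲`-resolution of `K` splice to a resolution of `M`.
It is proper because `Ext¹(𝒳, -)` vanishes on all syzygies. -/
theorem exists_properResolution (h0 : 𝒲.ContainsZero) (h𝒲 : 𝒲 ≤ 𝒳)
    (hperp : Perp.{u, v, w} 𝒳 𝒲) {d : ℕ} {M K G : A} {i₀ : K ⟶ G} {p₀ : G ⟶ M}
    (h : IsShortExact i₀ p₀) (hK : HasFiniteResolution 𝒲 d K) (hG : 𝒳 G) :
    ∃ ξ : ProperResolution 𝒳 M, (∀ n, 1 ≤ n → 𝒲 (ξ.cx.X n)) ∧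
      ∀ n : ℤ, d < n → IsZero (ξ.cx.X n) := by
  obtain ⟨O, hO, h𝒲O⟩ := h0
  let R : ∀ _ : ℤ, A → A → Prop := fun n Z Z' => ∃ (P : A) (i : Z' ⟶ P) (p : P ⟶ Z),
    i ≫ p = 0 ∧ (n < 0 → IsZero P) ∧
    (0 ≤ n → IsShortExact i p ∧ HasFiniteResolution 𝒲 (d - n).toNat Z') ∧ (n = 0 → 𝒳 P) ∧
    (n ≠ 0 → 𝒲 P) ∧ (d < n → IsZero P)
  obtain ⟨Z, hZ, hR'⟩ := exists_extend_up (F := fun _ => A) R 0 (fun _ => M) fun n hn s hs hsR => by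
    rcases hn.eq_or_lt with rfl | hn
    · obtain rfl : s 0 = M := hs 0 le_rfl
      exact ⟨K, G, i₀, p₀, h.w, by lia, fun _ => ⟨h, by simpa using hK⟩, fun _ => hG, by lia,
        by lia⟩
    · obtain ⟨k, rfl⟩ : ∃ k, n = k + 1 := ⟨n - 1, by lia⟩
      obtain ⟨_, _, _, _, _, hres, _⟩ := hsR k (by lia) (by lia)
      replace hres := (hres (by lia)).2
      rcases lt_or_ge (d : ℤ) (k + 1) with hdk | hdk
      · rw [show ((d : ℤ) - k).toNat = 0 by lia] at hres
        obtain ⟨hz⟩ := hres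
        refine ⟨O, O, 𝟙 O, 0, comp_zero, fun _ => hO, fun _ => ⟨.id_zero hz _, ?_⟩, by lia,
          fun _ => h𝒲O, fun _ => hO⟩
        rw [show ((d : ℤ) - (k + 1)).toNat = 0 by lia]
        exact .zero hO
      · rw [show ((d : ℤ) - k).toNat = (d - (k + 1) : ℤ).toNat + 1 by lia] at hres
        obtain _ | @⟨_, K', V, _, i, p, h', hV, hK'⟩ := hres
        exact ⟨K', V, i, p, h'.w, by lia, fun _ => ⟨h', hK'⟩, by lia, fun _ => hV, by lia⟩
  have hR : ∀ n, R n (Z n) (Z (n + 1)) := fun n => by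
    rcases lt_or_ge n 0 with hn | hn
    · exact ⟨O, 0, 0, comp_zero, fun _ => hO, by lia, by lia, fun _ => h𝒲O, fun _ => hO⟩
    · exact hR' n hn
  choose P i p hw hP₀ hs h𝒳 h𝒲' hP using hR
  obtain rfl : Z 0 = M := hZ 0 le_rfl
  have lift : ∀ n, 0 ≤ n → ∀ V, 𝒳 V → ∀ f : V ⟶ Z n, ∃ g, g ≫ p n = f := fun n hn V hV f =>
    (hs n hn).1.exists_lift
      ((hs n hn).2.ext_eq_zero (fun W hW m hm => hperp _ _ hV hW m hm) 1 le_rfl) f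
  have hd := splice_d P Z i p hw
  have hd0 : (splice P Z i p hw).d 1 0 = p 1 ≫ i 0 := hd 0
  have hw0 : (p 1 ≫ i 0) ≫ p 0 = 0 := by rw [Category.assoc, hw, comp_zero]
  have hw' : ∀ k, (p (k + 1 + 1) ≫ i (k + 1)) ≫ p (k + 1) ≫ i k = 0 := fun k => by
    rw [Category.assoc, ← Category.assoc (i (k + 1)), hw, zero_comp, comp_zero]
  refine ⟨
    { cx := splice P Z i p hw
      mem := fun n => ?_
      isZero := hP₀
      π := p 0
      d_π := by
        rw [hd0]
        exact hw0
      exact_pos := fun n hn => ?_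
      exact_zero := ?_
      epi_π := (hs 0 le_rfl).1.epi
      hom_exact_pos := fun V hV n hn f hf => ?_
      hom_exact_zero := fun V hV f hf => ?_
      hom_surjective := lift 0 le_rfl }, fun n hn => h𝒲' n (by lia), hP⟩
  · rcases eq_or_ne n 0 with rfl | hn
    · exact h𝒳 0 rfl
    · exact h𝒲 _ (h𝒲' n hn)
  · obtain ⟨k, rfl⟩ : ∃ k, n = k + 1 := ⟨n - 1, by lia⟩
    rw [exactAt_succ_iff, ← exactUpTo_top_iff, hd, hd]
    exact (exactUpTo_top_iff (hw' k)).2 (exact_comp (hs (k + 1 + 1) (by lia)).1.epi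
      (hs (k + 1) (by lia)).1 (hs k (by lia)).1.mono (hw' k))
  · refine (exactUpTo_top_iff _).1 ?_
    rw [hd0]
    exact (exactUpTo_top_iff hw0).2
      (exact_comp_left (hs 1 zero_le_one).1.epi (hs 0 le_rfl).1 hw0)
  · obtain ⟨k, rfl⟩ : ∃ k, n = k + 1 := ⟨n - 1, by lia⟩
    rw [show k + 1 - 1 = k by lia, hd] at hf
    rw [hd]
    exact hom_exact_comp (lift _ (by lia) V hV) (hs (k + 1) (by lia)).1 (hs k (by lia)).1.mono f hf
  · rw [hd0]
    exact hom_exact_comp_left (lift 1 zero_le_one V hV) (hs 0 le_rfl).1 f hf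

/-- The comparison sequence exists whenever `𝒲` is an injective cogenerator and a projective
generator for a class `𝒳` closed under extensions. -/
theorem comparison_of_generator_cogenerator (h𝒲 : IsAdditiveSubcategory 𝒲) (h𝒲𝒳 : 𝒲 ≤ 𝒳)
    (hext : 𝒳.IsClosedUnderExtensions) (hi : IsInjectiveCogenerator.{u, v, w} 𝒲 𝒳)
    (hp : IsProjectiveGenerator.{u, v, w} 𝒲 𝒳) :
    CohomologyWellDefined 𝒲 𝒳 ∧ Nonempty (ComparisonSequence 𝒲 𝒳) := by
  refine comparison_of_split h𝒲𝒳 fun M d hd => ?_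
  have hcog : ∀ X, 𝒳 X → ∃ (W X' : A) (i : X ⟶ W) (p : W ⟶ X'),
      IsShortExact i p ∧ 𝒲 W ∧ 𝒳 X' := fun X hX => by
    obtain ⟨W, X', i, p, w, h, hW, hX'⟩ := hi.exists_shortExact X hX
    exact ⟨W, X', i, p, ⟨w, h⟩, hW, hX'⟩
  have hgen : ∀ X, 𝒳 X → ∃ (X' W : A) (i : X' ⟶ W) (p : W ⟶ X),
      IsShortExact i p ∧ 𝒲 W ∧ 𝒳 X' := fun X hX => by
    obtain ⟨X', W, i, p, w, h, hW, hX'⟩ := hp.exists_shortExact X hX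
    exact ⟨X', W, i, p, ⟨w, h⟩, hW, hX'⟩
  -- the infimum that defines the relative dimension is attained
  obtain ⟨X, hX⟩ : ∃ X : Resolution 𝒳 M, X.length = d := by
    have : Nonempty (Resolution 𝒳 M) := by
      by_contra hne
      rw [not_nonempty_iff] at hne
      rw [relPd, iInf_of_empty] at hd
      exact ENat.top_ne_natCast d hd
    rw [← hd]
    exact ENat.exists_eq_iInf _
  have hXz : ∀ n : ℤ, d < n → IsZero (X.cx.X n) := fun n hn => by
    obtain ⟨k, rfl⟩ := Int.eq_ofNat_of_zero_le (show 0 ≤ n by lia)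
    by_contra hk
    have : (k : ℕ∞) ≤ X.length := le_iSup₂_of_le k hk le_rfl
    rw [hX, Nat.cast_le] at this
    lia
  obtain ⟨K, G, i, p, h, hK, hG⟩ := exists_approximation hext hcog (X.hasFiniteResolution hXz)
  obtain ⟨ξ, hξ, hξz⟩ := exists_properResolution h𝒲.zero h𝒲𝒳 hi.perp h hK hG
  obtain ⟨T, p, w, hT, hep, hex, hsur, hhom⟩ := exists_complete_resolution (𝒲 := 𝒲) (𝒴 := 𝒳)
    (fun V Y hV hY => hp.perp V Y hV hY 1 le_rfl) (fun V Y hV hY => hi.perp Y V hY hV 1 le_rfl)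
    hgen hcog (ξ.cx.X 0) (ξ.mem 0)
  obtain ⟨S, rfl⟩ := exists_splitComparison h𝒲 h𝒲𝒳 ξ hξ (d + 1) (fun n hn => hξz n (by lia)) T hT
    p hep w hex hsur hhom
  exact ⟨S, hξz⟩

end Approximation

/-! ### The subcategory `𝒢(𝒲)` -/

section Gorenstein

variable {A : Type u} [Category.{v} A] [Abelian A]

/-- The horseshoe lemma: epimorphisms from `P` and `Q` to the ends of a short exact sequence, the
second of which lifts to the middle term, give an epimorphism from `P ⊞ Q` to the middle term, and
the kernels form a short exact sequence. -/
theorem exists_horseshoe {X Y Z P Q X' Z' : A} {i : X ⟶ Y} {p : Y ⟶ Z} {kx : X' ⟶ P} {a : P ⟶ X}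
    {kz : Z' ⟶ Q} {c : Q ⟶ Z} (h : IsShortExact i p) (ha : IsShortExact kx a)
    (hc : IsShortExact kz c) (c' : Q ⟶ Y) (hc' : c' ≫ p = c) :
    ∃ (Y' : A) (ky : Y' ⟶ P ⊞ Q) (b : P ⊞ Q ⟶ Y) (i' : X' ⟶ Y') (p' : Y' ⟶ Z'),
      IsShortExact ky b ∧ IsShortExact i' p' := by
  have := h.mono
  have := ha.mono
  have := hc.mono
  have := ha.epi
  have := hc.epi
  let b : P ⊞ Q ⟶ Y := biprod.desc (a ≫ i) c'
  have hbp : b ≫ p = biprod.snd ≫ c := by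
    ext <;> simp [b, h.w, hc']
  have hb : Epi b := by
    rw [epi_iff_surjective_up_to_refinements]
    intro V y
    obtain ⟨V₁, c₁, _, z, hz⟩ := surjective_up_to_refinements_of_epi c (y ≫ p)
    obtain ⟨x, hx⟩ := h.exists_lift_of_comp_eq_zero (c₁ ≫ y - z ≫ c') (by simp [hz, hc'])
    obtain ⟨V₂, c₂, _, t, ht⟩ := surjective_up_to_refinements_of_epi a x
    refine ⟨V₂, c₂ ≫ c₁, inferInstance, biprod.lift t (c₂ ≫ z), ?_⟩
    simp [b, ← reassoc_of% ht, hx]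
  let j : X' ⟶ kernel b := kernel.lift b (kx ≫ biprod.inl) (by simp [b, reassoc_of% ha.w])
  obtain ⟨q, hq⟩ := hc.exists_lift_of_comp_eq_zero (kernel.ι b ≫ biprod.snd) (by
    rw [Category.assoc, ← hbp, kernel.condition_assoc, zero_comp])
  have hj : j ≫ kernel.ι b = kx ≫ biprod.inl := kernel.lift_ι _ _ _
  have hjm : Mono (j ≫ kernel.ι b) := hj ▸ inferInstance
  have hjq : j ≫ q = 0 := by
    rw [← cancel_mono kz, Category.assoc, hq, reassoc_of% hj]
    simp
  refine ⟨kernel b, kernel.ι b, b, j, q, .kernel b,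
    .of_exact hjq ?_ (mono_of_mono j (kernel.ι b)) ?_⟩
  · rw [← exactUpTo_top_iff]
    intro V _ x hx
    have hs : x ≫ kernel.ι b ≫ biprod.snd = 0 := by rw [← hq, ← Category.assoc, hx, zero_comp]
    have hx' : x ≫ kernel.ι b = (x ≫ kernel.ι b ≫ biprod.fst) ≫ biprod.inl := by
      ext <;> simp [hs]
    obtain ⟨t, ht⟩ := ha.exists_lift_of_comp_eq_zero (x ≫ kernel.ι b ≫ biprod.fst) (by
      have := x ≫= kernel.condition b
      rw [← Category.assoc, hx', Category.assoc, comp_zero] at this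
      rw [← cancel_mono i, zero_comp, ← this]
      simp [b])
    refine ⟨V, 𝟙 V, t, trivial, inferInstanceAs (Epi (𝟙 V)), ?_⟩
    rw [← cancel_mono (kernel.ι b), Category.assoc, hj, reassoc_of% ht, Category.id_comp, hx']
    simp
  · rw [epi_iff_surjective_up_to_refinements]
    intro V z
    obtain ⟨x, hx⟩ := h.exists_lift_of_comp_eq_zero (z ≫ kz ≫ c') (by
      rw [Category.assoc, Category.assoc, hc', hc.w, comp_zero])
    obtain ⟨V₁, c₁, _, t, ht⟩ := surjective_up_to_refinements_of_epi a x
    refine ⟨V₁, c₁, inferInstance, kernel.lift b (biprod.lift (-t) (c₁ ≫ z ≫ kz))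
      (by simp [b, ← reassoc_of% ht, hx]), ?_⟩
    rw [← cancel_mono kz, Category.assoc, Category.assoc, hq, kernel.lift_ι_assoc, biprod.lift_snd]

/-- The dual of the horseshoe lemma. -/
theorem exists_dual_horseshoe {X Y Z P Q X' Z' : A} {i : X ⟶ Y} {p : Y ⟶ Z} {a : X ⟶ P}
    {kx : P ⟶ X'} {c : Z ⟶ Q} {kz : Q ⟶ Z'} (h : IsShortExact i p) (ha : IsShortExact a kx)
    (hc : IsShortExact c kz) (a' : Y ⟶ P) (ha' : i ≫ a' = a) :
    ∃ (Y' : A) (b : Y ⟶ P ⊞ Q) (ky : P ⊞ Q ⟶ Y') (i' : X' ⟶ Y') (p' : Y' ⟶ Z'),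
      IsShortExact b ky ∧ IsShortExact i' p' := by
  have := h.epi
  have := ha.mono
  have := hc.mono
  have := ha.epi
  have := hc.epi
  let b : Y ⟶ P ⊞ Q := biprod.lift a' (p ≫ c)
  have hib : i ≫ b = a ≫ biprod.inl := by
    ext <;> simp [b, ha', reassoc_of% h.w]
  have hb : Mono b := by
    refine Preadditive.mono_of_cancel_zero _ fun y hy => ?_
    have h₁ : y ≫ a' = 0 := by simpa [b] using hy =≫ biprod.fst
    have h₂ : y ≫ p ≫ c = 0 := by simpa [b] using hy =≫ biprod.snd
    obtain ⟨x, rfl⟩ := h.exists_lift_of_comp_eq_zero y (by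
      rwa [← Category.assoc, ← zero_comp (f := c), cancel_mono] at h₂)
    rw [Category.assoc, ha', ← zero_comp (f := a), cancel_mono] at h₁
    rw [h₁, zero_comp]
  let q : cokernel b ⟶ Z' := cokernel.desc b (biprod.snd ≫ kz) (by simp [b, hc.w])
  obtain ⟨j, hj⟩ := ha.exists_desc_of_comp_eq_zero (biprod.inl ≫ cokernel.π b) (by
    rw [← Category.assoc, ← hib, Category.assoc, cokernel.condition, comp_zero])
  have hq : cokernel.π b ≫ q = biprod.snd ≫ kz := cokernel.π_desc _ _ _
  have hqe : Epi (cokernel.π b ≫ q) := hq ▸ inferInstance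
  have hjq : j ≫ q = 0 := by
    rw [← cancel_epi kx, reassoc_of% hj, hq]
    simp
  have hexb := (exactUpTo_top_iff (cokernel.condition b)).2
    (ShortComplex.exact_of_g_is_cokernel _ (cokernelIsCokernel b))
  refine ⟨cokernel b, b, cokernel.π b, j, q, .cokernel b,
    .of_exact hjq ?_ ?_ (epi_of_epi (cokernel.π b) q)⟩
  · rw [← exactUpTo_top_iff]
    intro V _ x hx
    obtain ⟨V₁, c₁, _, x₁, hx₁⟩ := surjective_up_to_refinements_of_epi (cokernel.π b) x
    obtain ⟨z, hz⟩ := hc.exists_lift_of_comp_eq_zero (x₁ ≫ biprod.snd) (by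
      rw [Category.assoc, ← hq, ← reassoc_of% hx₁, hx, comp_zero])
    obtain ⟨V₂, c₂, _, y, hy⟩ := surjective_up_to_refinements_of_epi p z
    have hw : c₂ ≫ x₁ - y ≫ b = (c₂ ≫ x₁ ≫ biprod.fst - y ≫ a') ≫ biprod.inl := by
      ext
      · simp [b]
      · simp [b, ← hz, ← reassoc_of% hy]
    refine ⟨V₂, c₂ ≫ c₁, (c₂ ≫ x₁ ≫ biprod.fst - y ≫ a') ≫ kx, trivial,
      inferInstanceAs (Epi (c₂ ≫ c₁)), ?_⟩
    rw [Category.assoc, hj, ← Category.assoc, ← hw, Preadditive.sub_comp, Category.assoc,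
      Category.assoc, cokernel.condition, comp_zero, sub_zero, Category.assoc, hx₁]
  · refine Preadditive.mono_of_cancel_zero _ fun {V} x hx => ?_
    obtain ⟨V₁, c₁, _, t, ht⟩ := surjective_up_to_refinements_of_epi kx x
    obtain ⟨V₂, c₂, y, -, hc₂, hy⟩ := hexb (V := V₁) trivial (t ≫ biprod.inl) (by
      rw [Category.assoc, ← hj, ← reassoc_of% ht, hx, comp_zero])
    have : Epi c₂ := hc₂
    have h₁ : y ≫ a' = c₂ ≫ t := by simpa [b] using hy =≫ biprod.fst
    have h₂ : y ≫ p ≫ c = 0 := by simpa [b] using hy =≫ biprod.snd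
    obtain ⟨x', rfl⟩ := h.exists_lift_of_comp_eq_zero y (by
      rwa [← Category.assoc, ← zero_comp (f := c), cancel_mono] at h₂)
    rw [Category.assoc, ha'] at h₁
    rw [← cancel_epi c₁, ← cancel_epi c₂, ht, ← reassoc_of% h₁, ha.w]
    simp

section Syzygies

variable {𝒲 : ObjectProperty A} {T : ChainComplex A ℤ}

/-- The syzygies `Coker(Tₙ₊₁ → Tₙ)` of a totally acyclic complex are linked by short exact
sequences. -/
theorem IsTotallyAcyclic.isShortExact (hT : IsTotallyAcyclic 𝒲 T) (n : ℤ) :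
    IsShortExact (cokernel.desc (T.d (n + 1 + 1) (n + 1)) (T.d (n + 1) n) (T.d_comp_d _ _ _))
      (cokernel.π (T.d (n + 1) n)) :=
  isShortExact_cokernel_desc ((exactAt_succ_iff _ _).1 (hT.acyclic (n + 1)))

variable [HasExt.{w} A]

theorem IsTotallyAcyclic.ext_right (hT : IsTotallyAcyclic 𝒲 T) (h𝒲 : Perp.{u, v, w} 𝒲 𝒲) {V : A}
    (hV : 𝒲 V) (m : ℕ) (hm : 1 ≤ m) (n : ℤ) :
    Subsingleton (Abelian.Ext.{w} V (cokernel (T.d (n + 1) n)) m) := by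
  induction m, hm using Nat.le_induction generalizing n with
  | base =>
    obtain ⟨k, rfl⟩ : ∃ k, n = k + 1 + 1 := ⟨n - 2, by lia⟩
    refine (hT.isShortExact (k + 1)).ext_one_eq_zero_right (h𝒲 _ _ hV (hT.mem _) 1 le_rfl)
      fun f => ?_
    have hk := hT.isShortExact k
    obtain ⟨g, hg⟩ := hT.hom_from V hV k (f ≫ cokernel.desc _ _ (T.d_comp_d (k + 1 + 1) _ k)) (by
      rw [Category.assoc]
      refine (congrArg (f ≫ ·) ?_).trans comp_zero
      rw [← cancel_epi (cokernel.π _)]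
      simp)
    have := hk.mono
    refine ⟨g, ?_⟩
    rw [← cancel_mono (cokernel.desc _ _ (T.d_comp_d (k + 1 + 1) _ k)), ← hg, Category.assoc,
      cokernel.π_desc]
  | succ m hm ih =>
    obtain ⟨k, rfl⟩ : ∃ k, n = k + 1 := ⟨n - 1, by lia⟩
    exact (hT.isShortExact k).ext_eq_zero_right₁ (h𝒲 _ _ hV (hT.mem _) _ (by lia)) (ih k)

theorem IsTotallyAcyclic.ext_left (hT : IsTotallyAcyclic 𝒲 T) (h𝒲 : Perp.{u, v, w} 𝒲 𝒲) {V : A}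
    (hV : 𝒲 V) (m : ℕ) (hm : 1 ≤ m) (n : ℤ) :
    Subsingleton (Abelian.Ext.{w} (cokernel (T.d (n + 1) n)) V m) := by
  induction m, hm using Nat.le_induction generalizing n with
  | base =>
    refine (hT.isShortExact n).ext_one_eq_zero_left (h𝒲 _ _ (hT.mem _) hV 1 le_rfl) fun f => ?_
    have h := hT.hom_to V hV (n + 1) (cokernel.π _ ≫ f) (by simp)
    rw [show n + 1 - 1 = n by lia] at h
    obtain ⟨g, hg⟩ := h
    exact ⟨g, by rw [← cancel_epi (cokernel.π _), cokernel.π_desc_assoc, hg]⟩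
  | succ m hm ih =>
    exact (hT.isShortExact n).ext_eq_zero_left₃ (ih (n + 1)) (h𝒲 _ _ (hT.mem _) hV _ (by lia))

/-- A class of objects as in `exists_complete_resolution` is contained in `𝒢(𝒲)`. -/
theorem mem_gorenstein {𝒴 : ObjectProperty A}
    (h₁ : ∀ V Y, 𝒲 V → 𝒴 Y → Subsingleton (Abelian.Ext.{w} V Y 1))
    (h₂ : ∀ V Y, 𝒲 V → 𝒴 Y → Subsingleton (Abelian.Ext.{w} Y V 1))
    (hgen : ∀ Y, 𝒴 Y → ∃ (Y' W : A) (i : Y' ⟶ W) (p : W ⟶ Y), IsShortExact i p ∧ 𝒲 W ∧ 𝒴 Y')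
    (hcog : ∀ Y, 𝒴 Y → ∃ (W Y' : A) (i : Y ⟶ W) (p : W ⟶ Y'), IsShortExact i p ∧ 𝒲 W ∧ 𝒴 Y') :
    𝒴 ≤ gorenstein 𝒲 := fun G hG => by
  obtain ⟨T, p, w, hT, hp, hex, -, -⟩ := exists_complete_resolution h₁ h₂ hgen hcog G hG
  exact ⟨T, hT, ⟨IsColimit.coconePointUniqueUpToIso hex.gIsCokernel (colimit.isColimit _)⟩⟩

theorem gorenstein_ext_right (h𝒲 : Perp.{u, v, w} 𝒲 𝒲) : Perp.{u, v, w} 𝒲 (gorenstein 𝒲) := by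
  rintro V Y hV ⟨T, hT, ⟨e⟩⟩ m hm
  exact ext_eq_zero_of_retract_right e.retract (hT.ext_right h𝒲 hV m hm 0)

theorem gorenstein_ext_left (h𝒲 : Perp.{u, v, w} 𝒲 𝒲) : Perp.{u, v, w} (gorenstein 𝒲) 𝒲 := by
  rintro Y V ⟨T, hT, ⟨e⟩⟩ hV m hm
  exact ext_eq_zero_of_retract_left e.retract (hT.ext_left h𝒲 hV m hm 0)

/-- All syzygies of a totally `𝒲`-acyclic complex belong to `𝒢(𝒲)`. -/
theorem IsTotallyAcyclic.mem_gorenstein (h𝒲 : Perp.{u, v, w} 𝒲 𝒲) (hT : IsTotallyAcyclic 𝒲 T)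
    (n : ℤ) : gorenstein 𝒲 (cokernel (T.d (n + 1) n)) := by
  refine TateCohomology.mem_gorenstein (𝒲 := 𝒲)
    (𝒴 := fun Y => ∃ n, Nonempty (Y ≅ cokernel (T.d (n + 1) n))) ?_ ?_ ?_ ?_ _ ⟨n, ⟨Iso.refl _⟩⟩
  · rintro V Y hV ⟨n, ⟨e⟩⟩
    exact ext_eq_zero_of_retract_right e.retract (hT.ext_right h𝒲 hV 1 le_rfl n)
  · rintro V Y hV ⟨n, ⟨e⟩⟩
    exact ext_eq_zero_of_retract_left e.retract (hT.ext_left h𝒲 hV 1 le_rfl n)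
  · rintro Y ⟨n, ⟨e⟩⟩
    exact ⟨_, _, _, _, (hT.isShortExact n).of_iso_right e.symm, hT.mem _, n + 1, ⟨Iso.refl _⟩⟩
  · rintro Y ⟨n, ⟨e⟩⟩
    obtain ⟨k, rfl⟩ : ∃ k, n = k + 1 := ⟨n - 1, by lia⟩
    exact ⟨_, _, _, _, (hT.isShortExact k).of_iso_left e, hT.mem _, k, ⟨Iso.refl _⟩⟩

theorem gorenstein_generator (h𝒲 : Perp.{u, v, w} 𝒲 𝒲) (Y : A) (hY : gorenstein 𝒲 Y) :
    ∃ (Y' W : A) (i : Y' ⟶ W) (p : W ⟶ Y), IsShortExact i p ∧ 𝒲 W ∧ gorenstein 𝒲 Y' := by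
  obtain ⟨T, hT, ⟨e⟩⟩ := hY
  exact ⟨_, _, _, _, (hT.isShortExact 0).of_iso_right e.symm, hT.mem _, hT.mem_gorenstein h𝒲 1⟩

theorem gorenstein_cogenerator (h𝒲 : Perp.{u, v, w} 𝒲 𝒲) (Y : A) (hY : gorenstein 𝒲 Y) :
    ∃ (W Y' : A) (i : Y ⟶ W) (p : W ⟶ Y'), IsShortExact i p ∧ 𝒲 W ∧ gorenstein 𝒲 Y' := by
  obtain ⟨T, hT, ⟨e⟩⟩ := hY
  exact ⟨_, _, _, _, (hT.isShortExact (-1)).of_iso_left e, hT.mem _, hT.mem_gorenstein h𝒲 (-1)⟩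

/-- An object `W` of `𝒲` is a syzygy of the complex `⋯ → 0 → W → W → 0 → ⋯`. -/
theorem le_gorenstein (h0 : 𝒲.ContainsZero) (h𝒲 : Perp.{u, v, w} 𝒲 𝒲) : 𝒲 ≤ gorenstein 𝒲 := by
  obtain ⟨O, hO, h𝒲O⟩ := h0
  exact mem_gorenstein (fun V Y hV hY => h𝒲 V Y hV hY 1 le_rfl)
    (fun V Y hV hY => h𝒲 Y V hY hV 1 le_rfl)
    (fun Y hY => ⟨O, Y, 0, 𝟙 Y, .zero_id hO _, hY, h𝒲O⟩)
    (fun Y hY => ⟨Y, O, 𝟙 Y, 0, .id_zero hO _, hY, h𝒲O⟩)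

/-- The extensions of two objects of `𝒢(𝒲)` form a class to which `mem_gorenstein` applies. -/
theorem gorenstein_extensions (hadd : IsAdditiveSubcategory 𝒲) (h𝒲 : Perp.{u, v, w} 𝒲 𝒲) :
    (gorenstein 𝒲).IsClosedUnderExtensions where
  prop_X₂_of_shortExact {S} hS hS₁ hS₃ := by
    refine mem_gorenstein (𝒲 := 𝒲) (𝒴 := fun Y => ∃ (X Z : A) (i : X ⟶ Y) (p : Y ⟶ Z),
      IsShortExact i p ∧ gorenstein 𝒲 X ∧ gorenstein 𝒲 Z) ?_ ?_ ?_ ?_ _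
      ⟨_, _, S.f, S.g, ⟨S.zero, hS⟩, hS₁, hS₃⟩
    · rintro V Y hV ⟨X, Z, i, p, h, hX, hZ⟩
      exact h.ext_eq_zero_right₂ (gorenstein_ext_right h𝒲 _ _ hV hX 1 le_rfl)
        (gorenstein_ext_right h𝒲 _ _ hV hZ 1 le_rfl)
    · rintro V Y hV ⟨X, Z, i, p, h, hX, hZ⟩
      exact h.ext_eq_zero_left₂ (gorenstein_ext_left h𝒲 _ _ hX hV 1 le_rfl)
        (gorenstein_ext_left h𝒲 _ _ hZ hV 1 le_rfl)
    · rintro Y ⟨X, Z, i, p, h, hX, hZ⟩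
      obtain ⟨X', P, kx, a, ha, hP, hX'⟩ := gorenstein_generator h𝒲 X hX
      obtain ⟨Z', Q, kz, c, hc, hQ, hZ'⟩ := gorenstein_generator h𝒲 Z hZ
      obtain ⟨c', hc'⟩ := h.exists_lift (gorenstein_ext_right h𝒲 _ _ hQ hX 1 le_rfl) c
      obtain ⟨Y', ky, b, i', p', h₁, h₂⟩ := exists_horseshoe h ha hc c' hc'
      exact ⟨Y', P ⊞ Q, ky, b, h₁, hadd.biprod _ _ hP hQ, X', Z', i', p', h₂, hX', hZ'⟩
    · rintro Y ⟨X, Z, i, p, h, hX, hZ⟩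
      obtain ⟨P, X', a, kx, ha, hP, hX'⟩ := gorenstein_cogenerator h𝒲 X hX
      obtain ⟨Q, Z', c, kz, hc, hQ, hZ'⟩ := gorenstein_cogenerator h𝒲 Z hZ
      obtain ⟨a', ha'⟩ := h.exists_desc (gorenstein_ext_left h𝒲 _ _ hZ hP 1 le_rfl) a
      obtain ⟨Y', b, ky, i', p', h₁, h₂⟩ := exists_dual_horseshoe h ha hc a' ha'
      exact ⟨P ⊞ Q, Y', b, ky, h₁, hadd.biprod _ _ hP hQ, X', Z', i', p', h₂, hX', hZ'⟩

/-- The comparison sequence for `𝒲` and `𝒢(𝒲)`, where `𝒲` is self-orthogonal. -/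
theorem comparison_gorenstein (hadd : IsAdditiveSubcategory 𝒲) (h𝒲 : Perp.{u, v, w} 𝒲 𝒲) :
    CohomologyWellDefined 𝒲 (gorenstein 𝒲) ∧ Nonempty (ComparisonSequence 𝒲 (gorenstein 𝒲)) := by
  refine comparison_of_generator_cogenerator.{u, v, w} hadd (le_gorenstein hadd.zero h𝒲)
    (gorenstein_extensions hadd h𝒲) ⟨fun X hX => ?_, gorenstein_ext_left h𝒲⟩
    ⟨fun X hX => ?_, gorenstein_ext_right h𝒲⟩
  · obtain ⟨W, X', i, p, h, hW, hX'⟩ := gorenstein_cogenerator h𝒲 X hX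
    exact ⟨W, X', i, p, h.w, h.2, hW, hX'⟩
  · obtain ⟨X', W, i, p, h, hW, hX'⟩ := gorenstein_generator h𝒲 X hX
    exact ⟨X', W, i, p, h.w, h.2, hW, hX'⟩

end Syzygies

end Gorenstein

/-! ### Semidualizing modules -/

section Semidualizing

variable {R : Type r} [CommRing R]

theorem isShortExact_ofHom {X Y Z : Type r} [AddCommGroup X] [AddCommGroup Y] [AddCommGroup Z]
    [Module R X] [Module R Y] [Module R Z] {f : X →ₗ[R] Y} {g : Y →ₗ[R] Z}
    (hf : Function.Injective f) (hfg : Function.Exact f g) (hg : Function.Surjective g) :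
    IsShortExact (ModuleCat.ofHom f) (ModuleCat.ofHom g) := by
  have w : ModuleCat.ofHom f ≫ ModuleCat.ofHom g = 0 := by
    ext x
    exact hfg.apply_apply_eq_zero x
  exact .of_exact w ((ShortComplex.ShortExact.moduleCat_exact_iff_function_exact _).2 hfg)
    ((ModuleCat.mono_iff_injective _).2 hf) ((ModuleCat.epi_iff_surjective _).2 hg)

theorem IsShortExact.function_exact {X Y Z : ModuleCat.{r} R} {i : X ⟶ Y} {p : Y ⟶ Z}
    (h : IsShortExact i p) : Function.Exact i p :=
  (ShortComplex.ShortExact.moduleCat_exact_iff_function_exact _).1 h.exact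

theorem IsShortExact.injective {X Y Z : ModuleCat.{r} R} {i : X ⟶ Y} {p : Y ⟶ Z}
    (h : IsShortExact i p) : Function.Injective i :=
  (ModuleCat.mono_iff_injective _).1 h.mono

theorem IsShortExact.surjective {X Y Z : ModuleCat.{r} R} {i : X ⟶ Y} {p : Y ⟶ Z}
    (h : IsShortExact i p) : Function.Surjective p :=
  (ModuleCat.epi_iff_surjective _).1 h.epi

theorem ext_eq_zero_of_projective (F M : ModuleCat.{r} R) [Module.Projective R F] {m : ℕ}
    (hm : 1 ≤ m) : Subsingleton (Abelian.Ext.{r} F M m) := by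
  obtain ⟨k, rfl⟩ : ∃ k, m = k + 1 := ⟨m - 1, by lia⟩
  exact Abelian.Ext.subsingleton_of_projective F M k

/-- Direct sums in the first argument: `Ext(X, M) = 0` implies `Ext(X^(J), M) = 0`, by dimension
shift along direct sums of a free presentation. -/
theorem ext_finsupp_left (J : Type r) (M : ModuleCat.{r} R) {m : ℕ} (hm : 1 ≤ m) :
    ∀ X : ModuleCat.{r} R, Subsingleton (Abelian.Ext.{r} X M m) →
      Subsingleton (Abelian.Ext.{r} (ModuleCat.of R (J →₀ X)) M m) := by
  have presentation : ∀ X : ModuleCat.{r} R, ∃ (K F : ModuleCat.{r} R) (i : K ⟶ F) (p : F ⟶ X),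
      Module.Free R F ∧ IsShortExact i p := fun X => by
    let p : ModuleCat.of R (X →₀ R) ⟶ X := ModuleCat.ofHom (Finsupp.linearCombination R id)
    have : Epi p := (ModuleCat.epi_iff_surjective _).2 (Finsupp.linearCombination_id_surjective R X)
    exact ⟨_, _, _, p, inferInstanceAs (Module.Free R (X →₀ R)), .kernel p⟩
  have sum : ∀ {K F X : ModuleCat.{r} R} {i : K ⟶ F} {p : F ⟶ X}, IsShortExact i p →
      IsShortExact (ModuleCat.ofHom (Finsupp.mapRange.linearMap (α := J) i.hom))
        (ModuleCat.ofHom (Finsupp.mapRange.linearMap (α := J) p.hom)) := fun h => by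
    refine isShortExact_ofHom ?_ ?_ ?_
    · exact Finsupp.mapRange_injective _ (map_zero _) h.injective
    · rw [LinearMap.exact_iff, Finsupp.ker_mapRange, Finsupp.range_mapRange_linearMap _
        (LinearMap.ker_eq_bot.2 h.injective), LinearMap.exact_iff.1 h.function_exact]
    · exact Finsupp.mapRange_surjective _ (map_zero _) h.surjective
  induction m, hm using Nat.le_induction with
  | base =>
    intro X hX
    obtain ⟨K, F, i, p, hF, h⟩ := presentation X
    refine (sum h).ext_one_eq_zero_left (ext_eq_zero_of_projective _ _ le_rfl) fun f => ?_
    choose g hg using fun j => h.exists_desc hX (ModuleCat.ofHom (f.hom ∘ₗ Finsupp.lsingle j))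
    refine ⟨ModuleCat.ofHom (Finsupp.lsum ℕ fun j => (g j).hom), ?_⟩
    ext j x
    have := ConcreteCategory.congr_hom (hg j) x
    simpa using this
  | succ m hm ih =>
    intro X hX
    obtain ⟨K, F, i, p, hF, h⟩ := presentation X
    exact (sum h).ext_eq_zero_left₃
      (ih K (h.ext_eq_zero_left₁ (ext_eq_zero_of_projective F M hm) hX))
      (ext_eq_zero_of_projective _ _ (by lia))

/-- If `Ext¹(X, C) = 0`, then a map from the finitely generated kernel of `F → X` to a direct sum of
copies of `C` extends to `F`, because it takes values in a finite subsum. -/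
theorem exists_desc_finsupp {J : Type r} {C K F X : ModuleCat.{r} R} {i : K ⟶ F} {p : F ⟶ X}
    (h : IsShortExact i p) (hX : Subsingleton (Abelian.Ext.{r} X C 1)) [Module.Finite R K]
    (f : K ⟶ ModuleCat.of R (J →₀ C)) : ∃ g : F ⟶ ModuleCat.of R (J →₀ C), i ≫ g = f := by
  classical
  obtain ⟨s, hs⟩ := Module.Finite.fg_top (R := R) (M := K)
  obtain ⟨φ, rfl⟩ : ∃ φ : K →ₗ[R] (J →₀ C), f = ModuleCat.ofHom φ := ⟨f.hom, rfl⟩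
  choose g hg using fun j => h.exists_desc hX (ModuleCat.ofHom (Finsupp.lapply j ∘ₗ φ))
  -- the components of `f` outside the finite set `t` vanish
  let t : Finset J := s.biUnion fun x => (φ x).support
  have ht : ∀ j ∉ t, ∀ x : K, φ x j = 0 := by
    intro j hj x
    have : LinearMap.range φ ≤ LinearMap.ker (Finsupp.lapply j : (J →₀ C) →ₗ[R] C) := by
      rw [LinearMap.range_eq_map, ← hs, Submodule.map_span_le]
      intro y hy
      by_contra hne
      exact hj (Finset.mem_biUnion.2 ⟨y, hy, Finsupp.mem_support_iff.2 hne⟩)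
    exact this ⟨x, rfl⟩
  refine ⟨ModuleCat.ofHom (∑ j ∈ t, Finsupp.lsingle j ∘ₗ (g j).hom), ?_⟩
  ext x k
  have hgx : ∀ j, (g j).hom (i x) = φ x j := fun j => ConcreteCategory.congr_hom (hg j) x
  change (∑ j ∈ t, Finsupp.lsingle j ∘ₗ (g j).hom) (i x) k = φ x k
  simp only [LinearMap.sum_apply, LinearMap.comp_apply, hgx, Finsupp.lsingle_apply,
    Finsupp.finsetSum_apply, Finsupp.single_apply, Finset.sum_ite_eq']
  split_ifs with hk
  · rfl
  · exact (ht k hk x).symm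

/-- If `C` has a resolution by free modules of finite rank and is self-orthogonal, then `C` is
orthogonal to all direct sums of copies of `C`. The syzygies of `C` are finitely generated, so that
`exists_desc_finsupp` applies to them after a dimension shift. -/
theorem ext_finsupp_right (J : Type r) {C : ModuleCat.{r} R} (X : Resolution (finiteFree R) C)
    (hC : ∀ m : ℕ, 1 ≤ m → Subsingleton (Abelian.Ext.{r} C C m)) {m : ℕ} (hm : 1 ≤ m) :
    Subsingleton (Abelian.Ext.{r} C (ModuleCat.of R (J →₀ C)) m) := by
  let Z : ℤ → ModuleCat.{r} R := fun n => cokernel (X.cx.d (n + 1) n)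
  have hproj : ∀ n, Module.Projective R (X.cx.X n) := fun n =>
    have := (X.mem n).2
    inferInstance
  have hfin : ∀ n, Module.Finite R (Z n) := fun n =>
    have := (X.mem n).1
    Module.Finite.of_surjective (cokernel.π (X.cx.d (n + 1) n)).hom
      ((ModuleCat.epi_iff_surjective _).1 inferInstance)
  have hs : ∀ n, 0 ≤ n → IsShortExact
      (cokernel.desc (X.cx.d (n + 1 + 1) (n + 1)) (X.cx.d (n + 1) n) (X.cx.d_comp_d _ _ _))
      (cokernel.π (X.cx.d (n + 1) n)) := fun n hn =>
    isShortExact_cokernel_desc ((exactAt_succ_iff _ _).1 (X.exact_pos (n + 1) (by lia)))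
  have key : ∀ n, 0 ≤ n → Subsingleton (Abelian.Ext.{r} (Z n) C m) →
      Subsingleton (Abelian.Ext.{r} (Z n) (ModuleCat.of R (J →₀ C)) m) := by
    induction m, hm using Nat.le_induction with
    | base =>
      intro n hn h
      have := hfin (n + 1)
      exact (hs n hn).ext_one_eq_zero_left (ext_eq_zero_of_projective _ _ le_rfl)
        (exists_desc_finsupp (hs n hn) h)
    | succ m hm ih =>
      intro n hn h
      exact (hs n hn).ext_eq_zero_left₃ (ih (n + 1) (by lia)
        ((hs n hn).ext_eq_zero_left₁ (ext_eq_zero_of_projective _ _ hm) h))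
        (ext_eq_zero_of_projective _ _ (by lia))
  have := X.epi_π
  let e : C ≅ Z 0 := IsColimit.coconePointUniqueUpToIso X.exact_zero.gIsCokernel
    (colimit.isColimit _)
  exact ext_eq_zero_of_retract_left e.retract
    (key 0 le_rfl (ext_eq_zero_of_retract_left e.symm.retract (hC m hm)))

/-- The objects of `𝒫_C` are the direct summands of direct sums of copies of `C`. -/
theorem cProjective.exists_retract {C V : ModuleCat.{r} R} (hV : cProjective C V) :
    ∃ J : Type r, Nonempty (Retract V (ModuleCat.of R (J →₀ C))) := by
  classical
  obtain ⟨P, hP, ⟨e⟩⟩ := hV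
  obtain ⟨s, hs⟩ := Module.projective_def'.1 hP
  let e' := TensorProduct.finsuppScalarLeft R C P
  refine ⟨P, ⟨⟨ModuleCat.ofHom (e'.toLinearMap ∘ₗ s.rTensor C ∘ₗ e.toLinearMap),
    ModuleCat.ofHom (e.symm.toLinearMap ∘ₗ (Finsupp.linearCombination R id).rTensor C ∘ₗ
      e'.symm.toLinearMap), ?_⟩⟩⟩
  ext x
  have := congrArg (fun f => f.rTensor C (e x)) hs
  simp only [LinearMap.rTensor_comp, LinearMap.rTensor_id, LinearMap.comp_apply,
    LinearMap.id_apply] at this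
  simp [this]

theorem perp_cProjective {C : ModuleCat.{r} R} (hC : IsSemidualizing C) :
    Perp.{r + 1, r, r} (cProjective C) (cProjective C) := by
  intro V W hV hW m hm
  obtain ⟨J, ⟨ρ⟩⟩ := hV.exists_retract
  obtain ⟨J', ⟨ρ'⟩⟩ := hW.exists_retract
  obtain ⟨X⟩ := hC.resolution
  exact ext_eq_zero_of_retract_left ρ (ext_eq_zero_of_retract_right ρ'
    (ext_finsupp_left J _ hm C (ext_finsupp_right J' X hC.ext_eq_zero hm)))

theorem isAdditiveSubcategory_cProjective (C : ModuleCat.{r} R) :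
    IsAdditiveSubcategory (cProjective C) where
  iso := ⟨fun e ⟨P, hP, ⟨f⟩⟩ => ⟨P, hP, ⟨e.symm.toLinearEquiv ≪≫ₗ f⟩⟩⟩
  zero := ⟨ModuleCat.of R PUnit, ModuleCat.isZero_of_subsingleton _, ModuleCat.of R PUnit,
    inferInstanceAs (Module.Projective R PUnit.{r + 1}), ⟨0, 0, fun _ => rfl, fun _ => Subsingleton.elim _ _⟩⟩
  biprod := by
    rintro X Y ⟨P, hP, ⟨f⟩⟩ ⟨Q, hQ, ⟨g⟩⟩
    exact ⟨ModuleCat.of R (P × Q), inferInstanceAs (Module.Projective R (P × Q)),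
      ⟨(ModuleCat.biprodIsoProd X Y).toLinearEquiv ≪≫ₗ f.prodCongr g ≪≫ₗ
        (TensorProduct.prodLeft R R P Q C).symm⟩⟩

end Semidualizing

end

end TateCohomology

theorem theoremB :
    (∀ (A : Type u) [Category.{v} A] [Abelian A] [HasExt.{w} A] (𝒲 𝒳 : ObjectProperty A),
      IsAdditiveSubcategory 𝒲 → 𝒲.IsStableUnderRetracts → 𝒲 ≤ 𝒳 →
      IsExactSubcategory 𝒳 → ClosedUnderKernelsOfEpis 𝒳 →
      IsInjectiveCogenerator.{u, v, w} 𝒲 𝒳 → IsProjectiveGenerator.{u, v, w} 𝒲 𝒳 →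
      CohomologyWellDefined 𝒲 𝒳 ∧ Nonempty (ComparisonSequence 𝒲 𝒳)) ∧
    (∀ (R : Type r) [CommRing R] (C : ModuleCat.{r} R), IsSemidualizing C →
      CohomologyWellDefined (cProjective C) (gorenstein (cProjective C)) ∧
      Nonempty (ComparisonSequence (cProjective C) (gorenstein (cProjective C)))) :=
  ⟨fun _ _ _ _ _ _ h𝒲 _ hle h𝒳 _ hi hp =>
    comparison_of_generator_cogenerator h𝒲 hle h𝒳.extensions hi hp,
    fun _ _ C hC => comparison_gorenstein (isAdditiveSubcategory_cProjective C)
      (perp_cProjective hC)⟩
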